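/- **Setting.** Let $C$ and $E$ be cocomplete categories with finite limits. Let $S$ be a monad on $C$ and $T$ a monad on $E$. Both monads are finitary (they preserve filtered colimits) and cartesian (they preserve pullbacks, and all naturality squares of the unit and the multiplication are pullbacks). Let $w:C\to E$ be a functor with left adjoint $c$, and let $d:Alg_S\to Alg_T$ be a functor with $U^Td\cong wU^S$, where $U$ denotes the forgetful functors from algebras and $\mathcal F$ their left adjoints. Put $G=\mathcal F^S c$, which is left adjoint to $wU^S\cong U^Td$. The unit of this adjunction and the $T$-algebra structure of $U^Td$ give a map $T\to wU^SG$. Its transpose is a right action $\lambda:G\,T\to G$ of $T$ on $G$. Assume that $\lambda$ is cartesian, that is, all its naturality squares are pullbacks. A categorical $T$-algebra is an internal category in $Alg_T$; with internal functors (strict morphisms) and internal natural transformations these form a $2$-category $\mathbf{CAlg}_T$. An internal $T$-algebra in a categorical $T$-algebra $B$ is a lax morphism $1\to B$ from the terminal categorical $T$-algebra, where the structure cell of a lax morphism $f:A\to B$ goes from $TA\to TB\to B$ to $TA\to A\to B$. With transformations of lax morphisms these form the category $IAlg_T(B)$, which is the value of a $2$-functor $IAlg_T:\mathbf{CAlg}_T\to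 Cat$. Put $IAlg^S_T(A)=IAlg_T(d(A))$, a $2$-functor $\mathbf{CAlg}_S\to Cat$. Applying $d$ to lax morphisms $1\to A$ and using $d(1)=1$ gives functors $\delta_A:IAlg_S(A)\to IAlg^S_T(A)$. For a functor $K$ with a right action of $T$ and a $T$-algebra $X$, the two-sided bar construction $B_\star(K,T,X)$ is $KT^nX$ in degree $n$. Its face $d_0$ is the action on $K$, its further faces are given by the multiplication of $T$ and, for the last one, by the structure map of $X$, and its degeneracies are given by the unit of $T$. In the nerve of an internal category, the face $d_0$ of a $1$-simplex is its source and $d_1$ its target. **Theorem.** 1. The functor $d$ has a left adjoint $p:Alg_T\to Alg_S$. 2. The $2$-functor $IAlg_T$ is representable (by a strictly $2$-natural isomorphism of categories) by a categorical $T$-algebra $H^T$ whose nerve is the cotriple resolution $B_\star(\mathcal F^T,T,1)$ of the terminal $T$-algebra. For every left adjoint $p$ of $d$, the $2$-functor $IAlg^S_T$ is representable by a categorical $S$-algebra $h^T=p(H^T)$: its nerve is the image under $p$ of the nerve of $H^T$, and this image is isomorphic to the two-sided bar construction $B_\star(G,T,1)$. Likewise $IAlg_S$ is representable by a categorical $S$-algebra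 $H^S$ with nerve $B_\star(\mathcal F^S,S,1)$. 3. Let $H^S$ and $h^T$ represent $IAlg_S$ and $IAlg^S_T$, and let $\zeta:h^T\to H^S$ be the map that classifies the image under $\delta$ of the canonical internal $S$-algebra in $H^S$ (the one corresponding to the identity of $H^S$). Under the representing isomorphisms, $\delta_A$ is the restriction functor $\zeta^\star:\mathbf{CAlg}_S(H^S,A)\to\mathbf{CAlg}_S(h^T,A)$ for every categorical $S$-algebra $A$. 4. The left adjoint to $\delta$ is left Kan extension along $\zeta$ in the $2$-category $\mathbf{CAlg}_S$. Precisely, for every categorical $S$-algebra $A$: if $L$ is left adjoint to $\delta_A$ and $f:h^T\to A$, then the map $H^S\to A$ which classifies the value of $L$ on the internal $T$-algebra classified by $f$, with the $2$-cell given by the unit of the adjunction, is a left Kan extension of $f$ along $\zeta$. Moreover, $\delta_A$ has a left adjoint if and only if every $f:h^T\to A$ has a left Kan extension along $\zeta$. -/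

import Mathlib

open CategoryTheory Limits Opposite Bicategory

universe v u u' u₁ u₂

noncomputable section

/-- An internal category in `C`. Rather than using a chosen pullback, the object of composable
pairs is a field together with the proof that it is a pullback of `tgt` and `src`.
Composition is in diagrammatic order: `fst` is followed by `snd`. Associativity is expressed
on generalized arrows. -/
structure InternalCat (C : Type u) [Category.{v} C] where
  obj : C
  mor : C
  pairs : C
  src : mor ⟶ obj
  tgt : mor ⟶ obj
  ident : obj ⟶ mor
  fst : pairs ⟶ mor
  snd : pairs ⟶ mor
  comp : pairs ⟶ mor
  isPullback : IsPullback fst snd tgt src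
  ident_src : ident ≫ src = 𝟙 obj
  ident_tgt : ident ≫ tgt = 𝟙 obj
  comp_src : comp ≫ src = fst ≫ src
  comp_tgt : comp ≫ tgt = snd ≫ tgt
  id_comp : isPullback.lift (src ≫ ident) (𝟙 mor) (by simp [ident_tgt]) ≫ comp = 𝟙 mor
  comp_id : isPullback.lift (𝟙 mor) (tgt ≫ ident) (by simp [ident_src]) ≫ comp = 𝟙 mor
  assoc : ∀ {X : C} (f g h : X ⟶ mor) (hfg : f ≫ tgt = g ≫ src) (hgh : g ≫ tgt = h ≫ src),
    isPullback.lift (isPullback.lift f g hfg ≫ comp) h (by simp [comp_tgt, hgh]) ≫ comp =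
      isPullback.lift f (isPullback.lift g h hgh ≫ comp) (by simp [comp_src, hfg]) ≫ comp

namespace InternalCat

attribute [simp] ident_src ident_tgt comp_src comp_tgt

section Basic

variable {C : Type u} [Category.{v} C] (A : InternalCat C)

@[simp]
theorem ident_src_assoc {Z : C} (h : A.obj ⟶ Z) : A.ident ≫ A.src ≫ h = h := by
  rw [← Category.assoc, ident_src, Category.id_comp]

@[simp]
theorem ident_tgt_assoc {Z : C} (h : A.obj ⟶ Z) : A.ident ≫ A.tgt ≫ h = h := by
  rw [← Category.assoc, ident_tgt, Category.id_comp]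

/-- The composite of two composable generalized arrows. -/
def cmp {X : C} (f g : X ⟶ A.mor) (h : f ≫ A.tgt = g ≫ A.src) : X ⟶ A.mor :=
  A.isPullback.lift f g h ≫ A.comp

@[simp]
theorem cmp_src {X : C} (f g : X ⟶ A.mor) (h : f ≫ A.tgt = g ≫ A.src) :
    A.cmp f g h ≫ A.src = f ≫ A.src := by simp [cmp]

@[simp]
theorem cmp_tgt {X : C} (f g : X ⟶ A.mor) (h : f ≫ A.tgt = g ≫ A.src) :
    A.cmp f g h ≫ A.tgt = g ≫ A.tgt := by simp [cmp]

theorem precomp_cmp {X Y : C} (k : Y ⟶ X) (f g : X ⟶ A.mor) (h : f ≫ A.tgt = g ≫ A.src) :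
    k ≫ A.cmp f g h = A.cmp (k ≫ f) (k ≫ g) (by simp [h]) := by
  rw [cmp, cmp, ← Category.assoc]
  congr 1
  apply A.isPullback.hom_ext <;> simp

theorem cmp_congr {X : C} {f f' g g' : X ⟶ A.mor} (hf : f = f') (hg : g = g')
    (h : f ≫ A.tgt = g ≫ A.src) (h' : f' ≫ A.tgt = g' ≫ A.src) :
    A.cmp f g h = A.cmp f' g' h' := by
  subst hf hg; rfl

theorem cmp_assoc {X : C} (f g h : X ⟶ A.mor) (hfg : f ≫ A.tgt = g ≫ A.src)
    (hgh : g ≫ A.tgt = h ≫ A.src) :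
    A.cmp (A.cmp f g hfg) h (by simp [hgh]) = A.cmp f (A.cmp g h hgh) (by simp [hfg]) :=
  A.assoc f g h hfg hgh

theorem id_cmp {X : C} (x : X ⟶ A.obj) (f : X ⟶ A.mor) (h : (x ≫ A.ident) ≫ A.tgt = f ≫ A.src) :
    A.cmp (x ≫ A.ident) f h = f := by
  have hx : x = f ≫ A.src := by simpa using h
  subst hx
  have := congrArg (fun k => f ≫ k) A.id_comp
  rw [← Category.assoc] at this
  simp only [Category.comp_id] at this
  refine Eq.trans ?_ this
  rw [cmp]
  congr 1
  apply A.isPullback.hom_ext <;> simp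

theorem cmp_id {X : C} (f : X ⟶ A.mor) (x : X ⟶ A.obj) (h : f ≫ A.tgt = (x ≫ A.ident) ≫ A.src) :
    A.cmp f (x ≫ A.ident) h = f := by
  have hx : x = f ≫ A.tgt := by simpa using h.symm
  subst hx
  have := congrArg (fun k => f ≫ k) A.comp_id
  rw [← Category.assoc] at this
  simp only [Category.comp_id] at this
  refine Eq.trans ?_ this
  rw [cmp]
  congr 1
  apply A.isPullback.hom_ext <;> simp

theorem comp_eq_cmp : A.comp = A.cmp A.fst A.snd A.isPullback.w := by
  have : A.isPullback.lift A.fst A.snd A.isPullback.w = 𝟙 _ := by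
    apply A.isPullback.hom_ext <;> simp
  rw [cmp, this, Category.id_comp]

end Basic

/-- Internal functors. -/
@[ext]
structure Fun {C : Type u} [Category.{v} C] (A B : InternalCat C) where
  obj : A.obj ⟶ B.obj
  mor : A.mor ⟶ B.mor
  mor_src : mor ≫ B.src = A.src ≫ obj
  mor_tgt : mor ≫ B.tgt = A.tgt ≫ obj
  ident_mor : A.ident ≫ mor = obj ≫ B.ident
  comp_mor : A.comp ≫ mor = B.cmp (A.fst ≫ mor) (A.snd ≫ mor)
    (by rw [Category.assoc, Category.assoc, mor_tgt, mor_src, ← Category.assoc, ← Category.assoc,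
      A.isPullback.w])

attribute [simp] Fun.mor_src Fun.mor_tgt Fun.ident_mor

/-- Internal natural transformations `F ⇒ G`: a morphism from the objects of the domain to the
arrows of the codomain. -/
@[ext]
structure Trans {C : Type u} [Category.{v} C] {A B : InternalCat C} (F G : Fun A B) where
  app : A.obj ⟶ B.mor
  app_src : app ≫ B.src = F.obj
  app_tgt : app ≫ B.tgt = G.obj
  naturality : B.cmp F.mor (A.tgt ≫ app) (by simp [app_src]) =
    B.cmp (A.src ≫ app) G.mor (by simp [app_tgt])

attribute [simp] Trans.app_src Trans.app_tgt

section TwoCat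

variable {C : Type u} [Category.{v} C]

theorem Fun.cmp_mor {A B : InternalCat C} (F : Fun A B) {X : C} (f g : X ⟶ A.mor)
    (h : f ≫ A.tgt = g ≫ A.src) :
    A.cmp f g h ≫ F.mor = B.cmp (f ≫ F.mor) (g ≫ F.mor)
      (by simp only [Category.assoc, mor_tgt, mor_src]; rw [← Category.assoc, h, Category.assoc]) := by
  rw [cmp, Category.assoc, F.comp_mor, precomp_cmp]
  congr 1 <;> simp [← Category.assoc]

theorem Trans.naturality_at {A B : InternalCat C} {F G : Fun A B} (θ : Trans F G) {X : C}
    (f : X ⟶ A.mor) :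
    B.cmp (f ≫ F.mor) (f ≫ A.tgt ≫ θ.app) (by simp) =
      B.cmp (f ≫ A.src ≫ θ.app) (f ≫ G.mor) (by simp) := by
  have := congrArg (fun k => f ≫ k) θ.naturality
  simpa only [precomp_cmp] using this

instance : CategoryStruct (InternalCat C) where
  Hom A B := Fun A B
  id A := 
    { obj := 𝟙 _
      mor := 𝟙 _
      mor_src := by simp
      mor_tgt := by simp
      ident_mor := by simp
      comp_mor := by simpa using A.comp_eq_cmp }
  comp {A B D} F G :=
    { obj := F.obj ≫ G.obj
      mor := F.mor ≫ G.mor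
      mor_src := by 
        rw [Category.assoc, G.mor_src, ← Category.assoc, F.mor_src, Category.assoc]
      mor_tgt := by
        rw [Category.assoc, G.mor_tgt, ← Category.assoc, F.mor_tgt, Category.assoc]
      ident_mor := by
        rw [← Category.assoc, F.ident_mor, Category.assoc, G.ident_mor, Category.assoc]
      comp_mor := by
        rw [← Category.assoc, F.comp_mor, G.cmp_mor]
        simp only [Category.assoc] }

@[simp] theorem id_obj (A : InternalCat C) : Fun.obj (𝟙 A) = 𝟙 A.obj := rfl
@[simp] theorem id_mor (A : InternalCat C) : Fun.mor (𝟙 A) = 𝟙 A.mor := rfl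
@[simp] theorem comp_obj {A B D : InternalCat C} (F : A ⟶ B) (G : B ⟶ D) :
    Fun.obj (F ≫ G) = Fun.obj F ≫ Fun.obj G := rfl
@[simp] theorem comp_mor' {A B D : InternalCat C} (F : A ⟶ B) (G : B ⟶ D) :
    Fun.mor (F ≫ G) = Fun.mor F ≫ Fun.mor G := rfl

theorem hom_ext {A B : InternalCat C} {F G : A ⟶ B} (h₀ : Fun.obj F = Fun.obj G)
    (h₁ : Fun.mor F = Fun.mor G) : F = G := Fun.ext h₀ h₁

instance (A B : InternalCat C) : Category (A ⟶ B) where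
  Hom F G := Trans F G
  id F :=
    { app := Fun.obj F ≫ B.ident
      app_src := by simp
      app_tgt := by simp
      naturality := by
        have h₁ := B.cmp_id (Fun.mor F) (A.tgt ≫ Fun.obj F) (by simp)
        have h₂ := B.id_cmp (A.src ≫ Fun.obj F) (Fun.mor F) (by simp)
        simp only [Category.assoc] at h₁ h₂
        rw [h₁, h₂] }
  comp {F G H} θ κ :=
    { app := B.cmp θ.app κ.app (by simp)
      app_src := by simp
      app_tgt := by simp
      naturality := by
        simp only [precomp_cmp]
        rw [← cmp_assoc _ _ _ _ (by simp) (by simp)]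
        simp only [θ.naturality]
        rw [cmp_assoc _ _ _ _ (by simp) (by simp)]
        simp only [κ.naturality]
        rw [cmp_assoc _ _ _ _ (by simp) (by simp)] }
  id_comp θ := Trans.ext (B.id_cmp _ _ _)
  comp_id θ := Trans.ext (B.cmp_id _ _ _)
  assoc θ κ l := Trans.ext (B.cmp_assoc _ _ _ _ _)

variable {A B D : InternalCat C}

@[simp] theorem id_app (F : A ⟶ B) : Trans.app (𝟙 F) = Fun.obj F ≫ B.ident := rfl

theorem comp_app {F G H : A ⟶ B} (θ : F ⟶ G) (κ : G ⟶ H) :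
    Trans.app (θ ≫ κ) = B.cmp (Trans.app θ) (Trans.app κ)
      ((Trans.app_tgt θ).trans (Trans.app_src κ).symm) := rfl

theorem trans_ext {F G : A ⟶ B} {θ κ : F ⟶ G} (h : Trans.app θ = Trans.app κ) : θ = κ :=
  Trans.ext h

@[simp] theorem eqToHom_app {F G : A ⟶ B} (h : F = G) :
    Trans.app (eqToHom h) = Fun.obj F ≫ B.ident := by
  subst h; rfl

/-- Whiskering on the left. -/
def whiskerL (F : A ⟶ B) {G H : B ⟶ D} (θ : G ⟶ H) : (F ≫ G) ⟶ (F ≫ H) :=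
  { app := Fun.obj F ≫ Trans.app θ
    app_src := by rw [Category.assoc, Trans.app_src]; rfl
    app_tgt := by rw [Category.assoc, Trans.app_tgt]; rfl
    naturality := by
      have := Trans.naturality_at θ (Fun.mor F)
      simp only [← Category.assoc, Fun.mor_src, Fun.mor_tgt] at this
      simpa using this : Trans (F ≫ G) (F ≫ H) }

/-- Whiskering on the right. -/
def whiskerR {F G : A ⟶ B} (θ : F ⟶ G) (H : B ⟶ D) : (F ≫ H) ⟶ (G ≫ H) :=
  { app := Trans.app θ ≫ Fun.mor H
    app_src := by rw [Category.assoc, Fun.mor_src, ← Category.assoc, Trans.app_src]; rfl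
    app_tgt := by rw [Category.assoc, Fun.mor_tgt, ← Category.assoc, Trans.app_tgt]; rfl
    naturality := by
      have := congrArg (fun k => k ≫ Fun.mor H) (Trans.naturality θ)
      simp only [Fun.cmp_mor, Category.assoc] at this
      simpa using this : Trans (F ≫ H) (G ≫ H) }

@[simp] theorem whiskerL_app (F : A ⟶ B) {G H : B ⟶ D} (θ : G ⟶ H) :
    Trans.app (whiskerL F θ) = Fun.obj F ≫ Trans.app θ := rfl

@[simp] theorem whiskerR_app {F G : A ⟶ B} (θ : F ⟶ G) (H : B ⟶ D) :
    Trans.app (whiskerR θ H) = Trans.app θ ≫ Fun.mor H := rfl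

theorem comp_eqToHom_app {F G H : A ⟶ B} (θ : F ⟶ G) (h : G = H) :
    Trans.app (θ ≫ eqToHom h) = Trans.app θ := by
  subst h; simp

theorem eqToHom_comp_app {F G H : A ⟶ B} (h : F = G) (θ : G ⟶ H) :
    Trans.app (eqToHom h ≫ θ) = Trans.app θ := by
  subst h; simp

theorem whiskerL_eqToHom (F : A ⟶ B) {G H : B ⟶ D} (h : G = H) :
    whiskerL F (eqToHom h) = eqToHom (by rw [h]) := by
  subst h; exact trans_ext (by simp)

theorem whiskerR_eqToHom {F G : A ⟶ B} (h : F = G) (H : B ⟶ D) :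
    whiskerR (eqToHom h) H = eqToHom (by rw [h]) := by
  subst h; exact trans_ext (by simp)

/-- The `2`-category of internal categories in `C`. -/
instance : Bicategory (InternalCat C) where
  whiskerLeft F _ _ θ := whiskerL F θ
  whiskerRight θ H := whiskerR θ H
  associator F G H := eqToIso (hom_ext (by simp) (by simp))
  leftUnitor F := eqToIso (hom_ext (by simp) (by simp))
  rightUnitor F := eqToIso (hom_ext (by simp) (by simp))
  whiskerLeft_id F G := by
    refine trans_ext ?_
    rw [whiskerL_app]; simp
  whiskerLeft_comp F _ _ _ θ κ := by
    refine trans_ext ?_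
    rw [whiskerL_app, comp_app, comp_app, precomp_cmp]; rfl
  id_whiskerLeft θ := by
    refine trans_ext ?_
    simp only [eqToIso.hom, eqToIso.inv, eqToHom_comp_app, comp_eqToHom_app, whiskerL_app,
      id_obj, Category.id_comp]
  comp_whiskerLeft F G _ _ θ := by
    refine trans_ext ?_
    simp only [eqToIso.hom, eqToIso.inv, eqToHom_comp_app, comp_eqToHom_app, whiskerL_app,
      comp_obj, Category.assoc]
  id_whiskerRight F G := by
    refine trans_ext ?_
    rw [whiskerR_app]; simp
  comp_whiskerRight θ κ H := by
    refine trans_ext ?_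
    rw [whiskerR_app, comp_app, comp_app, Fun.cmp_mor]; rfl
  whiskerRight_id θ := by
    refine trans_ext ?_
    simp only [eqToIso.hom, eqToIso.inv, eqToHom_comp_app, comp_eqToHom_app, whiskerR_app,
      id_mor, Category.comp_id]
  whiskerRight_comp θ F G := by
    refine trans_ext ?_
    simp only [eqToIso.hom, eqToIso.inv, eqToHom_comp_app, comp_eqToHom_app, whiskerR_app,
      comp_mor', Category.assoc]
  whisker_assoc F _ _ θ H := by
    refine trans_ext ?_
    simp only [eqToIso.hom, eqToIso.inv, eqToHom_comp_app, comp_eqToHom_app, whiskerR_app,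
      whiskerL_app, Category.assoc]
  whisker_exchange {_ _ _ F G H I} θ κ := by
    refine trans_ext ?_
    simp only [comp_app, whiskerR_app, whiskerL_app]
    have := Trans.naturality_at κ (Trans.app θ)
    simp only [← Category.assoc, Trans.app_src, Trans.app_tgt] at this
    exact this.symm
  pentagon F G H K := by
    simp only [eqToIso.hom, whiskerR_eqToHom, whiskerL_eqToHom, eqToHom_trans]
  triangle F G := by
    simp only [eqToIso.hom, whiskerR_eqToHom, whiskerL_eqToHom, eqToHom_trans]

instance : Bicategory.Strict (InternalCat C) where
  id_comp F := hom_ext (by simp) (by simp)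
  comp_id F := hom_ext (by simp) (by simp)
  assoc F G H := hom_ext (by simp) (by simp)
  leftUnitor_eqToIso F := rfl
  rightUnitor_eqToIso F := rfl
  associator_eqToIso F G H := rfl

@[simp] theorem whiskerLeft_app (F : A ⟶ B) {G H : B ⟶ D} (θ : G ⟶ H) :
    Trans.app (F ◁ θ) = Fun.obj F ≫ Trans.app θ := rfl

@[simp] theorem whiskerRight_app {F G : A ⟶ B} (θ : F ⟶ G) (H : B ⟶ D) :
    Trans.app (θ ▷ H) = Trans.app θ ≫ Fun.mor H := rfl

end TwoCat

/-! ### Action of pullback-preserving functors -/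

section Map

variable {C : Type u} [Category.{v} C] {D : Type u'} [Category.{v} D]

theorem map_lift {X Y Z P : C} {f : P ⟶ X} {g : P ⟶ Y} {h : X ⟶ Z} {k : Y ⟶ Z}
    (hp : IsPullback f g h k) (F : C ⥤ D) [PreservesLimitsOfShape WalkingCospan F] {W : C}
    (a : W ⟶ X) (b : W ⟶ Y) (w : a ≫ h = b ≫ k) :
    F.map (hp.lift a b w) =
      (hp.map F).lift (F.map a) (F.map b) (by rw [← F.map_comp, w, F.map_comp]) := by
  apply (hp.map F).hom_ext <;> simp [← F.map_comp]

theorem precomp_lift {X Y Z P : C} {f : P ⟶ X} {g : P ⟶ Y} {h : X ⟶ Z} {k : Y ⟶ Z}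
    (hp : IsPullback f g h k) {W V : C} (t : V ⟶ W)
    (a : W ⟶ X) (b : W ⟶ Y) (w : a ≫ h = b ≫ k) :
    t ≫ hp.lift a b w = hp.lift (t ≫ a) (t ≫ b) (by simp [w]) := by
  apply hp.hom_ext <;> simp

/-- The levelwise image of an internal category under a pullback-preserving functor. -/
@[simps obj mor src tgt ident fst snd comp]
def mapObj [HasPullbacks C] (F : C ⥤ D) [PreservesLimitsOfShape WalkingCospan F] (A : InternalCat C) :
    InternalCat D where
  obj := F.obj A.obj
  mor := F.obj A.mor
  pairs := F.obj A.pairs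
  src := F.map A.src
  tgt := F.map A.tgt
  ident := F.map A.ident
  fst := F.map A.fst
  snd := F.map A.snd
  comp := F.map A.comp
  isPullback := A.isPullback.map F
  ident_src := by rw [← F.map_comp, ident_src, F.map_id]
  ident_tgt := by rw [← F.map_comp, ident_tgt, F.map_id]
  comp_src := by rw [← F.map_comp, comp_src, F.map_comp]
  comp_tgt := by rw [← F.map_comp, comp_tgt, F.map_comp]
  id_comp := by
    have := congrArg F.map A.id_comp
    simpa only [F.map_comp, map_lift, F.map_id] using this
  comp_id := by
    have := congrArg F.map A.comp_id
    simpa only [F.map_comp, map_lift, F.map_id] using this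
  assoc {X} f g h hfg hgh := by
    have hP := (IsPullback.of_hasPullback A.snd A.fst).map F
    have key := A.assoc (pullback.fst A.snd A.fst ≫ A.fst) (pullback.fst A.snd A.fst ≫ A.snd)
      (pullback.snd A.snd A.fst ≫ A.snd) (by simp [A.isPullback.w])
      (by rw [pullback.condition, Category.assoc, A.isPullback.w, Category.assoc])
    have ht₁ := hP.lift_fst ((A.isPullback.map F).lift f g hfg)
      ((A.isPullback.map F).lift g h hgh) (by simp)
    have ht₂ := hP.lift_snd ((A.isPullback.map F).lift f g hfg)
      ((A.isPullback.map F).lift g h hgh) (by simp)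
    generalize hP.lift _ _ _ = t at ht₁ ht₂
    have h₁ : t ≫ F.map (pullback.fst A.snd A.fst) ≫ F.map A.fst = f := by
      rw [← Category.assoc, ht₁, IsPullback.lift_fst]
    have h₂ : t ≫ F.map (pullback.fst A.snd A.fst) ≫ F.map A.snd = g := by
      rw [← Category.assoc, ht₁, IsPullback.lift_snd]
    have h₃ : t ≫ F.map (pullback.snd A.snd A.fst) ≫ F.map A.snd = h := by
      rw [← Category.assoc, ht₂, IsPullback.lift_snd]
    have key' := congrArg (fun k => t ≫ F.map k) key
    simp only [F.map_comp, map_lift, ← Category.assoc, precomp_lift] at key'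
    simpa only [Category.assoc, h₁, h₂, h₃] using key'

variable [HasPullbacks C]

theorem map_cmp (F : C ⥤ D) [PreservesLimitsOfShape WalkingCospan F] (A : InternalCat C)
    {X : C} (f g : X ⟶ A.mor) (h : f ≫ A.tgt = g ≫ A.src) :
    F.map (A.cmp f g h) = (mapObj F A).cmp (F.map f) (F.map g)
      (by
        change F.map f ≫ F.map A.tgt = F.map g ≫ F.map A.src
        rw [← F.map_comp, h, F.map_comp]) := by
  rw [cmp, F.map_comp, map_lift]; rfl

/-- The levelwise image of an internal functor. -/
def mapHom (F : C ⥤ D) [PreservesLimitsOfShape WalkingCospan F] {A B : InternalCat C}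
    (f : A ⟶ B) : mapObj F A ⟶ mapObj F B :=
  { obj := F.map (Fun.obj f)
    mor := F.map (Fun.mor f)
    mor_src := (F.map_comp _ _).symm.trans
      ((congrArg F.map (Fun.mor_src f)).trans (F.map_comp _ _))
    mor_tgt := (F.map_comp _ _).symm.trans
      ((congrArg F.map (Fun.mor_tgt f)).trans (F.map_comp _ _))
    ident_mor := (F.map_comp _ _).symm.trans
      ((congrArg F.map (Fun.ident_mor f)).trans (F.map_comp _ _))
    comp_mor := by
      have := congrArg F.map (Fun.comp_mor f)
      simp only [F.map_comp, map_cmp] at this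
      exact this : Fun (mapObj F A) (mapObj F B) }

@[simp] theorem mapHom_obj (F : C ⥤ D) [PreservesLimitsOfShape WalkingCospan F]
    {A B : InternalCat C} (f : A ⟶ B) : Fun.obj (mapHom F f) = F.map (Fun.obj f) := rfl

@[simp] theorem mapHom_mor (F : C ⥤ D) [PreservesLimitsOfShape WalkingCospan F]
    {A B : InternalCat C} (f : A ⟶ B) : Fun.mor (mapHom F f) = F.map (Fun.mor f) := rfl

/-- The levelwise image of an internal natural transformation. -/
def mapTrans (F : C ⥤ D) [PreservesLimitsOfShape WalkingCospan F] {A B : InternalCat C}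
    {f g : A ⟶ B} (θ : f ⟶ g) : mapHom F f ⟶ mapHom F g :=
  { app := F.map (Trans.app θ)
    app_src := (F.map_comp _ _).symm.trans (congrArg F.map (Trans.app_src θ))
    app_tgt := (F.map_comp _ _).symm.trans (congrArg F.map (Trans.app_tgt θ))
    naturality := by
      have := congrArg F.map (Trans.naturality θ)
      simp only [F.map_comp, map_cmp] at this
      exact this : Trans (mapHom F f) (mapHom F g) }

@[simp] theorem mapTrans_app (F : C ⥤ D) [PreservesLimitsOfShape WalkingCospan F]
    {A B : InternalCat C} {f g : A ⟶ B} (θ : f ⟶ g) :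
    Trans.app (mapTrans F θ) = F.map (Trans.app θ) := rfl

theorem mapHom_comp (F : C ⥤ D) [PreservesLimitsOfShape WalkingCospan F] {A B B' : InternalCat C}
    (f : A ⟶ B) (g : B ⟶ B') : mapHom F (f ≫ g) = mapHom F f ≫ mapHom F g :=
  hom_ext (F.map_comp _ _) (F.map_comp _ _)

theorem mapTrans_eqToHom (F : C ⥤ D) [PreservesLimitsOfShape WalkingCospan F]
    {A B : InternalCat C} {f g : A ⟶ B} (h : f = g) :
    mapTrans F (eqToHom h) = eqToHom (by rw [h]) := by
  subst h
  exact trans_ext ((F.map_comp _ _).trans rfl)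

/-- The strict `2`-functor between `2`-categories of internal categories induced by a
pullback-preserving functor. -/
def map (F : C ⥤ D) [PreservesLimitsOfShape WalkingCospan F] :
    StrictPseudofunctor (InternalCat C) (InternalCat D) :=
  StrictPseudofunctor.mk'
    { obj := mapObj F
      map := mapHom F
      map₂ := mapTrans F
      map₂_id := fun f => trans_ext (by
        rw [mapTrans_app, id_app, id_app, F.map_comp]; rfl)
      map₂_comp := fun θ κ => trans_ext (by
        rw [mapTrans_app, comp_app, comp_app, map_cmp]; rfl)
      map_id := fun A => hom_ext (F.map_id _) (F.map_id _)
      map_comp := fun f g => hom_ext (F.map_comp _ _) (F.map_comp _ _)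
      map₂_whisker_left := fun f _ _ θ => trans_ext (by
        rw [eqToHom_comp_app, comp_eqToHom_app, mapTrans_app, whiskerLeft_app, F.map_comp]; rfl)
      map₂_whisker_right := fun θ g => trans_ext (by
        rw [eqToHom_comp_app, comp_eqToHom_app, mapTrans_app, whiskerRight_app, F.map_comp]; rfl)
      map₂_left_unitor := fun f => by
        simp only [Strict.leftUnitor_eqToIso, eqToIso.hom, mapTrans_eqToHom, eqToHom_trans]
      map₂_right_unitor := fun f => by
        simp only [Strict.rightUnitor_eqToIso, eqToIso.hom, mapTrans_eqToHom, eqToHom_trans]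
      map₂_associator := fun f g h => by
        simp only [Strict.associator_eqToIso, eqToIso.hom, mapTrans_eqToHom, eqToHom_trans] }

/-- The internal functor with components those of a natural transformation. -/
def mapNat {F G : C ⥤ D} [PreservesLimitsOfShape WalkingCospan F]
    [PreservesLimitsOfShape WalkingCospan G] (α : F ⟶ G) (A : InternalCat C) :
    mapObj F A ⟶ mapObj G A :=
  { obj := α.app A.obj
    mor := α.app A.mor
    mor_src := (α.naturality _).symm
    mor_tgt := (α.naturality _).symm
    ident_mor := α.naturality _
    comp_mor := by
      have h := (congrArg (fun k => α.app A.pairs ≫ k) (comp_eq_cmp (mapObj G A))).trans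
        (precomp_cmp _ (α.app A.pairs) _ _ _)
      refine (α.naturality _).trans (h.trans ?_)
      congr 1
      · exact (α.naturality _).symm
      · exact (α.naturality _).symm : Fun (mapObj F A) (mapObj G A) }

@[simp] theorem mapNat_obj {F G : C ⥤ D} [PreservesLimitsOfShape WalkingCospan F]
    [PreservesLimitsOfShape WalkingCospan G] (α : F ⟶ G) (A : InternalCat C) :
    Fun.obj (mapNat α A) = α.app A.obj := rfl

@[simp] theorem mapNat_mor {F G : C ⥤ D} [PreservesLimitsOfShape WalkingCospan F]
    [PreservesLimitsOfShape WalkingCospan G] (α : F ⟶ G) (A : InternalCat C) :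
    Fun.mor (mapNat α A) = α.app A.mor := rfl

end Map

/-! ### Nerves and discrete internal categories -/

section Nerve

variable {C : Type u} [Category.{v} C]

/-- The objects of the category of generalized elements `X ⟶ A`. -/
@[ext]
structure Pt (A : InternalCat C) (X : C) where
  pt : X ⟶ A.obj

variable (A : InternalCat C)

instance (X : C) : Category (A.Pt X) where
  Hom x y := { f : X ⟶ A.mor // f ≫ A.src = x.pt ∧ f ≫ A.tgt = y.pt }
  id x := ⟨x.pt ≫ A.ident, by simp, by simp⟩
  comp f g := ⟨A.cmp f.1 g.1 (f.2.2.trans g.2.1.symm), by simp [f.2.1], by simp [g.2.2]⟩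
  id_comp f := Subtype.ext (A.id_cmp _ _ _)
  comp_id f := Subtype.ext (A.cmp_id _ _ _)
  assoc f g h := Subtype.ext (A.cmp_assoc _ _ _ _ _)

@[simp] theorem Pt.id_val {X : C} (x : A.Pt X) : (𝟙 x : x ⟶ x).1 = x.pt ≫ A.ident := rfl

theorem Pt.comp_val {X : C} {x y z : A.Pt X} (f : x ⟶ y) (g : y ⟶ z) :
    (f ≫ g).1 = A.cmp f.1 g.1 (f.2.2.trans g.2.1.symm) := rfl

theorem Pt.eqToHom_comp_val {X : C} {x y z : A.Pt X} (h : x = y) (f : y ⟶ z) :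
    (eqToHom h ≫ f).1 = f.1 := by
  subst h; simp

theorem Pt.comp_eqToHom_val {X : C} {x y z : A.Pt X} (f : x ⟶ y) (h : y = z) :
    (f ≫ eqToHom h).1 = f.1 := by
  subst h; simp

/-- Restriction of generalized elements. -/
def Pt.restrict {X Y : C} (k : Y ⟶ X) : A.Pt X ⥤ A.Pt Y where
  obj x := ⟨k ≫ x.pt⟩
  map f := ⟨k ≫ f.1, by rw [Category.assoc, f.2.1], by rw [Category.assoc, f.2.2]⟩
  map_id x := Subtype.ext (by simp)
  map_comp f g := Subtype.ext (by simp only [Pt.comp_val, precomp_cmp])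

theorem Pt.restrict_id (X : C) : Pt.restrict A (𝟙 X) = 𝟭 _ :=
  CategoryTheory.Functor.ext (fun x => Pt.ext (Category.id_comp _)) (fun x y f => by
    refine Subtype.ext ?_
    rw [Pt.eqToHom_comp_val, Pt.comp_eqToHom_val]
    exact Category.id_comp _)

theorem Pt.restrict_comp {X Y Z : C} (k : Y ⟶ X) (l : Z ⟶ Y) :
    Pt.restrict A (l ≫ k) = Pt.restrict A k ⋙ Pt.restrict A l :=
  CategoryTheory.Functor.ext (fun x => Pt.ext (Category.assoc _ _ _)) (fun x y f => by
    refine Subtype.ext ?_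
    rw [Pt.eqToHom_comp_val, Pt.comp_eqToHom_val]
    exact Category.assoc _ _ _)

/-- The presheaf of categories represented by an internal category. -/
def points : Cᵒᵖ ⥤ Cat.{v, v} where
  obj X := Cat.of (A.Pt X.unop)
  map k := (Pt.restrict A k.unop).toCatHom
  map_id X := congrArg Functor.toCatHom (Pt.restrict_id A X.unop)
  map_comp k l := congrArg Functor.toCatHom (Pt.restrict_comp A k.unop l.unop)

/-- `N` is the simplicial nerve of `A`: an `n`-simplex of `N`, at any stage of definition `X`, is
a string of `n` composable generalized arrows `X ⟶ A.mor`, naturally in `X` and `n`.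
The passage to opposite categories fixes the convention on the order of the vertices: a simplex
is a string `xₙ ⟶ ⋯ ⟶ x₁ ⟶ x₀`, so that the face `d₀` of an edge is its source and `d₁` its
target. -/
def IsNerve (N : SimplicialObject C) : Prop :=
  Nonempty (N ⋙ yoneda ≅ (A.points ⋙ Cat.opFunctor ⋙ nerveFunctor.{v, v}).flip)

theorem lift_id {X W : C} (a b : W ⟶ X) (w : a ≫ 𝟙 X = b ≫ 𝟙 X) :
    (IsPullback.of_id_fst (f := 𝟙 X)).lift a b w = a := by
  simpa using (IsPullback.of_id_fst (f := 𝟙 X)).lift_fst a b w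

/-- The discrete internal category on an object. -/
@[simps obj mor src tgt]
def discrete (X : C) : InternalCat C where
  obj := X
  mor := X
  pairs := X
  src := 𝟙 X
  tgt := 𝟙 X
  ident := 𝟙 X
  fst := 𝟙 X
  snd := 𝟙 X
  comp := 𝟙 X
  isPullback := IsPullback.of_id_fst
  ident_src := by simp
  ident_tgt := by simp
  comp_src := by simp
  comp_tgt := by simp
  id_comp := by rw [Category.comp_id, lift_id, Category.comp_id]
  comp_id := by rw [Category.comp_id, lift_id]
  assoc f g h hfg hgh := by simp only [Category.comp_id, lift_id]

end Nerve

end InternalCat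

/-! ### Cartesian monads and categorical algebras -/

open InternalCat

/-- Cartesian monads. -/
class CartesianMonad {C : Type u} [Category.{v} C] (T : Monad C) : Prop where
  preservesPullbacks : PreservesLimitsOfShape WalkingCospan T.toFunctor
  mul_cartesian : NatTrans.Equifibered T.μ
  unit_cartesian : NatTrans.Equifibered T.η

attribute [instance] CartesianMonad.preservesPullbacks

section Algebras

variable {C : Type u} [Category.{v} C]

theorem aux_post (T : Monad C) {X Y Y' : C} (c : X ⟶ Y) (y : T.obj Y ⟶ Y) (y' : T.obj Y' ⟶ Y')
    (g : Y ⟶ Y') (h : y ≫ g = T.map g ≫ y') : (T.map c ≫ y) ≫ g = T.map (c ≫ g) ≫ y' := by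
  rw [Category.assoc, h, T.map_comp, Category.assoc]

theorem aux_pre₁ (T : Monad C) {X Y Z : C} (f : X ⟶ Y) (c : Y ⟶ Z) (y : T.obj Z ⟶ Z) :
    T.map f ≫ T.map c ≫ y = T.map (f ≫ c) ≫ y := by
  rw [T.map_comp, Category.assoc]

theorem aux_pre₂ (T : Monad C) {X Y Z : C} (c : T.obj Y ⟶ Z) (x : T.obj X ⟶ X)
    (y : T.obj Y ⟶ Y) (f : X ⟶ Y) (h : T.map f ≫ y = x ≫ f) :
    T.map (T.map f) ≫ T.map y ≫ c = T.map x ≫ T.map f ≫ c := by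
  rw [← Category.assoc, ← Category.assoc, ← T.map_comp, ← T.map_comp, h]

instance algebra_hasPullbacks [HasPullbacks C] (T : Monad C) : HasPullbacks T.Algebra :=
  ⟨fun D => Monad.hasLimit_of_comp_forget_hasLimit D⟩

/-- Categorical `T`-algebras: internal categories in the category of `T`-algebras, with internal
functors and internal natural transformations of these. -/
abbrev CAlg (T : Monad C) := InternalCat T.Algebra

/-- The action of `T` on algebras, as a natural transformation. -/
@[simps]
def algebraAction (T : Monad C) : T.forget ⋙ T.toFunctor ⟶ T.forget where
  app A := A.a
  naturality _ _ f := f.h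

variable [HasFiniteLimits C] (T : Monad C) [CartesianMonad T]

variable {T}

namespace CAlg

/-- The underlying internal category in `C` of a categorical `T`-algebra. -/
abbrev carrier (A : CAlg T) : InternalCat C := mapObj T.forget A

/-- The underlying internal functor in `C` of a strict morphism of categorical `T`-algebras. -/
abbrev carrierHom {A B : CAlg T} (f : A ⟶ B) : carrier A ⟶ carrier B := mapHom T.forget f

/-- The structure functor `T A ⟶ A` of a categorical `T`-algebra. -/
def act (A : CAlg T) : mapObj T.toFunctor (carrier A) ⟶ carrier A :=
  mapNat (algebraAction T) A

@[simp] theorem act_obj (A : CAlg T) : Fun.obj (act A) = A.obj.a := rfl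
@[simp] theorem act_mor (A : CAlg T) : Fun.mor (act A) = A.mor.a := rfl

theorem act_naturality {A B : CAlg T} (g : A ⟶ B) :
    mapHom T.toFunctor (carrierHom g) ≫ act B = act A ≫ carrierHom g :=
  hom_ext (Fun.obj g).h (Fun.mor g).h

end CAlg

open CAlg

theorem cell_composable {A B : CAlg T} {F : carrier A ⟶ carrier B}
    (c : mapHom T.toFunctor F ≫ act B ⟶ act A ≫ F) :
    (T.map (Trans.app c) ≫ B.mor.a) ≫ (carrier B).tgt =
      (T.map A.obj.a ≫ Trans.app c) ≫ (carrier B).src :=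
  (Trans.app_tgt (mapTrans T.toFunctor c ▷ act B)).trans
    (((congrArg (· ≫ B.obj.a) (T.map_comp _ _)).trans (Category.assoc _ _ _)).trans
      (Trans.app_src (mapHom T.toFunctor (act A) ◁ c)).symm)

/-- Lax morphisms of categorical `T`-algebras: an internal functor `f : A ⟶ B` in `C` together
with an internal natural transformation from `T A ⟶ T B ⟶ B` to `T A ⟶ A ⟶ B`, compatible with
the unit and the multiplication of `T`. Both compatibilities are equalities of internal natural
transformations, written in terms of components. -/
structure LaxMor (A B : CAlg T) where
  functor : carrier A ⟶ carrier B
  cell : (mapHom T.toFunctor functor ≫ act B) ⟶ (act A ≫ functor)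
  unit : T.η.app A.obj.A ≫ Trans.app cell = Fun.obj functor ≫ (carrier B).ident
  mul : T.μ.app A.obj.A ≫ Trans.app cell =
    (carrier B).cmp (T.map (Trans.app cell) ≫ B.mor.a) (T.map A.obj.a ≫ Trans.app cell)
      (cell_composable cell)

/-- Transformations between lax morphisms. -/
@[ext]
structure LaxTrans {A B : CAlg T} (f g : LaxMor A B) where
  trans : f.functor ⟶ g.functor
  comm : f.cell ≫ act A ◁ trans = mapTrans T.toFunctor trans ▷ act B ≫ g.cell

theorem LaxTrans.comm_app {A B : CAlg T} {f g : LaxMor A B} (α : LaxTrans f g) :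
    (carrier B).cmp (Trans.app f.cell) (A.obj.a ≫ Trans.app α.trans)
        ((Trans.app_tgt f.cell).trans (Trans.app_src (act A ◁ α.trans)).symm) =
      (carrier B).cmp (T.map (Trans.app α.trans) ≫ B.mor.a) (Trans.app g.cell)
        ((Trans.app_tgt (mapTrans T.toFunctor α.trans ▷ act B)).trans (Trans.app_src g.cell).symm) :=
  congrArg Trans.app α.comm

instance (A B : CAlg T) : Category (LaxMor A B) where
  Hom f g := LaxTrans f g
  id f :=
    { trans := 𝟙 _
      comm := trans_ext (by
        have h : mapTrans T.toFunctor (𝟙 f.functor) = 𝟙 _ := mapTrans_eqToHom _ rfl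
        rw [h, Bicategory.whiskerLeft_id, Bicategory.id_whiskerRight, Category.comp_id,
          Category.id_comp]) }
  comp {f g h} α β :=
    { trans := α.trans ≫ β.trans
      comm := by
        have h : mapTrans T.toFunctor (α.trans ≫ β.trans) =
            mapTrans T.toFunctor α.trans ≫ mapTrans T.toFunctor β.trans :=
          (InternalCat.map T.toFunctor).map₂_comp _ _
        rw [h, Bicategory.whiskerLeft_comp, Bicategory.comp_whiskerRight, Category.assoc,
          ← β.comm, ← Category.assoc, ← Category.assoc, α.comm] }
  id_comp α := LaxTrans.ext (Category.id_comp _)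
  comp_id α := LaxTrans.ext (Category.comp_id _)
  assoc α β γ := LaxTrans.ext (Category.assoc _ _ _)

namespace LaxMor

variable {A B D : CAlg T}

theorem ext' {f g : LaxMor A B} (h : f.functor = g.functor)
    (h' : Trans.app f.cell = Trans.app g.cell) : f = g := by
  obtain ⟨F, c, _, _⟩ := f
  obtain ⟨G, d, _, _⟩ := g
  obtain rfl : F = G := h
  obtain rfl : c = d := trans_ext h'
  rfl

theorem trans_ext' {f g : LaxMor A B} {α β : f ⟶ g}
    (h : Trans.app (LaxTrans.trans α) = Trans.app (LaxTrans.trans β)) : α = β :=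
  LaxTrans.ext (trans_ext h)

@[simp] theorem id_trans (f : LaxMor A B) : LaxTrans.trans (𝟙 f) = 𝟙 f.functor := rfl

@[simp] theorem comp_trans {f g h : LaxMor A B} (α : f ⟶ g) (β : g ⟶ h) :
    LaxTrans.trans (α ≫ β) = LaxTrans.trans α ≫ LaxTrans.trans β := rfl

theorem eqToHom_trans_app {f g : LaxMor A B} (h : f = g) :
    Trans.app (LaxTrans.trans (eqToHom h)) = Fun.obj f.functor ≫ (carrier B).ident := by
  subst h; rfl

theorem eqToHom_comp_app {f g h : LaxMor A B} (e : f = g) (α : g ⟶ h) :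
    Trans.app (LaxTrans.trans (eqToHom e ≫ α)) = Trans.app (LaxTrans.trans α) := by
  subst e; simp

theorem comp_eqToHom_app {f g h : LaxMor A B} (α : f ⟶ g) (e : g = h) :
    Trans.app (LaxTrans.trans (α ≫ eqToHom e)) = Trans.app (LaxTrans.trans α) := by
  subst e; simp

/-- The structure cell of the composite of a lax morphism with a strict morphism. -/
def postcompCell (f : LaxMor A B) (g : B ⟶ D) :
    mapHom T.toFunctor (f.functor ≫ carrierHom g) ≫ act D ⟶
      act A ≫ f.functor ≫ carrierHom g :=
  eqToHom (by rw [mapHom_comp, Category.assoc, act_naturality, Category.assoc]) ≫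
    f.cell ▷ carrierHom g ≫ eqToHom (Category.assoc _ _ _)

theorem postcompCell_app (f : LaxMor A B) (g : B ⟶ D) :
    Trans.app (postcompCell f g) = Trans.app f.cell ≫ (Fun.mor g).f := by
  rw [postcompCell, InternalCat.eqToHom_comp_app, InternalCat.comp_eqToHom_app]
  rfl

/-- Composition of a lax morphism with a strict morphism. -/
def postcomp (f : LaxMor A B) (g : B ⟶ D) : LaxMor A D where
  functor := f.functor ≫ carrierHom g
  cell := postcompCell f g
  unit := by
    rw [postcompCell_app]
    refine (Category.assoc _ _ _).symm.trans ?_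
    rw [f.unit]
    refine (Category.assoc _ _ _).trans ?_
    exact (congrArg (fun k => Fun.obj f.functor ≫ k) (Fun.ident_mor (carrierHom g))).trans
      (Category.assoc _ _ _).symm
  mul := by
    have h : T.μ.app A.obj.A ≫ Trans.app f.cell ≫ (Fun.mor g).f =
        (carrier D).cmp ((T.map (Trans.app f.cell) ≫ B.mor.a) ≫ (Fun.mor g).f)
          ((T.map A.obj.a ≫ Trans.app f.cell) ≫ (Fun.mor g).f) _ :=
      (Category.assoc _ _ _).symm.trans ((congrArg (· ≫ (Fun.mor g).f) f.mul).trans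
        (Fun.cmp_mor (carrierHom g) _ _ _))
    refine ((congrArg (fun k => T.μ.app A.obj.A ≫ k) (postcompCell_app f g)).trans h).trans
      (cmp_congr _ ?_ ?_ _ _)
    · rw [postcompCell_app]
      exact aux_post T (Trans.app f.cell) _ _ _ (Fun.mor g).h.symm
    · rw [postcompCell_app]
      exact Category.assoc _ _ _

/-- The structure cell of the composite of a strict morphism with a lax morphism. -/
def precompCell (f : A ⟶ B) (g : LaxMor B D) :
    mapHom T.toFunctor (carrierHom f ≫ g.functor) ≫ act D ⟶
      act A ≫ carrierHom f ≫ g.functor :=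
  eqToHom (by rw [mapHom_comp, Category.assoc]) ≫
    mapHom T.toFunctor (carrierHom f) ◁ g.cell ≫
      eqToHom (by rw [← Category.assoc, act_naturality, Category.assoc])

theorem precompCell_app (f : A ⟶ B) (g : LaxMor B D) :
    Trans.app (precompCell f g) = T.map (Fun.obj f).f ≫ Trans.app g.cell := by
  rw [precompCell, InternalCat.eqToHom_comp_app, InternalCat.comp_eqToHom_app]
  rfl

/-- Composition of a strict morphism with a lax morphism. -/
def precomp (f : A ⟶ B) (g : LaxMor B D) : LaxMor A D where
  functor := carrierHom f ≫ g.functor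
  cell := precompCell f g
  unit := by
    rw [precompCell_app]
    refine (Category.assoc _ _ _).symm.trans ?_
    refine (congrArg (· ≫ Trans.app g.cell) (T.η.naturality (Fun.obj f).f).symm).trans ?_
    refine (Category.assoc _ _ _).trans ?_
    exact (congrArg (fun k => (Fun.obj f).f ≫ k) g.unit).trans (Category.assoc _ _ _).symm
  mul := by
    have h : T.μ.app A.obj.A ≫ T.map (Fun.obj f).f ≫ Trans.app g.cell =
        (carrier D).cmp (T.map (T.map (Fun.obj f).f) ≫ T.map (Trans.app g.cell) ≫ D.mor.a)
          (T.map (T.map (Fun.obj f).f) ≫ T.map B.obj.a ≫ Trans.app g.cell) _ :=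
      (Category.assoc _ _ _).symm.trans
        ((congrArg (· ≫ Trans.app g.cell) (T.μ.naturality (Fun.obj f).f).symm).trans
          ((Category.assoc _ _ _).trans
            ((congrArg (fun k => T.map (T.map (Fun.obj f).f) ≫ k) g.mul).trans
              (precomp_cmp _ _ _ _ _))))
    refine ((congrArg (fun k => T.μ.app A.obj.A ≫ k) (precompCell_app f g)).trans h).trans
      (cmp_congr _ ?_ ?_ _ _)
    · rw [precompCell_app]
      exact aux_pre₁ T _ (Trans.app g.cell) _
    · rw [precompCell_app]
      exact aux_pre₂ T (Trans.app g.cell) _ _ _ (Fun.obj f).h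

theorem whiskerRight_comm {f g : LaxMor A B} (α : f ⟶ g) (h : B ⟶ D) :
    postcompCell f h ≫ act A ◁ (LaxTrans.trans α ▷ carrierHom h) =
      mapTrans T.toFunctor (LaxTrans.trans α ▷ carrierHom h) ▷ act D ≫ postcompCell g h := by
  refine trans_ext ?_
  have := (Fun.cmp_mor (carrierHom h) _ _ _).symm.trans
    ((congrArg (· ≫ (Fun.mor h).f) (LaxTrans.comm_app α)).trans (Fun.cmp_mor (carrierHom h) _ _ _))
  refine Eq.trans (cmp_congr _ ?_ ?_ _ _) (this.trans (cmp_congr _ ?_ ?_ _ _))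
  · exact postcompCell_app f h
  · exact (Category.assoc _ _ _).symm
  · exact aux_post T (Trans.app (LaxTrans.trans α)) _ _ _ (Fun.mor h).h.symm
  · exact (postcompCell_app g h).symm

theorem whiskerLeft_comm (h : A ⟶ B) {f g : LaxMor B D} (α : f ⟶ g) :
    precompCell h f ≫ act A ◁ (carrierHom h ◁ LaxTrans.trans α) =
      mapTrans T.toFunctor (carrierHom h ◁ LaxTrans.trans α) ▷ act D ≫ precompCell h g := by
  refine trans_ext ?_
  have := (precomp_cmp _ _ _ _ _).symm.trans
    ((congrArg (fun k => T.map (Fun.obj h).f ≫ k) (LaxTrans.comm_app α)).trans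
      (precomp_cmp _ _ _ _ _))
  refine Eq.trans (cmp_congr _ ?_ ?_ _ _) (this.trans (cmp_congr _ ?_ ?_ _ _))
  · exact precompCell_app h f
  · exact (Category.assoc _ _ _).symm.trans ((congrArg (· ≫ Trans.app (LaxTrans.trans α))
      (Fun.obj h).h.symm).trans (Category.assoc _ _ _))
  · exact aux_pre₁ T (Fun.obj h).f (Trans.app (LaxTrans.trans α)) _
  · exact (precompCell_app h g).symm

/-- Composition with a strict morphism `h`, as a functor. -/
@[simps]
def postcompFunctor (A : CAlg T) (h : B ⟶ D) : LaxMor A B ⥤ LaxMor A D where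
  obj f := f.postcomp h
  map α := { trans := LaxTrans.trans α ▷ carrierHom h, comm := whiskerRight_comm α h }
  map_id _ := LaxTrans.ext (Bicategory.id_whiskerRight _ _)
  map_comp _ _ := LaxTrans.ext (Bicategory.comp_whiskerRight _ _ _)

/-- Precomposition with a strict morphism `h`, as a functor. -/
@[simps]
def precompFunctor (h : A ⟶ B) (D : CAlg T) : LaxMor B D ⥤ LaxMor A D where
  obj f := f.precomp h
  map α := { trans := carrierHom h ◁ LaxTrans.trans α, comm := whiskerLeft_comm h α }
  map_id _ := LaxTrans.ext (Bicategory.whiskerLeft_id _ _)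
  map_comp _ _ := LaxTrans.ext (Bicategory.whiskerLeft_comp _ _ _)

/-- The transformation of lax morphisms induced by a transformation of strict morphisms. -/
def whiskerTrans (f : LaxMor A B) {g h : B ⟶ D} (θ : g ⟶ h) : f.postcomp g ⟶ f.postcomp h :=
  { trans := f.functor ◁ mapTrans T.forget θ
    comm := trans_ext (by
      have := Trans.naturality_at (mapTrans T.forget θ) (Trans.app f.cell)
      have h₁ : Trans.app f.cell ≫ (carrier B).src = T.map (Fun.obj f.functor) ≫ B.obj.a :=
        Trans.app_src f.cell
      have h₂ : Trans.app f.cell ≫ (carrier B).tgt = A.obj.a ≫ Fun.obj f.functor :=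
        Trans.app_tgt f.cell
      refine Eq.trans (cmp_congr _ ?_ ?_ _ _) (this.trans (cmp_congr _ ?_ ?_ _ _))
      · exact postcompCell_app f g
      · exact (Category.assoc _ _ _).symm.trans
          ((congrArg (· ≫ (Trans.app θ).f) h₂.symm).trans (Category.assoc _ _ _))
      · exact (Category.assoc _ _ _).symm.trans
          ((congrArg (· ≫ (Trans.app θ).f) h₁).trans
            (aux_post T (Fun.obj f.functor) _ _ _ (Trans.app θ).h.symm))
      · exact (postcompCell_app f h).symm) : LaxTrans _ _ }

end LaxMor

section

variable {X A B D : CAlg T}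

theorem laxHom_ext {F G : Cat.of (LaxMor X A) ⟶ Cat.of (LaxMor X B)} {σ τ : F ⟶ G}
    (h : ∀ f : LaxMor X A, Trans.app (LaxTrans.trans (σ.toNatTrans.app f)) =
      Trans.app (LaxTrans.trans (τ.toNatTrans.app f))) : σ = τ :=
  Cat.Hom₂.ext (NatTrans.ext (funext fun f => LaxMor.trans_ext' (h f)))

theorem laxHom_eqToHom_comp {F G H : Cat.of (LaxMor X A) ⟶ Cat.of (LaxMor X B)} (e : F = G)
    (τ : G ⟶ H) (f : LaxMor X A) :
    Trans.app (LaxTrans.trans ((eqToHom e ≫ τ).toNatTrans.app f)) =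
      Trans.app (LaxTrans.trans (τ.toNatTrans.app f)) := by
  subst e; rw [eqToHom_refl, Category.id_comp]

theorem laxHom_comp_eqToHom {F G H : Cat.of (LaxMor X A) ⟶ Cat.of (LaxMor X B)} (τ : F ⟶ G)
    (e : G = H) (f : LaxMor X A) :
    Trans.app (LaxTrans.trans ((τ ≫ eqToHom e).toNatTrans.app f)) =
      Trans.app (LaxTrans.trans (τ.toNatTrans.app f)) := by
  subst e; rw [eqToHom_refl, Category.comp_id]

theorem LaxMor.postcomp_id (f : LaxMor X A) : f.postcomp (𝟙 A) = f :=
  LaxMor.ext' (hom_ext (Category.comp_id _) (Category.comp_id _))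
    ((LaxMor.postcompCell_app f (𝟙 A)).trans (Category.comp_id _))

theorem LaxMor.postcomp_comp (f : LaxMor X A) (g : A ⟶ B) (h : B ⟶ D) :
    f.postcomp (g ≫ h) = (f.postcomp g).postcomp h :=
  LaxMor.ext' (hom_ext (Category.assoc _ _ _).symm (Category.assoc _ _ _).symm)
    ((LaxMor.postcompCell_app f (g ≫ h)).trans
      ((Category.assoc _ _ _).symm.trans
        ((congrArg (· ≫ (Fun.mor h).f) (LaxMor.postcompCell_app f g).symm).trans
          (LaxMor.postcompCell_app (f.postcomp g) h).symm)))

theorem LaxMor.functor_ext {A' B' : CAlg T} {F G : LaxMor A B ⥤ LaxMor A' B'}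
    (h : ∀ f, F.obj f = G.obj f)
    (h' : ∀ {f g : LaxMor A B} (α : f ⟶ g),
      Trans.app (LaxTrans.trans (F.map α)) = Trans.app (LaxTrans.trans (G.map α))) : F = G :=
  CategoryTheory.Functor.ext h (fun _ _ α => LaxMor.trans_ext' (by
    rw [LaxMor.eqToHom_comp_app, LaxMor.comp_eqToHom_app, h' α]))

theorem LaxMor.postcompFunctor_id : LaxMor.postcompFunctor X (𝟙 A) = 𝟭 (LaxMor X A) :=
  LaxMor.functor_ext LaxMor.postcomp_id (fun _ => Category.comp_id _)

theorem LaxMor.postcompFunctor_comp (g : A ⟶ B) (h : B ⟶ D) :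
    LaxMor.postcompFunctor X (g ≫ h) =
      LaxMor.postcompFunctor X g ⋙ LaxMor.postcompFunctor X h :=
  LaxMor.functor_ext (fun f => LaxMor.postcomp_comp f g h) (fun _ => (Category.assoc _ _ _).symm)

theorem laxHom_eqToHom_app {F G : Cat.of (LaxMor X A) ⟶ Cat.of (LaxMor X B)} (e : F = G)
    (f : LaxMor X A) :
    Trans.app (LaxTrans.trans ((eqToHom e).toNatTrans.app f)) =
      Fun.obj (LaxMor.functor (F.toFunctor.obj f)) ≫ (carrier B).ident := by
  subst e; rfl

theorem LaxMor.whiskerTrans_eqToHom_app {g h : A ⟶ B} (e : g = h) (f : LaxMor X A) :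
    Trans.app (LaxTrans.trans (LaxMor.whiskerTrans f (eqToHom e))) =
      Fun.obj (LaxMor.functor (f.postcomp g)) ≫ (carrier B).ident := by
  subst e
  exact (Category.assoc _ _ _).symm

end

/-- The `2`-functor of lax morphisms out of a categorical `T`-algebra. -/
def laxHom (X : CAlg T) : StrictPseudofunctor (CAlg T) Cat.{v, v} :=
  StrictPseudofunctor.mk'
    { obj := fun A => Cat.of (LaxMor X A)
      map := fun g => (LaxMor.postcompFunctor X g).toCatHom
      map₂ := fun θ => NatTrans.toCatHom₂
        { app := fun f => LaxMor.whiskerTrans f θ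
          naturality := fun _ _ α =>
            LaxTrans.ext (whisker_exchange (LaxTrans.trans α) (mapTrans T.forget θ)).symm }
      map₂_id := by
        intro A B f
        refine laxHom_ext (fun g => ?_)
        exact LaxMor.whiskerTrans_eqToHom_app rfl g
      map₂_comp := by
        intro A B f g h θ κ
        refine Cat.Hom₂.ext (NatTrans.ext (funext fun l => LaxTrans.ext ?_))
        exact (congrArg (fun k => LaxMor.functor l ◁ k)
          ((InternalCat.map T.forget).map₂_comp θ κ)).trans (Bicategory.whiskerLeft_comp _ _ _)
      map_id := fun A => congrArg Functor.toCatHom LaxMor.postcompFunctor_id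
      map_comp := fun f g => congrArg Functor.toCatHom (LaxMor.postcompFunctor_comp f g)
      map₂_whisker_left := fun f _ _ θ => laxHom_ext (fun g => by
        rw [laxHom_eqToHom_comp, laxHom_comp_eqToHom]
        exact (Category.assoc _ _ _).symm)
      map₂_whisker_right := fun θ g => laxHom_ext (fun f => by
        rw [laxHom_eqToHom_comp, laxHom_comp_eqToHom]
        exact (Category.assoc _ _ _).symm)
      map₂_left_unitor := fun f => by
        rw [Strict.leftUnitor_eqToIso, Strict.leftUnitor_eqToIso, eqToIso.hom, eqToIso.hom,
          eqToHom_trans]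
        refine laxHom_ext (fun g => ?_)
        rw [laxHom_eqToHom_app]
        exact LaxMor.whiskerTrans_eqToHom_app _ g
      map₂_right_unitor := fun f => by
        rw [Strict.rightUnitor_eqToIso, Strict.rightUnitor_eqToIso, eqToIso.hom, eqToIso.hom,
          eqToHom_trans]
        refine laxHom_ext (fun g => ?_)
        rw [laxHom_eqToHom_app]
        exact LaxMor.whiskerTrans_eqToHom_app _ g
      map₂_associator := fun f g h => by
        rw [Strict.associator_eqToIso, Strict.associator_eqToIso, eqToIso.hom, eqToIso.hom,
          eqToHom_trans, eqToHom_trans]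
        refine laxHom_ext (fun g => ?_)
        rw [laxHom_eqToHom_app]
        exact LaxMor.whiskerTrans_eqToHom_app _ g }

variable (T) in
/-- The terminal `T`-algebra. -/
def terminalAlgebra : T.Algebra where
  A := ⊤_ C
  a := terminal.from _

variable (T) in
/-- The terminal `T`-algebra is terminal. -/
def terminalAlgebraIsTerminal : IsTerminal (terminalAlgebra T) :=
  IsTerminal.ofUniqueHom
    (fun A => { f := terminal.from A.A, h := terminalIsTerminal.hom_ext _ _ })
    (fun _ _ => Monad.Algebra.Hom.ext (terminalIsTerminal.hom_ext _ _))

variable (T) in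
/-- The terminal categorical `T`-algebra. -/
def oneCAlg : CAlg T := discrete (terminalAlgebra T)

variable (T) in
/-- The `2`-functor sending a categorical `T`-algebra to the category of its internal
`T`-algebras, i.e. of lax morphisms from the terminal categorical `T`-algebra. -/
def IAlg : StrictPseudofunctor (CAlg T) Cat.{v, v} := laxHom (oneCAlg T)

end Algebras

/-! ### Squares of adjunctions -/

theorem aux_nat {E : Type u₂} [Category.{v} E] (T : Monad E) {X Y X' Y' : E} (f : X ⟶ Y)
    (a : X ⟶ X') (b : Y ⟶ Y') (g : X' ⟶ Y') (s : T.obj X' ⟶ X') (t : T.obj Y' ⟶ Y')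
    (h : f ≫ b = a ≫ g) (h' : T.map g ≫ t = s ≫ g) :
    T.map f ≫ T.map b ≫ t = (T.map a ≫ s) ≫ g := by
  rw [← Category.assoc, ← T.map_comp, h, T.map_comp, Category.assoc, h', Category.assoc]

/-- A monad `S` on `C` and a monad `T` on `E`, a right adjoint `w : C ⥤ E` and a functor
`d : Alg_S ⥤ Alg_T` over `w`. -/
structure AdjSquare {C : Type u₁} [Category.{v} C] {E : Type u₂} [Category.{v} E]
    (S : Monad C) (T : Monad E) where
  w : C ⥤ E
  c : E ⥤ C
  adj : c ⊣ w
  d : S.Algebra ⥤ T.Algebra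
  comm : d ⋙ T.forget ≅ S.forget ⋙ w

namespace AdjSquare

variable {C : Type u₁} [Category.{v} C] {E : Type u₂} [Category.{v} E]
  {S : Monad C} {T : Monad E} (Q : AdjSquare S T)

/-- The functor `G = F^S c`. -/
abbrev G : E ⥤ S.Algebra := Q.c ⋙ S.free

/-- The composite adjunction `F^S c ⊣ w U^S`. -/
abbrev adjG : Q.G ⊣ S.forget ⋙ Q.w := Q.adj.comp S.adj

/-- The components of the isomorphism `U^T d ≅ w U^S`. -/
def commIso (A : S.Algebra) : (Q.d.obj A).A ≅ Q.w.obj A.A := Q.comm.app A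

theorem commIso_hom_naturality {A B : S.Algebra} (f : A ⟶ B) :
    (Q.d.map f).f ≫ (Q.commIso B).hom = (Q.commIso A).hom ≫ Q.w.map f.f :=
  Q.comm.hom.naturality f

theorem commIso_inv_naturality {A B : S.Algebra} (f : A ⟶ B) :
    Q.w.map f.f ≫ (Q.commIso B).inv = (Q.commIso A).inv ≫ (Q.d.map f).f :=
  Q.comm.inv.naturality f

/-- The `T`-algebra structure on `w U^S = U^T d`. -/
def str (A : S.Algebra) : T.obj (Q.w.obj A.A) ⟶ Q.w.obj A.A :=
  T.map (Q.commIso A).inv ≫ (Q.d.obj A).a ≫ (Q.commIso A).hom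

theorem str_naturality {A B : S.Algebra} (f : A ⟶ B) :
    T.map (Q.w.map f.f) ≫ Q.str B = Q.str A ≫ Q.w.map f.f := by
  rw [str, str, ← Category.assoc, ← T.map_comp, commIso_inv_naturality, T.map_comp,
    Category.assoc, ← Category.assoc (T.map (Q.d.map f).f), (Q.d.map f).h, Category.assoc,
    Category.assoc, Category.assoc, commIso_hom_naturality]

theorem str_unit (A : S.Algebra) : T.η.app (Q.w.obj A.A) ≫ Q.str A = 𝟙 _ := by
  have h := T.η.naturality (Q.commIso A).inv
  dsimp at h
  rw [str, ← Category.assoc, ← h, Category.assoc, ← Category.assoc (T.η.app _),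
    (Q.d.obj A).unit]
  exact (congrArg (fun k => (Q.commIso A).inv ≫ k) (Category.id_comp _)).trans
    (Q.commIso A).inv_hom_id

theorem map_hom_str (A : S.Algebra) :
    T.map (Q.commIso A).hom ≫ Q.str A = (Q.d.obj A).a ≫ (Q.commIso A).hom := by
  rw [str, ← Category.assoc, ← T.map_comp, Iso.hom_inv_id, T.map_id, Category.id_comp]

theorem str_mul (A : S.Algebra) :
    T.μ.app (Q.w.obj A.A) ≫ Q.str A = T.map (Q.str A) ≫ Q.str A := by
  have h := T.μ.naturality (Q.commIso A).inv
  dsimp at h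
  conv_lhs => rw [str, ← Category.assoc, ← h, Category.assoc, ← Category.assoc (T.μ.app _),
    (Q.d.obj A).assoc]
  conv_rhs => rw [str, T.map_comp, T.map_comp, Category.assoc, Category.assoc, ← str, map_hom_str]
  simp only [Category.assoc]

/-- The map of monads `T ⟶ Φ = w U^S F^S c`, obtained from the unit of the adjunction
`F^S c ⊣ w U^S` and the `T`-algebra structure on `w U^S = U^T d`. -/
def monadMap : T.toFunctor ⟶ Q.G ⋙ S.forget ⋙ Q.w where
  app X := T.map (Q.adjG.unit.app X) ≫ Q.str (Q.G.obj X)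
  naturality X Y f := by
    exact aux_nat T f _ _ _ _ _ (Q.adjG.unit.naturality f) (Q.str_naturality (Q.G.map f))

/-- The right action `F^S c U^T F^T ⟶ F^S c` of `T` on `G`, the adjoint transpose of
`monadMap`. -/
def action : T.toFunctor ⋙ Q.G ⟶ Q.G where
  app X := (Q.adjG.homEquiv (T.obj X) (Q.G.obj X)).symm (Q.monadMap.app X)
  naturality X Y f := by
    have h := Q.monadMap.naturality f
    refine (Q.adjG.homEquiv_naturality_left_symm _ _).symm.trans
      (Eq.trans ?_ (Q.adjG.homEquiv_naturality_right_symm _ _))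
    exact congrArg _ h

theorem w_preserves (J : Type) [SmallCategory J] : PreservesLimitsOfShape J Q.w :=
  have := Q.adj.rightAdjoint_preservesLimits
  inferInstance

theorem d_preserves (J : Type) [SmallCategory J] : PreservesLimitsOfShape J Q.d :=
  have := Q.w_preserves J
  have : PreservesLimitsOfShape J (Q.d ⋙ T.forget) := preservesLimitsOfShape_of_natIso Q.comm.symm
  preservesLimitsOfShape_of_reflects_of_preserves Q.d T.forget

instance : PreservesLimitsOfShape WalkingCospan Q.w := Q.w_preserves _
instance : PreservesLimitsOfShape WalkingCospan Q.d := Q.d_preserves _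

/-- The map `T w ⟶ w S`: the `T`-algebra structure of `w S = U^T d F^S` restricted along
the unit of `S`. -/
def distApp (X : C) : T.obj (Q.w.obj X) ⟶ Q.w.obj (S.obj X) :=
  T.map (Q.w.map (S.η.app X)) ≫ Q.str (S.free.obj X)

theorem distApp_naturality {X Y : C} (f : X ⟶ Y) :
    T.map (Q.w.map f) ≫ Q.distApp Y = Q.distApp X ≫ Q.w.map (S.map f) :=
  aux_nat T (Q.w.map f) _ _ _ _ _
    ((Q.w.map_comp _ _).symm.trans ((congrArg Q.w.map (S.η.naturality f)).trans
      (Q.w.map_comp _ _))) (Q.str_naturality (S.free.map f))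

/-- `distApp` as a natural transformation. -/
def dist : Q.w ⋙ T.toFunctor ⟶ S.toFunctor ⋙ Q.w where
  app X := Q.distApp X
  naturality _ _ f := Q.distApp_naturality f

theorem distApp_alg (A : S.Algebra) : Q.distApp A.A ≫ Q.w.map A.a = Q.str A := by
  have h : T.map (Q.w.map A.a) ≫ Q.str A = Q.str (S.free.obj A.A) ≫ Q.w.map A.a :=
    Q.str_naturality (A := S.free.obj A.A) (B := A) { f := A.a, h := A.assoc.symm }
  refine (Category.assoc _ _ _).trans ?_
  refine (congrArg (fun k => T.map (Q.w.map (S.η.app A.A)) ≫ k) h.symm).trans ?_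
  refine (Category.assoc _ _ _).symm.trans ?_
  rw [← T.map_comp, ← Q.w.map_comp, A.unit]
  refine (congrArg (fun k => T.map k ≫ Q.str A) (Q.w.map_id _)).trans ?_
  rw [T.map_id, Category.id_comp]

theorem map_hom_distApp (A : S.Algebra) :
    T.map (Q.commIso A).hom ≫ Q.distApp A.A ≫ Q.w.map A.a =
      (Q.d.obj A).a ≫ (Q.commIso A).hom :=
  (congrArg (fun k => T.map (Q.commIso A).hom ≫ k) (Q.distApp_alg A)).trans (Q.map_hom_str A)

theorem distApp_unit (X : C) : T.η.app (Q.w.obj X) ≫ Q.distApp X = Q.w.map (S.η.app X) := by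
  have h := T.η.naturality (Q.w.map (S.η.app X))
  have h' := Q.str_unit (S.free.obj X)
  exact (Category.assoc _ _ _).symm.trans ((congrArg (· ≫ Q.str (S.free.obj X)) h.symm).trans
    ((Category.assoc _ _ _).trans ((congrArg (fun k => Q.w.map (S.η.app X) ≫ k) h').trans
      (Category.comp_id _))))

theorem distApp_mul (X : C) : T.μ.app (Q.w.obj X) ≫ Q.distApp X =
    T.map (Q.distApp X) ≫ Q.distApp (S.obj X) ≫ Q.w.map (S.μ.app X) := by
  have h := Q.distApp_alg (S.free.obj X)
  refine Eq.trans ?_ (congrArg (fun k => T.map (Q.distApp X) ≫ k) h.symm)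
  have h₁ := T.μ.naturality (Q.w.map (S.η.app X))
  have h₂ := Q.str_mul (S.free.obj X)
  refine (Category.assoc _ _ _).symm.trans ((congrArg (· ≫ Q.str (S.free.obj X)) h₁.symm).trans
    ((Category.assoc _ _ _).trans
      ((congrArg (fun k => T.map (T.map (Q.w.map (S.η.app X))) ≫ k) h₂).trans ?_)))
  exact (Category.assoc _ _ _).symm.trans
    (congrArg (· ≫ Q.str (S.free.obj X)) (T.map_comp _ _).symm)

theorem map_inv_act (B : S.Algebra) :
    T.map (Q.commIso B).inv ≫ (Q.d.obj B).a = Q.distApp B.A ≫ Q.w.map B.a ≫ (Q.commIso B).inv := by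
  have h := Q.distApp_alg B
  rw [← Category.assoc, h, str, Category.assoc, Category.assoc, Iso.hom_inv_id, Category.comp_id]

theorem lax_src (A B : S.Algebra) (k : A.A ⟶ B.A) :
    T.map ((Q.commIso A).hom ≫ Q.w.map k ≫ (Q.commIso B).inv) ≫ (Q.d.obj B).a =
      (T.map (Q.commIso A).hom ≫ Q.distApp A.A) ≫ Q.w.map (S.map k ≫ B.a) ≫
        (Q.commIso B).inv := by
  rw [T.map_comp, T.map_comp, Category.assoc, Category.assoc, map_inv_act, Q.w.map_comp,
    Category.assoc, Category.assoc, ← Category.assoc (T.map (Q.w.map k)), distApp_naturality,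
    Category.assoc]

theorem lax_tgt (A : S.Algebra) {X : C} (B : S.Algebra) (k : A.A ⟶ X) (l : Q.w.obj X ⟶ (Q.d.obj B).A) :
    (T.map (Q.commIso A).hom ≫ Q.distApp A.A) ≫ Q.w.map (A.a ≫ k) ≫ l =
      (Q.d.obj A).a ≫ (Q.commIso A).hom ≫ Q.w.map k ≫ l := by
  have h := Q.map_hom_distApp A
  rw [Q.w.map_comp, Category.assoc, Category.assoc, ← Category.assoc (Q.distApp A.A),
    ← Category.assoc (T.map _), h, Category.assoc]

theorem lax_unit (A : S.Algebra) {X : C} {Y : E} (k : S.obj A.A ⟶ X) (l : Q.w.obj X ⟶ Y) :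
    T.η.app (Q.d.obj A).A ≫ (T.map (Q.commIso A).hom ≫ Q.distApp A.A) ≫ Q.w.map k ≫ l =
      (Q.commIso A).hom ≫ Q.w.map (S.η.app A.A ≫ k) ≫ l := by
  have h := T.η.naturality (Q.commIso A).hom
  have h' := Q.distApp_unit A.A
  dsimp at h h'
  rw [Category.assoc, ← Category.assoc, ← h, Category.assoc, ← Category.assoc (T.η.app _), h',
    Q.w.map_comp, Category.assoc]

theorem lax_mul (A : S.Algebra) {X : C} {Y : E} (k : S.obj A.A ⟶ X) (l : Q.w.obj X ⟶ Y) :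
    T.μ.app (Q.d.obj A).A ≫ (T.map (Q.commIso A).hom ≫ Q.distApp A.A) ≫ Q.w.map k ≫ l =
      (T.map (T.map (Q.commIso A).hom) ≫ T.map (Q.distApp A.A) ≫ Q.distApp (S.obj A.A)) ≫
        Q.w.map (S.μ.app A.A ≫ k) ≫ l := by
  have h := T.μ.naturality (Q.commIso A).hom
  have h' := Q.distApp_mul A.A
  dsimp at h h'
  rw [Category.assoc, ← Category.assoc, ← h, Category.assoc, ← Category.assoc (T.μ.app _), h',
    Q.w.map_comp]
  simp only [Category.assoc]

theorem lax_mul₁ (A B : S.Algebra) (c : S.obj A.A ⟶ B.A) :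
    T.map ((T.map (Q.commIso A).hom ≫ Q.distApp A.A) ≫ Q.w.map c ≫ (Q.commIso B).inv) ≫
        (Q.d.obj B).a =
      (T.map (T.map (Q.commIso A).hom) ≫ T.map (Q.distApp A.A) ≫ Q.distApp (S.obj A.A)) ≫
        Q.w.map (S.map c ≫ B.a) ≫ (Q.commIso B).inv := by
  simp only [T.map_comp, Category.assoc, map_inv_act, Q.w.map_comp]
  rw [← Category.assoc (T.map (Q.w.map c)), distApp_naturality, Category.assoc]

theorem lax_mul₂ (A : S.Algebra) {X : C} {Y : E} (c : S.obj A.A ⟶ X) (l : Q.w.obj X ⟶ Y) :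
    T.map (Q.d.obj A).a ≫ (T.map (Q.commIso A).hom ≫ Q.distApp A.A) ≫ Q.w.map c ≫ l =
      (T.map (T.map (Q.commIso A).hom) ≫ T.map (Q.distApp A.A) ≫ Q.distApp (S.obj A.A)) ≫
        Q.w.map (S.map A.a ≫ c) ≫ l := by
  have h := Q.map_hom_distApp A
  rw [Category.assoc, ← Category.assoc, ← T.map_comp, ← h]
  simp only [T.map_comp, Category.assoc, Q.w.map_comp]
  rw [← Category.assoc (T.map (Q.w.map A.a)), distApp_naturality, Category.assoc]

theorem aux_unit {X : C} {M N : S.Algebra} (k : X ⟶ M.A) (i : M ⟶ N) {Y : E}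
    (l : Y ⟶ Q.w.obj X) :
    l ≫ Q.w.map (k ≫ i.f) ≫ (Q.commIso N).inv =
      (l ≫ Q.w.map k ≫ (Q.commIso M).inv) ≫ (Q.d.map i).f := by
  rw [Q.w.map_comp, Category.assoc, commIso_inv_naturality, Category.assoc, Category.assoc]

section Lax

open CAlg

variable [HasFiniteLimits C] [HasFiniteLimits E] [CartesianMonad S] [CartesianMonad T]

/-- The `2`-functor from categorical `S`-algebras to categorical `T`-algebras given by `d`. -/
def dCat : StrictPseudofunctor (CAlg S) (CAlg T) := InternalCat.map Q.d

/-- The categorical `T`-algebra `d A`. -/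
abbrev dObj (A : CAlg S) : CAlg T := mapObj Q.d A

variable {A B : CAlg S}

/-- The comparison `U^T d A ⟶ w U^S A` of internal categories in `E`. -/
def toW (A : CAlg S) : carrier (Q.dObj A) ⟶ mapObj Q.w (carrier A) := mapNat Q.comm.hom A

/-- The comparison `w U^S A ⟶ U^T d A` of internal categories in `E`. -/
def ofW (A : CAlg S) : mapObj Q.w (carrier A) ⟶ carrier (Q.dObj A) := mapNat Q.comm.inv A

/-- The internal functor `T U^T d A ⟶ T w U^S A ⟶ w S U^S A`. -/
def distW (A : CAlg S) :
    mapObj T.toFunctor (carrier (Q.dObj A)) ⟶ mapObj Q.w (mapObj S.toFunctor (carrier A)) :=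
  mapHom T.toFunctor (Q.toW A) ≫ mapNat Q.dist (carrier A)

/-- The functor underlying the image under `d` of a lax morphism. -/
def dFunctor (f : carrier A ⟶ carrier B) : carrier (Q.dObj A) ⟶ carrier (Q.dObj B) :=
  Q.toW A ≫ mapHom Q.w f ≫ Q.ofW B

theorem dFunctor_src (f : carrier A ⟶ carrier B) :
    mapHom T.toFunctor (Q.dFunctor f) ≫ act (Q.dObj B) =
      Q.distW A ≫ mapHom Q.w (mapHom S.toFunctor f ≫ act B) ≫ Q.ofW B :=
  hom_ext (Q.lax_src A.obj B.obj (Fun.obj f)) (Q.lax_src A.mor B.mor (Fun.mor f))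

theorem dFunctor_tgt (f : carrier A ⟶ carrier B) :
    Q.distW A ≫ mapHom Q.w (act A ≫ f) ≫ Q.ofW B = act (Q.dObj A) ≫ Q.dFunctor f :=
  hom_ext (Q.lax_tgt A.obj B.obj (Fun.obj f) (Q.commIso B.obj).inv)
    (Q.lax_tgt A.mor B.mor (Fun.mor f) (Q.commIso B.mor).inv)

/-- The structure cell of the image under `d` of a lax morphism. -/
def dCell (f : LaxMor A B) :
    mapHom T.toFunctor (Q.dFunctor f.functor) ≫ act (Q.dObj B) ⟶
      act (Q.dObj A) ≫ Q.dFunctor f.functor :=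
  eqToHom (Q.dFunctor_src f.functor) ≫
    Q.distW A ◁ (mapTrans Q.w f.cell ▷ Q.ofW B) ≫ eqToHom (Q.dFunctor_tgt f.functor)

theorem dCell_app (f : LaxMor A B) :
    Trans.app (Q.dCell f) = (T.map (Q.commIso A.obj).hom ≫ Q.distApp A.obj.A) ≫
      Q.w.map (Trans.app f.cell) ≫ (Q.commIso B.mor).inv := by
  rw [dCell, InternalCat.eqToHom_comp_app, InternalCat.comp_eqToHom_app]
  rfl

/-- The image under `d` of a lax morphism of categorical `S`-algebras. -/
def dLax (f : LaxMor A B) : LaxMor (Q.dObj A) (Q.dObj B) where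
  functor := Q.dFunctor f.functor
  cell := Q.dCell f
  unit := by
    rw [dCell_app]
    refine (Q.lax_unit A.obj (Trans.app f.cell) _).trans ?_
    rw [f.unit]
    exact aux_unit Q (Fun.obj f.functor) B.ident _
  mul := by
    have h₁ := (Q.lax_mul A.obj (Trans.app f.cell) (Q.commIso B.mor).inv).trans
      (congrArg (fun k => _ ≫ Q.w.map k ≫ _) f.mul)
    have h₃ := map_cmp Q.w (carrier B) _ _ (cell_composable f.cell)
    refine (congrArg (fun k => T.μ.app (Q.dObj A).obj.A ≫ k) (Q.dCell_app f)).trans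
      ((h₁.trans (congrArg (fun k => _ ≫ k) ((congrArg (· ≫ Fun.mor (Q.ofW B)) h₃).trans
      (Fun.cmp_mor (Q.ofW B) _ _ _)))).trans ((precomp_cmp _ _ _ _ _).trans (cmp_congr _ ?_ ?_ _ _)))
    · rw [dCell_app]
      exact (Q.lax_mul₁ A.obj B.mor (Trans.app f.cell)).symm
    · rw [dCell_app]
      exact (Q.lax_mul₂ A.obj (Trans.app f.cell) _).symm

/-- The image under `d` of a transformation of lax morphisms. -/
def dTrans {f g : LaxMor A B} (α : f ⟶ g) : Q.dLax f ⟶ Q.dLax g :=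
  { trans := Q.toW A ◁ (mapTrans Q.w (LaxTrans.trans α) ▷ Q.ofW B)
    comm := trans_ext (by
      have h₀ := congrArg Q.w.map (LaxTrans.comm_app α)
      have h₁ := (map_cmp Q.w (carrier B) _ _ _).symm.trans (h₀.trans (map_cmp Q.w (carrier B) _ _ _))
      have h₂ := (Fun.cmp_mor (Q.ofW B) _ _ _).symm.trans
        ((congrArg (· ≫ Fun.mor (Q.ofW B)) h₁).trans (Fun.cmp_mor (Q.ofW B) _ _ _))
      have h₃ := (precomp_cmp _ (T.map (Q.commIso A.obj).hom ≫ Q.distApp A.obj.A) _ _ _).symm.trans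
        ((congrArg (fun k => (T.map (Q.commIso A.obj).hom ≫ Q.distApp A.obj.A) ≫ k) h₂).trans
          (precomp_cmp _ _ _ _ _))
      refine Eq.trans (cmp_congr _ ?_ ?_ _ _) (h₃.trans (cmp_congr _ ?_ ?_ _ _))
      · exact Q.dCell_app f
      · exact (Q.lax_tgt A.obj B.mor (Trans.app (LaxTrans.trans α)) (Q.commIso B.mor).inv).symm
      · exact (Q.lax_src A.obj B.mor (Trans.app (LaxTrans.trans α))).symm
      · exact (Q.dCell_app g).symm) : LaxTrans (Q.dLax f) (Q.dLax g) }

/-- The extension of `d` to lax morphisms and their transformations. -/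
def dLaxFunctor (A B : CAlg S) : LaxMor A B ⥤ LaxMor (Q.dObj A) (Q.dObj B) where
  obj f := Q.dLax f
  map α := Q.dTrans α
  map_id f := LaxTrans.ext (by
    have h : mapTrans Q.w (𝟙 f.functor) = 𝟙 _ := mapTrans_eqToHom _ rfl
    change Q.toW A ◁ (mapTrans Q.w (𝟙 f.functor) ▷ Q.ofW B) = 𝟙 _
    rw [h, Bicategory.id_whiskerRight, Bicategory.whiskerLeft_id])
  map_comp α β := LaxTrans.ext (by
    have h : mapTrans Q.w (LaxTrans.trans α ≫ LaxTrans.trans β) =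
        mapTrans Q.w (LaxTrans.trans α) ≫ mapTrans Q.w (LaxTrans.trans β) :=
      (InternalCat.map Q.w).map₂_comp (LaxTrans.trans α) (LaxTrans.trans β)
    change Q.toW A ◁ (mapTrans Q.w (LaxTrans.trans α ≫ LaxTrans.trans β) ▷ Q.ofW B) = _
    rw [h, Bicategory.comp_whiskerRight, Bicategory.whiskerLeft_comp]
    rfl)

/-- `d` preserves the terminal algebra. -/
def dTerminal : IsTerminal (Q.d.obj (terminalAlgebra S)) :=
  have := Q.d_preserves (Discrete PEmpty.{1})
  (terminalAlgebraIsTerminal S).isTerminalObj Q.d _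

/-- The comparison `1 ⟶ d 1` of categorical `T`-algebras. -/
def oneComparison : oneCAlg T ⟶ Q.dObj (oneCAlg S) :=
  { obj := Q.dTerminal.from _
    mor := Q.dTerminal.from _
    mor_src := Q.dTerminal.hom_ext _ _
    mor_tgt := Q.dTerminal.hom_ext _ _
    ident_mor := Q.dTerminal.hom_ext _ _
    comp_mor := Q.dTerminal.hom_ext _ _ : Fun _ _ }

/-- The `2`-functor sending a categorical `S`-algebra `A` to the category of internal
`T`-algebras in `A`, i.e. of internal `T`-algebras in `d A`. -/
def IAlgOver : StrictPseudofunctor (CAlg S) Cat.{v, v} := Q.dCat.comp (IAlg T)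

/-- The functor from internal `S`-algebras in `A` to internal `T`-algebras in `A`: apply `d` to a
lax morphism `1 ⟶ A` and precompose with the comparison `1 ⟶ d 1`. -/
def delta (A : CAlg S) : (IAlg S).obj A ⟶ Q.IAlgOver.obj A :=
  (Q.dLaxFunctor (oneCAlg S) A ⋙
    LaxMor.precompFunctor Q.oneComparison (Q.dObj A)).toCatHom

end Lax

end AdjSquare

/-! ### Two-sided bar constructions -/

section Bar

variable {E : Type u₂} [Category.{v} E] {T : Monad E}

/-- The iterates `Tⁿ X` of a `T`-algebra `X`. -/
def barPow (X : T.Algebra) : ℕ → E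
  | 0 => X.A
  | n + 1 => T.obj (barPow X n)

/-- The maps `T^(n+1) X ⟶ Tⁿ X`: the last one is `Tⁿ` of the structure map of `X`, the `i`-th one
is `T^i` of a component of the multiplication. -/
def barFace (X : T.Algebra) : (n : ℕ) → Fin (n + 1) → (barPow X (n + 1) ⟶ barPow X n)
  | 0, _ => X.a
  | n + 1, i => Fin.cases (T.μ.app (barPow X n)) (fun j => T.map (barFace X n j)) i

/-- The maps `Tⁿ X ⟶ T^(n+1) X`: the `i`-th one is `T^i` of a component of the unit. -/
def barDegen (X : T.Algebra) : (n : ℕ) → Fin (n + 1) → (barPow X n ⟶ barPow X (n + 1))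
  | 0, _ => T.η.app X.A
  | n + 1, i => Fin.cases (T.η.app (barPow X (n + 1))) (fun j => T.map (barDegen X n j)) i

/-- An isomorphism of a simplicial object `N` with May's two-sided bar construction `B(G, T, X)`
of a functor `G` with a right action of the monad `T` and a `T`-algebra `X`: in degree `n` this is
`G Tⁿ X`, the face `d₀` is the action on `G`, the further faces are given by the multiplication of
`T` and finally by the structure map of `X`, and the degeneracies by the unit of `T`. -/
structure BarIso {D : Type u'} [Category.{v} D] (G : E ⥤ D) (act : T.toFunctor ⋙ G ⟶ G)
    (X : T.Algebra) (N : SimplicialObject D) where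
  iso (n : ℕ) : N.obj (op (SimplexCategory.mk n)) ≅ G.obj (barPow X n)
  δ_zero (n : ℕ) : N.δ (0 : Fin (n + 2)) ≫ (iso n).hom =
    (iso (n + 1)).hom ≫ act.app (barPow X n)
  δ_succ (n : ℕ) (i : Fin (n + 1)) : N.δ i.succ ≫ (iso n).hom =
    (iso (n + 1)).hom ≫ G.map (barFace X n i)
  σ (n : ℕ) (i : Fin (n + 1)) : N.σ i ≫ (iso (n + 1)).hom =
    (iso n).hom ≫ G.map (barDegen X n i)

/-- The right action of `T` on the free algebra functor. The bar construction `B(F^T, T, X)`, which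
is `B(T, T, X)` with its structure of a simplicial `T`-algebra, is the cotriple resolution
of `X`. -/
def freeAction (T : Monad E) : T.toFunctor ⋙ T.free ⟶ T.free :=
  Functor.whiskerLeft T.free T.adj.counit

theorem freeAction_app (X : E) : ((freeAction T).app X).f = T.μ.app X := by
  simp [freeAction]; rfl

end Bar

/-! ### Representations of 2-functors -/

section Rep

variable {B : Type u} [Bicategory.{v, v} B] [Bicategory.Strict B]

/-- A representation of a strict `2`-functor `F` with values in categories: isomorphisms of
categories `Hom(X, A) ≅ F A`, strictly natural with respect to `1`-cells and `2`-cells. -/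
structure TwoRep (F : StrictPseudofunctor B Cat.{v, v}) (X : B) where
  iso (A : B) : Cat.of (X ⟶ A) ≅ F.obj A
  natural {A A' : B} (g : A ⟶ A') :
    (postcomposingCat X A A').obj g ≫ (iso A').hom = (iso A).hom ≫ F.map g
  natural₂ {A A' : B} {g g' : A ⟶ A'} (θ : g ⟶ g') :
    (postcomposingCat X A A').map θ ▷ (iso A').hom =
      eqToHom (natural g) ≫ (iso A).hom ◁ F.map₂ θ ≫ eqToHom (natural g').symm

namespace TwoRep

variable {F : StrictPseudofunctor B Cat.{v, v}} {X : B} (ρ : TwoRep F X)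

/-- The object of `F A` corresponding to a `1`-cell `X ⟶ A`. -/
def elt {A : B} (f : X ⟶ A) : F.obj A := (ρ.iso A).hom.toFunctor.obj f

/-- The map in `F A` corresponding to a `2`-cell. -/
def eltMap {A : B} {f g : X ⟶ A} (θ : f ⟶ g) : ρ.elt f ⟶ ρ.elt g :=
  (ρ.iso A).hom.toFunctor.map θ

/-- The `1`-cell `X ⟶ A` classifying an object of `F A`. -/
def classify {A : B} (x : F.obj A) : X ⟶ A := (ρ.iso A).inv.toFunctor.obj x

theorem elt_classify {A : B} (x : F.obj A) : ρ.elt (ρ.classify x) = x :=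
  Functor.congr_obj (congrArg Cat.Hom.toFunctor (ρ.iso A).inv_hom_id) x

end TwoRep

end Rep

namespace AdjSquare

section Zeta

variable {C : Type u₁} [Category.{v} C] {E : Type u₂} [Category.{v} E]
  {S : Monad C} {T : Monad E} (Q : AdjSquare S T)
  [HasFiniteLimits C] [HasFiniteLimits E] [CartesianMonad S] [CartesianMonad T]
  {HS h : CAlg S} (ρS : TwoRep (IAlg S) HS) (ρ : TwoRep Q.IAlgOver h)

/-- The canonical map `ζ : h^T ⟶ H^S`: it classifies the internal `T`-algebra in `H^S` which is the
image under `δ` of the canonical internal `S`-algebra of `H^S`. -/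
def zeta : h ⟶ HS := ρ.classify ((Q.delta HS).toFunctor.obj (ρS.elt (𝟙 HS)))

/-- The statement that `δ` corresponds to the restriction functor along `ζ`. -/
def DeltaIsRestriction : Prop :=
  ∀ A : CAlg S, (precomposingCat h HS A).obj (Q.zeta ρS ρ) ≫ (ρ.iso A).hom =
    (ρS.iso A).hom ≫ Q.delta A

variable {Q ρS ρ}

theorem DeltaIsRestriction.elt_comp (H : Q.DeltaIsRestriction ρS ρ) {A : CAlg S}
    (x : (IAlg S).obj A) :
    (Q.delta A).toFunctor.obj x = ρ.elt (Q.zeta ρS ρ ≫ ρS.classify x) :=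
  ((Functor.congr_obj (congrArg Cat.Hom.toFunctor (H A)) (ρS.classify x)).trans
    (congrArg (Q.delta A).toFunctor.obj (ρS.elt_classify x))).symm

end Zeta

end AdjSquare

end

/-! Let `K` be a functor with a right action of `T`. If the action is cartesian, the bar
construction B(K,T,X) is the nerve of an internal category: objects K X, arrows K T X, source the
action, target K of the structure map. The naturality square of the action at the structure map of X
says exactly that K T T X is the object of composable pairs, and the laws of module and algebra
become the laws of a category (`CartesianModule.barCat`). More generally K Tⁿ⁺¹ X is the pullback of
K Tⁿ X and K T X, so K Tⁿ X represents strings of n arrows. By Yoneda the simplicial operators can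
then be computed on one universal string (`universal_bijective`, `universal_face`,
`universal_degen`).

For X = 1 this category represents internal algebras. Let K be left adjoint to U^T R, with the
action transpose to the algebra structures of the R B. A lax morphism 1 ⟶ R A consists of an object
1 ⟶ R A₀ and an arrow T 1 ⟶ R A₁ with prescribed ends, subject to a unit law and a multiplication
law. Their transposes K 1 ⟶ A₀ and K T 1 ⟶ A₁ are the data of an internal functor out of the bar
category, and the two laws say that it preserves identities and composition (`ModuleAdj.twoRep`).

Free algebra functors with R the identity give H^T and H^S. For h^T take K = p F^T and R = d. Here p
exists by the adjoint triangle theorem, because algebras for a finitary monad have coequalizers.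
Both p F^T and G = F^S c are left adjoint to U^T d ≅ w U^S, and their actions are transposes of the
same algebra structures, so they are isomorphic as modules (`ModuleAdj.act_uniq`). Thus the
hypothesis that λ is cartesian passes to p F^T, although p need not preserve pullbacks.

Finally, δ is strictly 2-natural in A, so the 2-dimensional Yoneda argument `TwoRep.precomp_eq`
identifies it with restriction along ζ. Across the representing isomorphisms the unit of an
adjunction L ⊣ δ becomes a universal arrow to this restriction functor, which is what a left Kan
extension along ζ is (`isUniversal_of_adjunction`). -/

noncomputable section

/-! ### Coequalizers of algebras for a finitary monad -/

/-- A sequence of partial algebra structures `S Xₙ ⟶ Xₙ₊₁`, whose colimit is an `S`-algebra if `S`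
preserves it. -/
structure AlgebraSequence {C : Type u} [Category.{v} C] (S : Monad C) where
  X : ℕ → C
  q (n : ℕ) : X n ⟶ X (n + 1)
  x (n : ℕ) : S.obj (X n) ⟶ X (n + 1)
  unit (n : ℕ) : S.η.app (X n) ≫ x n = q n
  mul (n : ℕ) : S.μ.app (X n) ≫ S.map (q n) ≫ x (n + 1) = S.map (x n) ≫ x (n + 1)

namespace AlgebraSequence

variable {C : Type u} [Category.{v} C] {S : Monad C} (A : AlgebraSequence S)

/-- This compatibility need not be an axiom: it is `mul` precomposed with the unit at `S Xₙ`, by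
naturality of the unit and a unit law of the monad. -/
theorem map_q_x (n : ℕ) : S.map (A.q n) ≫ A.x (n + 1) = A.x n ≫ A.q (n + 1) := by
  rw [← A.unit (n + 1), ← Category.assoc (A.x n)]
  have h₁ : A.x n ≫ S.η.app (A.X (n + 1)) = S.η.app (S.obj (A.X n)) ≫ S.map (A.x n) :=
    S.η.naturality (A.x n)
  rw [h₁, Category.assoc, ← A.mul n, ← Category.assoc (S.η.app _), S.left_unit, Category.id_comp]

/-- The diagram of the objects of the sequence. -/
def diagram : ℕ ⥤ C := Functor.ofSequence A.q

theorem diagram_map (n : ℕ) : A.diagram.map (homOfLE (Nat.le_add_right n 1)) = A.q n :=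
  Functor.ofSequence_map_homOfLE_succ A.q n

/-- A cocone on the image of the diagram under a functor. -/
def coconeMk {D : Type u'} [Category.{v} D] (F : C ⥤ D) {Z : D} (k : ∀ n, F.obj (A.X n) ⟶ Z)
    (hk : ∀ n, F.map (A.q n) ≫ k (n + 1) = k n) : Cocone (A.diagram ⋙ F) where
  pt := Z
  ι := NatTrans.ofSequence k (fun n =>
    (congrArg (fun t => F.map t ≫ k (n + 1)) (A.diagram_map n)).trans
      ((hk n).trans (Category.comp_id _).symm))

/-- The maps to the colimit of the sequence. -/
def inc [HasColimitsOfShape ℕ C] (n : ℕ) : A.X n ⟶ colimit A.diagram := colimit.ι A.diagram n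

section

variable [HasColimitsOfShape ℕ C]

theorem q_inc (n : ℕ) : A.q n ≫ A.inc (n + 1) = A.inc n := by
  rw [← diagram_map]
  exact colimit.w A.diagram _

theorem hom_ext' {Z : C} {f g : colimit A.diagram ⟶ Z} (h : ∀ n, A.inc n ≫ f = A.inc n ≫ g) :
    f = g :=
  colimit.hom_ext h

/-- Maps out of the colimit of the sequence. -/
def desc {Z : C} (k : ∀ n, A.X n ⟶ Z) (hk : ∀ n, A.q n ≫ k (n + 1) = k n) :
    colimit A.diagram ⟶ Z :=
  colimit.desc A.diagram (A.coconeMk (𝟭 C) k hk)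

theorem inc_desc {Z : C} (k : ∀ n, A.X n ⟶ Z) (hk : ∀ n, A.q n ≫ k (n + 1) = k n) (n : ℕ) :
    A.inc n ≫ A.desc k hk = k n :=
  colimit.ι_desc (A.coconeMk (𝟭 C) k hk) n

variable [PreservesColimitsOfShape ℕ S.toFunctor]

theorem hom_ext_map {Z : C} {f g : S.obj (colimit A.diagram) ⟶ Z}
    (h : ∀ n, S.map (A.inc n) ≫ f = S.map (A.inc n) ≫ g) : f = g :=
  (isColimitOfPreserves S.toFunctor (colimit.isColimit A.diagram)).hom_ext h

theorem hom_ext_map_map {Z : C} {f g : S.obj (S.obj (colimit A.diagram)) ⟶ Z}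
    (h : ∀ n, S.map (S.map (A.inc n)) ≫ f = S.map (S.map (A.inc n)) ≫ g) : f = g :=
  (isColimitOfPreserves S.toFunctor
    (isColimitOfPreserves S.toFunctor (colimit.isColimit A.diagram))).hom_ext h

/-- The structure map of the colimit of the sequence. -/
def str : S.obj (colimit A.diagram) ⟶ colimit A.diagram :=
  (isColimitOfPreserves S.toFunctor (colimit.isColimit A.diagram)).desc
    (A.coconeMk S.toFunctor (fun n => A.x n ≫ A.inc (n + 1)) (fun n => by
      rw [← Category.assoc, map_q_x, Category.assoc, q_inc]))

theorem map_inc_str (n : ℕ) : S.map (A.inc n) ≫ A.str = A.x n ≫ A.inc (n + 1) :=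
  (isColimitOfPreserves S.toFunctor (colimit.isColimit A.diagram)).fac _ n

/-- The colimit of the sequence as an algebra. -/
@[reducible]
def algebra : S.Algebra where
  A := colimit A.diagram
  a := A.str
  unit := A.hom_ext' fun n => by
    have h : A.inc n ≫ S.η.app (colimit A.diagram) = S.η.app (A.X n) ≫ S.map (A.inc n) :=
      S.η.naturality (A.inc n)
    rw [← Category.assoc, h, Category.assoc, map_inc_str, ← Category.assoc, A.unit, q_inc,
      Category.comp_id]
  assoc := A.hom_ext_map_map fun n => by
    have h : S.map (S.map (A.inc n)) ≫ S.μ.app (colimit A.diagram) =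
      S.μ.app (A.X n) ≫ S.map (A.inc n) := S.μ.naturality (A.inc n)
    -- The law `mul` compares the two composites only in `Xₙ₊₂`, so stage n is first pushed to stage
    -- n + 1.
    have h₁ : S.map (A.inc n) = S.map (A.q n) ≫ S.map (A.inc (n + 1)) := by
      rw [← S.map_comp, q_inc]
    rw [← Category.assoc, ← Category.assoc (S.map (S.map _)) (S.map _), ← S.map_comp, map_inc_str,
      S.map_comp, Category.assoc (S.map (A.x n)), map_inc_str, ← Category.assoc (S.map (A.x n)), ← A.mul,
      h, h₁]
    simp only [Category.assoc, map_inc_str]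

/-- A compatible family of maps to an algebra induces a homomorphism on the colimit. -/
def algebraDesc {Z : S.Algebra} (k : ∀ n, A.X n ⟶ Z.A) (hk : ∀ n, A.q n ≫ k (n + 1) = k n)
    (hx : ∀ n, A.x n ≫ k (n + 1) = S.map (k n) ≫ Z.a) : A.algebra ⟶ Z where
  f := A.desc k hk
  h := A.hom_ext_map fun n => by
    rw [← Category.assoc, ← S.map_comp, inc_desc, ← hx, ← Category.assoc, map_inc_str,
      Category.assoc, inc_desc]

end

end AlgebraSequence

/-! ### The coequalizer of two homomorphisms as the colimit of a sequence -/

namespace CoequalizerSequence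

variable {C : Type u} [Category.{v} C] {S : Monad C} [HasCoequalizers C]

/-- A step of the construction of a coequalizer of algebras. -/
structure Stage (S : Monad C) where
  X : C
  Y : C
  q : X ⟶ Y
  x : S.obj X ⟶ Y
  unit : S.η.app X ≫ x = q

/-- The next step: the universal `S Y ⟶ Y'` with the associativity condition. -/
def Stage.next (s : Stage S) : Stage S where
  X := s.Y
  Y := coequalizer (S.μ.app s.X ≫ S.map s.q) (S.map s.x)
  -- The unit law leaves no other choice for `q` once `x` is the coequalizer map.
  q := S.η.app s.Y ≫ coequalizer.π (S.μ.app s.X ≫ S.map s.q) (S.map s.x)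
  x := coequalizer.π (S.μ.app s.X ≫ S.map s.q) (S.map s.x)
  unit := rfl

variable {A B : S.Algebra} (f g : A ⟶ B)

/-- The steps of the construction of the coequalizer of `f` and `g`. -/
def stage : ℕ → Stage S
  | 0 =>
    { X := B.A
      Y := coequalizer f.f g.f
      q := coequalizer.π f.f g.f
      x := B.a ≫ coequalizer.π f.f g.f
      unit := by
        rw [← Category.assoc, B.unit]
        exact Category.id_comp _ }
  | n + 1 => (stage n).next

theorem stage_mul (n : ℕ) : S.μ.app (stage f g n).X ≫ S.map (stage f g n).q ≫ (stage f g (n + 1)).x =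
    S.map (stage f g n).x ≫ (stage f g (n + 1)).x := by
  exact (Category.assoc _ _ _).symm.trans (coequalizer.condition _ _)

/-- The sequence whose colimit is the coequalizer of `f` and `g`. -/
def seq : AlgebraSequence S where
  X n := (stage f g n).X
  q n := (stage f g n).q
  x n := (stage f g n).x
  unit n := (stage f g n).unit
  mul n := stage_mul f g n

variable {f g}

section Desc

variable {Z : S.Algebra} (k : B ⟶ Z) (hk : f ≫ k = g ≫ k)

/-- Maps from a step to an algebra, compatible with the structure. -/
structure StageMap (s : Stage S) (Z : S.Algebra) where
  k : s.X ⟶ Z.A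
  l : s.Y ⟶ Z.A
  q_l : s.q ≫ l = k
  x_l : s.x ≫ l = S.map k ≫ Z.a

/-- The extension of a compatible map to the next step. -/
def StageMap.next {s : Stage S} {Z : S.Algebra} (m : StageMap s Z) : StageMap s.next Z where
  k := m.l
  -- The two composites agree by associativity of `Z` and naturality of the multiplication.
  l := coequalizer.desc (S.map m.l ≫ Z.a) (by
    rw [Category.assoc, ← Category.assoc (S.map s.q), ← S.map_comp, m.q_l,
      ← Category.assoc (S.map s.x), ← S.map_comp, m.x_l, S.map_comp, Category.assoc, ← Z.assoc,
      ← Category.assoc, ← Category.assoc]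
    exact congrArg (· ≫ Z.a) (S.μ.naturality m.k).symm)
  q_l := by
    have h : m.l ≫ S.η.app Z.A = S.η.app s.Y ≫ S.map m.l := S.η.naturality m.l
    refine (Category.assoc _ _ _).trans ?_
    refine (congrArg (fun t => S.η.app s.Y ≫ t) (coequalizer.π_desc _ _)).trans ?_
    rw [← Category.assoc, ← h, Category.assoc, Z.unit]
    exact Category.comp_id _
  x_l := coequalizer.π_desc _ _

/-- The maps from all steps induced by a homomorphism that coequalizes `f` and `g`. -/
def stageMap : (n : ℕ) → StageMap (stage f g n) Z
  | 0 =>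
    { k := k.f
      l := coequalizer.desc k.f (congrArg Monad.Algebra.Hom.f hk)
      q_l := coequalizer.π_desc _ _
      x_l := by
        refine (Category.assoc _ _ _).trans ?_
        refine (congrArg (fun t => B.a ≫ t) (coequalizer.π_desc _ _)).trans ?_
        exact k.h.symm }
  | n + 1 => (stageMap n).next

end Desc

variable [HasColimitsOfShape ℕ C] [PreservesColimitsOfShape ℕ S.toFunctor]

variable (f g) in
/-- The map to the coequalizer. -/
def proj : B ⟶ (seq f g).algebra where
  f := (seq f g).inc 0
  h := by
    refine ((seq f g).map_inc_str 0).trans ((Category.assoc _ _ _).trans ?_)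
    exact congrArg (fun t => B.a ≫ t) ((seq f g).q_inc 0)

theorem condition : f ≫ proj f g = g ≫ proj f g :=
  Monad.Algebra.Hom.ext (by
    have h := (seq f g).q_inc 0
    change f.f ≫ (seq f g).inc 0 = g.f ≫ (seq f g).inc 0
    rw [← h]
    refine (Category.assoc _ _ _).symm.trans (Eq.trans ?_ (Category.assoc _ _ _))
    exact congrArg (· ≫ (seq f g).inc (0 + 1)) (coequalizer.condition f.f g.f))

/-- A homomorphism is determined stage by stage. Stage 1 is a quotient of `B`, by the coequalizer in
`C`. Each later stage is a quotient of `S` of the previous one, and there the homomorphism law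
dictates the values. -/
theorem hom_ext {Z : S.Algebra} {k l : (seq f g).algebra ⟶ Z}
    (h : proj f g ≫ k = proj f g ≫ l) : k = l := by
  have h₀ : (seq f g).inc 0 ≫ k.f = (seq f g).inc 0 ≫ l.f := congrArg Monad.Algebra.Hom.f h
  have h₁ (m : (seq f g).algebra ⟶ Z) (n : ℕ) : (seq f g).x n ≫ (seq f g).inc (n + 1) ≫ m.f =
      S.map ((seq f g).inc n ≫ m.f) ≫ Z.a := by
    refine (Category.assoc _ _ _).symm.trans
      ((congrArg (· ≫ m.f) ((seq f g).map_inc_str n).symm).trans ?_)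
    rw [S.map_comp, Category.assoc, Category.assoc, m.h]
  refine Monad.Algebra.Hom.ext ((seq f g).hom_ext' fun n => ?_)
  induction n with
  | zero => exact h₀
  | succ n ih =>
    cases n with
    | zero =>
      have h₂ (m : (seq f g).algebra ⟶ Z) : coequalizer.π f.f g.f ≫ (seq f g).inc (0 + 1) ≫ m.f =
          (seq f g).inc 0 ≫ m.f :=
        (Category.assoc _ _ _).symm.trans (congrArg (· ≫ m.f) ((seq f g).q_inc 0))
      exact coequalizer.hom_ext ((h₂ k).trans (ih.trans (h₂ l).symm))
    | succ n =>
      refine coequalizer.hom_ext ((h₁ k (n + 1)).trans (Eq.trans ?_ (h₁ l (n + 1)).symm))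
      rw [ih]

/-- The map out of the coequalizer. -/
def desc {Z : S.Algebra} (k : B ⟶ Z) (hk : f ≫ k = g ≫ k) : (seq f g).algebra ⟶ Z :=
  (seq f g).algebraDesc (fun n => (stageMap k hk n).k) (fun n => (stageMap k hk n).q_l)
    (fun n => (stageMap k hk n).x_l)

theorem proj_desc {Z : S.Algebra} (k : B ⟶ Z) (hk : f ≫ k = g ≫ k) :
    proj f g ≫ desc k hk = k :=
  Monad.Algebra.Hom.ext ((seq f g).inc_desc _ _ 0)

variable (f g) in
/-- The cofork of the construction is a colimit. -/
def isColimit : IsColimit (Cofork.ofπ (proj f g) condition) :=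
  Cofork.IsColimit.mk _ (fun s => desc s.π s.condition) (fun _ => proj_desc _ _)
    (fun _ _ hm => hom_ext (hm.trans (proj_desc _ _).symm))

end CoequalizerSequence

/-- Algebras for a monad that preserves colimits of sequences have coequalizers. -/
theorem hasCoequalizers_algebra {C : Type u} [Category.{v} C] (S : Monad C)
    [HasCoequalizers C] [HasColimitsOfShape ℕ C] [PreservesColimitsOfShape ℕ S.toFunctor] :
    HasCoequalizers S.Algebra :=
  have {A B : S.Algebra} (f g : A ⟶ B) : HasCoequalizer f g :=
    ⟨⟨_, CoequalizerSequence.isColimit f g⟩⟩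
  hasCoequalizers_of_hasColimit_parallelPair _

/-! ### The left adjoint of `d` -/

namespace AdjSquare

/-- Adjoint triangle theorem: U^T is monadic, U^T d ≅ w U^S has the left adjoint `G`, and
`S`-algebras have reflexive coequalizers. -/
theorem d_isRightAdjoint {C : Type u₁} [Category.{v} C] {E : Type u₂} [Category.{v} E]
    {S : Monad C} {T : Monad E} (Q : AdjSquare S T) [HasColimits C]
    [PreservesFilteredColimits S.toFunctor] : Q.d.IsRightAdjoint := by
  -- The hypotheses concern diagrams of size `v`; they are lowered to size 0, where ℕ lives.
  have : PreservesFilteredColimitsOfSize.{0, 0} S.toFunctor :=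
    preservesSmallestFilteredColimits_of_preservesFilteredColimits.{v, v} S.toFunctor
  have : PreservesColimitsOfShape ℕ S.toFunctor :=
    PreservesFilteredColimitsOfSize.preserves_filtered_colimits ℕ
  have : HasColimitsOfSize.{0, 0} C := hasColimitsOfSizeShrink.{0, 0, v, v} C
  have : HasCoequalizers S.Algebra := hasCoequalizers_algebra S
  have : HasReflexiveCoequalizers S.Algebra := ⟨fun _ _ _ _ _ => inferInstance⟩
  have : (Q.d ⋙ T.forget).IsRightAdjoint :=
    (Q.adjG.ofNatIsoRight Q.comm.symm).isRightAdjoint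
  exact isRightAdjoint_triangle_lift_monadic T.forget

end AdjSquare

/-! ### Internal categories from cartesian actions of a monad -/

/-- A functor `K` with a cartesian right action of the monad `T`. -/
structure CartesianModule {E : Type u₂} [Category.{v} E] (T : Monad E) (D : Type u')
    [Category.{v} D] where
  K : E ⥤ D
  lam (X : E) : K.obj (T.obj X) ⟶ K.obj X
  nat {X Y : E} (f : X ⟶ Y) : K.map (T.map f) ≫ lam Y = lam X ≫ K.map f
  unit (X : E) : K.map (T.η.app X) ≫ lam X = 𝟙 (K.obj X)
  assoc (X : E) : K.map (T.μ.app X) ≫ lam X = lam (T.obj X) ≫ lam X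
  cartesian {X Y : E} (f : X ⟶ Y) : IsPullback (lam X) (K.map (T.map f)) (K.map f) (lam Y)

namespace CartesianModule

variable {E : Type u₂} [Category.{v} E] {T : Monad E} {D : Type u'} [Category.{v} D]
  (M : CartesianModule T D)

/-- Identifies an abstract composable pair with a concrete map into K T T X, so that composition
becomes postcomposition with K μ. -/
theorem lift_eq (X : T.Algebra) {W : D} (t : W ⟶ M.K.obj (T.obj (T.obj X.A)))
    (f g : W ⟶ M.K.obj (T.obj X.A)) (w : f ≫ M.K.map X.a = g ≫ M.lam X.A)
    (hf : t ≫ M.lam (T.obj X.A) = f) (hg : t ≫ M.K.map (T.map X.a) = g) :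
    (M.cartesian X.a).lift f g w = t := by
  apply (M.cartesian X.a).hom_ext
  · rw [IsPullback.lift_fst, hf]
  · rw [IsPullback.lift_snd, hg]

theorem map_mul_naturality {X Y : E} (f : X ⟶ Y) :
    M.K.map (T.μ.app X) ≫ M.K.map (T.map f) = M.K.map (T.map (T.map f)) ≫ M.K.map (T.μ.app Y) := by
  rw [← M.K.map_comp, ← M.K.map_comp]
  exact congrArg M.K.map (T.μ.naturality f).symm

theorem map_unit_naturality {X Y : E} (f : X ⟶ Y) :
    M.K.map (T.η.app X) ≫ M.K.map (T.map f) = M.K.map f ≫ M.K.map (T.η.app Y) := by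
  rw [← M.K.map_comp, ← M.K.map_comp]
  exact congrArg M.K.map (T.η.naturality f).symm

theorem map_mul_act (X : T.Algebra) :
    M.K.map (T.μ.app X.A) ≫ M.K.map X.a = M.K.map (T.map X.a) ≫ M.K.map X.a := by
  rw [← M.K.map_comp, X.assoc, M.K.map_comp]

theorem map_unit_act (X : T.Algebra) :
    M.K.map (T.η.app X.A) ≫ M.K.map X.a = 𝟙 _ := by
  rw [← M.K.map_comp, X.unit]
  exact M.K.map_id _

/-- The internal category whose nerve is the two-sided bar construction. -/
def barCat (X : T.Algebra) : InternalCat D where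
  obj := M.K.obj X.A
  mor := M.K.obj (T.obj X.A)
  pairs := M.K.obj (T.obj (T.obj X.A))
  src := M.lam X.A
  tgt := M.K.map X.a
  ident := M.K.map (T.η.app X.A)
  fst := M.lam (T.obj X.A)
  snd := M.K.map (T.map X.a)
  comp := M.K.map (T.μ.app X.A)
  isPullback := M.cartesian X.a
  ident_src := M.unit X.A
  ident_tgt := M.map_unit_act X
  comp_src := M.assoc X.A
  comp_tgt := M.map_mul_act X
  id_comp := by
    -- K T η names the pair of an arrow preceded by the identity of its source; `comp_id` uses K η T
    -- instead. The two unit laws of the monad then apply.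
    rw [M.lift_eq X (M.K.map (T.map (T.η.app X.A))), ← M.K.map_comp]
    · exact (congrArg M.K.map (T.right_unit X.A)).trans (M.K.map_id _)
    · exact M.nat _
    · rw [← M.K.map_comp, ← T.map_comp, X.unit]
      exact (congrArg M.K.map (T.map_id _)).trans (M.K.map_id _)
  comp_id := by
    rw [M.lift_eq X (M.K.map (T.η.app (T.obj X.A))), ← M.K.map_comp]
    · exact (congrArg M.K.map (T.left_unit X.A)).trans (M.K.map_id _)
    · exact M.unit _
    · exact M.map_unit_naturality X.a
  assoc {W} f g h hfg hgh := by
    let l₁ := (M.cartesian X.a).lift f g hfg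
    let l₂ := (M.cartesian X.a).lift g h hgh
    have h₁ : l₁ ≫ M.lam _ = f := (M.cartesian X.a).lift_fst _ _ _
    have h₂ : l₁ ≫ M.K.map (T.map X.a) = g := (M.cartesian X.a).lift_snd _ _ _
    have h₃ : l₂ ≫ M.lam _ = g := (M.cartesian X.a).lift_fst _ _ _
    have h₄ : l₂ ≫ M.K.map (T.map X.a) = h := (M.cartesian X.a).lift_snd _ _ _
    -- A composable triple is a map into K T³ X. Composing its first two arrows is K T μ, composing
    -- its last two is K μ T, and the associativity of the monad compares the results.
    let t := (M.cartesian (T.map X.a)).lift l₁ l₂ (h₂.trans h₃.symm)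
    have ht₁ : t ≫ M.lam _ = l₁ := (M.cartesian (T.map X.a)).lift_fst _ _ _
    have ht₂ : t ≫ M.K.map (T.map (T.map X.a)) = l₂ := (M.cartesian (T.map X.a)).lift_snd _ _ _
    rw [M.lift_eq X (t ≫ M.K.map (T.map (T.μ.app X.A))),
      M.lift_eq X (t ≫ M.K.map (T.μ.app (T.obj X.A)))]
    · rw [Category.assoc, Category.assoc, ← M.K.map_comp, ← M.K.map_comp]
      exact congrArg (fun k => t ≫ M.K.map k) (T.assoc X.A)
    · rw [Category.assoc, M.assoc, ← Category.assoc, ht₁, h₁]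
    · rw [Category.assoc, M.map_mul_naturality, ← Category.assoc, ht₂]
    · rw [Category.assoc, M.nat, ← Category.assoc, ht₁]
    · rw [Category.assoc, ← M.K.map_comp, ← T.map_comp, X.assoc, T.map_comp, M.K.map_comp,
        ← Category.assoc, ht₂, h₄]

theorem barCat_cmp (X : T.Algebra) {W : D} (t : W ⟶ M.K.obj (T.obj (T.obj X.A)))
    (f g : W ⟶ M.K.obj (T.obj X.A)) (w : f ≫ M.K.map X.a = g ≫ M.lam X.A)
    (hf : t ≫ M.lam (T.obj X.A) = f) (hg : t ≫ M.K.map (T.map X.a) = g) :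
    (M.barCat X).cmp f g w = t ≫ M.K.map (T.μ.app X.A) :=
  congrArg (· ≫ M.K.map (T.μ.app X.A)) (M.lift_eq X t f g w hf hg)

end CartesianModule

/-! ### Strings of generalized arrows -/

namespace InternalCat

section Strings

variable {D : Type u'} [Category.{v} D] (A : InternalCat D)

/-- The strings of `n` composable generalized arrows, in the order of the nerve. -/
abbrev Strings (Y : D) (n : ℕ) : Type v := ComposableArrows (A.Pt Y)ᵒᵖ n

variable {A}

/-- Restriction of strings along a map of stages. -/
def Strings.restrict {Y Z : D} {n : ℕ} (F : A.Strings Y n) (k : Z ⟶ Y) : A.Strings Z n :=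
  F ⋙ (Pt.restrict A k).op

/-- The action of the simplicial operators on strings. -/
def Strings.act {Y : D} {m n : ℕ} (F : A.Strings Y n)
    (φ : SimplexCategory.mk m ⟶ SimplexCategory.mk n) : A.Strings Y m :=
  F.whiskerLeft (SimplexCategory.toCat.map φ).toFunctor

/-- The vertices of a string. -/
def Strings.vertex {Y : D} {n : ℕ} (F : A.Strings Y n) (i : Fin (n + 1)) : Y ⟶ A.obj :=
  (F.obj i).unop.pt

/-- The edges of a string. -/
def Strings.edge {Y : D} {n : ℕ} (F : A.Strings Y n) {i j : Fin (n + 1)} (h : i ≤ j) :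
    Y ⟶ A.mor :=
  (F.map (homOfLE h)).unop.1

namespace Strings

variable {Y : D} {n : ℕ}

/-- Strings live in the opposite category, so arrows run from the larger index to the smaller one;
hence also the reversed order in `edge_trans`. -/
theorem edge_src (F : A.Strings Y n) {i j : Fin (n + 1)} (h : i ≤ j) :
    F.edge h ≫ A.src = F.vertex j :=
  (F.map (homOfLE h)).unop.2.1

theorem edge_tgt (F : A.Strings Y n) {i j : Fin (n + 1)} (h : i ≤ j) :
    F.edge h ≫ A.tgt = F.vertex i :=
  (F.map (homOfLE h)).unop.2.2

theorem edge_self (F : A.Strings Y n) (i : Fin (n + 1)) :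
    F.edge (le_refl i) = F.vertex i ≫ A.ident :=
  congrArg (fun f => f.unop.1) (F.map_id i)

theorem edge_trans (F : A.Strings Y n) {i j k : Fin (n + 1)} (h : i ≤ j) (h' : j ≤ k) :
    F.edge (h.trans h') =
      A.cmp (F.edge h') (F.edge h) ((F.edge_tgt h').trans (F.edge_src h).symm) :=
  congrArg (fun f => f.unop.1) (F.map_comp (homOfLE h) (homOfLE h'))

theorem ext₀ {F G : A.Strings Y 0} (h : F.vertex 0 = G.vertex 0) : F = G :=
  ComposableArrows.ext₀ (congrArg op (Pt.ext h))

theorem op_eqToHom_comp_val {x y z : (A.Pt Y)ᵒᵖ} (h : x = y) (f : y ⟶ z) :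
    (eqToHom h ≫ f).unop.1 = f.unop.1 := by
  subst h; rw [eqToHom_refl, Category.id_comp]

theorem op_comp_eqToHom_val {x y z : (A.Pt Y)ᵒᵖ} (f : x ⟶ y) (h : y = z) :
    (f ≫ eqToHom h).unop.1 = f.unop.1 := by
  subst h; rw [eqToHom_refl, Category.comp_id]

/-- The face `d₀` forgets only vertex 0 and the edge that ends there; vertex 0 is recovered as the
target of that edge. This is the tool of all inductions on the length below. -/
theorem ext_succ {F G : A.Strings Y (n + 1)} (h : F.act (SimplexCategory.δ 0) =
    G.act (SimplexCategory.δ 0)) (w : F.edge (Fin.zero_le 1) = G.edge (Fin.zero_le 1)) :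
    F = G := by
  have h₀ : F.vertex 0 = G.vertex 0 := by
    rw [← F.edge_tgt (Fin.zero_le 1), w, G.edge_tgt]
  refine ComposableArrows.ext_succ (congrArg op (Pt.ext h₀)) h ?_
  refine Quiver.Hom.unop_inj (Subtype.ext ?_)
  exact w.trans ((op_eqToHom_comp_val _ _).trans (op_comp_eqToHom_val _ _)).symm

theorem act_comp {m l : ℕ} (F : A.Strings Y n)
    (φ : SimplexCategory.mk m ⟶ SimplexCategory.mk n)
    (ψ : SimplexCategory.mk l ⟶ SimplexCategory.mk m) : (F.act φ).act ψ = F.act (ψ ≫ φ) := rfl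

theorem act_restrict {m : ℕ} {Z : D} (F : A.Strings Y n)
    (φ : SimplexCategory.mk m ⟶ SimplexCategory.mk n) (k : Z ⟶ Y) :
    (F.act φ).restrict k = (F.restrict k).act φ := rfl

theorem restrict_comp {Z W : D} (F : A.Strings Y n) (k : Z ⟶ Y) (l : W ⟶ Z) :
    (F.restrict k).restrict l = F.restrict (l ≫ k) := by
  rw [restrict, restrict, restrict, Pt.restrict_comp]; rfl

theorem restrict_id (F : A.Strings Y n) : F.restrict (𝟙 Y) = F := by
  rw [restrict, Pt.restrict_id]; rfl

/-- The simplicial identity that reduces a face `dᵢ₊₁` to a face `dᵢ` of a shorter string. -/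
theorem act_succ_act_zero (F : A.Strings Y (n + 2)) (i : Fin (n + 2)) :
    (F.act (SimplexCategory.δ i.succ)).act (SimplexCategory.δ 0) =
      (F.act (SimplexCategory.δ 0)).act (SimplexCategory.δ i) := by
  rw [act_comp, act_comp, SimplexCategory.δ_comp_δ (Fin.zero_le i), Fin.castSucc_zero]

/-- The face `d₁` omits vertex 1, so its first edge is the composite of the first two edges. -/
theorem edge_act_succ_zero (F : A.Strings Y (n + 2)) :
    (F.act (SimplexCategory.δ (Fin.succ 0))).edge (Fin.zero_le 1) =
      A.cmp ((F.act (SimplexCategory.δ 0)).edge (Fin.zero_le 1)) (F.edge (Fin.zero_le 1))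
        ((edge_tgt _ _).trans (F.edge_src _).symm) :=
  F.edge_trans (i := 0) (j := 1) (k := Fin.succ 1) (Fin.zero_le 1) (Fin.le_def.2 (Nat.le_succ 1))

/-- Extend a string by an arrow from its last vertex. -/
def cons (F : A.Strings Y n) (x : Y ⟶ A.obj) (f : Y ⟶ A.mor) (hf : f ≫ A.src = F.vertex 0)
    (hx : f ≫ A.tgt = x) : A.Strings Y (n + 1) :=
  ComposableArrows.precomp F (X := op ⟨x⟩) (Quiver.Hom.op ⟨f, hf, hx⟩)

end Strings

end Strings

end InternalCat

/-! ### The nerve of the bar construction -/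

/-- The iterated structure map `Tⁿ X ⟶ X` of an algebra. -/
def barEnd {E : Type u₂} [Category.{v} E] {T : Monad E} (X : T.Algebra) :
    (n : ℕ) → (barPow X n ⟶ X.A)
  | 0 => 𝟙 X.A
  | n + 1 => T.map (barEnd X n) ≫ X.a

section BarEnd

variable {E : Type u₂} [Category.{v} E] {T : Monad E} (X : T.Algebra)

/-- All ways of evaluating an iterated expression agree, by associativity of the algebra. With
`barDegen_barEnd` this expresses that faces other than `d₀` and degeneracies fix vertex 0, which is
K of `barEnd` on the universal string. -/
theorem barFace_barEnd (n : ℕ) (i : Fin (n + 1)) :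
    barFace X n i ≫ barEnd X n = barEnd X (n + 1) := by
  induction n with
  | zero =>
    refine (Category.comp_id _).trans ?_
    exact ((congrArg (· ≫ X.a) (T.map_id _)).trans (Category.id_comp _)).symm
  | succ n ih =>
    refine Fin.cases ?_ (fun j => ?_) i
    · have h : T.μ.app (barPow X n) ≫ T.map (barEnd X n) =
        T.map (T.map (barEnd X n)) ≫ T.μ.app X.A := (T.μ.naturality (barEnd X n)).symm
      change T.μ.app (barPow X n) ≫ T.map (barEnd X n) ≫ X.a =
        T.map (T.map (barEnd X n) ≫ X.a) ≫ X.a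
      rw [← Category.assoc, h, Category.assoc, X.assoc, T.map_comp, Category.assoc]
    · change T.map (barFace X n j) ≫ T.map (barEnd X n) ≫ X.a = T.map (barEnd X (n + 1)) ≫ X.a
      rw [← ih j, T.map_comp, Category.assoc]

theorem barDegen_barEnd (n : ℕ) (i : Fin (n + 1)) :
    barDegen X n i ≫ barEnd X (n + 1) = barEnd X n := by
  have h₀ {Y : E} (f : Y ⟶ X.A) : T.η.app Y ≫ T.map f ≫ X.a = f := by
    have h : T.η.app Y ≫ T.map f = f ≫ T.η.app X.A := (T.η.naturality f).symm
    rw [← Category.assoc, h, Category.assoc, X.unit]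
    exact Category.comp_id f
  induction n with
  | zero => exact h₀ (𝟙 X.A)
  | succ n ih =>
    refine Fin.cases ?_ (fun j => ?_) i
    · exact h₀ (barEnd X (n + 1))
    · change T.map (barDegen X n j) ≫ T.map (barEnd X (n + 1)) ≫ X.a = T.map (barEnd X n) ≫ X.a
      rw [← ih j, T.map_comp, Category.assoc]

end BarEnd

namespace CartesianModule

variable {E : Type u₂} [Category.{v} E] {T : Monad E} {D : Type u'} [Category.{v} D]
  (M : CartesianModule T D) (X : T.Algebra)

open InternalCat

/-- The objects of the bar construction. -/
abbrev barObj (n : ℕ) : D := M.K.obj (barPow X n)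

/-- The universal string of length `n` with its last vertex. -/
def universalAux : (n : ℕ) → { F : (M.barCat X).Strings (M.barObj X n) n //
    F.vertex 0 = M.K.map (barEnd X n) }
  | 0 => ⟨ComposableArrows.mk₀ (op ⟨M.K.map (barEnd X 0)⟩), rfl⟩
  -- The tail is the shorter universal string pulled back along `d₀`. The new edge starts at its
  -- vertex 0 by naturality of the action; this is why the value of vertex 0 is carried through the
  -- recursion.
  | n + 1 => ⟨((universalAux n).1.restrict (M.lam (barPow X n))).cons
      (M.K.map (barEnd X (n + 1))) (M.K.map (T.map (barEnd X n)))
      ((M.nat (barEnd X n)).trans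
        (congrArg (fun k => M.lam (barPow X n) ≫ k) (universalAux n).2.symm))
      (M.K.map_comp _ _).symm, rfl⟩

/-- The universal string of length `n`. -/
def universal (n : ℕ) : (M.barCat X).Strings (M.barObj X n) n := (M.universalAux X n).1

theorem universal_vertex (n : ℕ) : (M.universal X n).vertex 0 = M.K.map (barEnd X n) :=
  (M.universalAux X n).2

/-- The face `d₀` of the bar construction. -/
abbrev barLam (n : ℕ) : M.barObj X (n + 1) ⟶ M.barObj X n := M.lam (barPow X n)

/-- The first edge of the universal string. -/
abbrev barEdge (n : ℕ) : M.barObj X (n + 1) ⟶ (M.barCat X).mor := M.K.map (T.map (barEnd X n))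

theorem isPullback_bar (n : ℕ) : IsPullback (M.barLam X n) (M.barEdge X n)
    (M.K.map (barEnd X n) : _ ⟶ (M.barCat X).obj) (M.barCat X).src :=
  M.cartesian (barEnd X n)

theorem universal_act (n : ℕ) : (M.universal X (n + 1)).act (SimplexCategory.δ 0) =
    (M.universal X n).restrict (M.barLam X n) := rfl

theorem universal_edge (n : ℕ) :
    (M.universal X (n + 1)).edge (Fin.zero_le 1) = M.barEdge X n := rfl

variable {X} in
theorem restrict_universal_act {n : ℕ} {Y : D} {k : Y ⟶ M.barObj X (n + 1)} {t : Y ⟶ M.barObj X n}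
    (h : k ≫ M.barLam X n = t) :
    ((M.universal X (n + 1)).restrict k).act (SimplexCategory.δ 0) =
      (M.universal X n).restrict t :=
  (Strings.restrict_comp _ _ _).trans (congrArg _ h)

variable {X} in
theorem eq_restrict_universal {n : ℕ} {Y : D} {F : (M.barCat X).Strings Y (n + 1)}
    {k : Y ⟶ M.barObj X (n + 1)} {t : Y ⟶ M.barObj X n} (h : k ≫ M.barLam X n = t)
    (hF : F.act (SimplexCategory.δ 0) = (M.universal X n).restrict t)
    (hk : F.edge (Fin.zero_le 1) = k ≫ M.barEdge X n) :
    F = (M.universal X (n + 1)).restrict k :=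
  Strings.ext_succ (hF.trans (M.restrict_universal_act h).symm) hk

/-- A string of length n + 1 is a string of length n with an arrow out of its vertex 0, that is, a
point of the pullback of K Tⁿ X and K T X over K X. By cartesianness at `barEnd` this pullback is K
Tⁿ⁺¹ X. -/
theorem universal_bijective (n : ℕ) (Y : D) :
    Function.Bijective (fun k : Y ⟶ M.barObj X n => (M.universal X n).restrict k) := by
  induction n with
  | zero =>
    have h (k : Y ⟶ M.barObj X 0) : ((M.universal X 0).restrict k).vertex 0 = k :=
      (congrArg (fun t => k ≫ t) (M.K.map_id _)).trans (Category.comp_id k)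
    exact ⟨fun k l hkl => (h k).symm.trans ((congrArg (Strings.vertex · 0) hkl).trans (h l)),
      fun F => ⟨F.vertex 0, Strings.ext₀ (h _)⟩⟩
  | succ n ih =>
    constructor
    · intro k l hkl
      apply (M.isPullback_bar X n).hom_ext
      · apply ih.1
        exact (M.restrict_universal_act rfl).symm.trans
          ((congrArg (Strings.act · (SimplexCategory.δ 0)) hkl).trans
            (M.restrict_universal_act rfl))
      · exact congrArg (Strings.edge · (Fin.zero_le 1)) hkl
    · intro F
      obtain ⟨t, ht⟩ := ih.2 (F.act (SimplexCategory.δ 0))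
      have hw : t ≫ M.K.map (barEnd X n) = F.edge (Fin.zero_le 1) ≫ (M.barCat X).src :=
        (congrArg (fun k => t ≫ k) (M.universal_vertex X n).symm).trans
          ((congrArg (Strings.vertex · 0) ht).trans (F.edge_src (Fin.zero_le 1)).symm)
      exact ⟨(M.isPullback_bar X n).lift t (F.edge (Fin.zero_le 1)) hw,
        (M.eq_restrict_universal ((M.isPullback_bar X n).lift_fst _ _ _) ht.symm
          ((M.isPullback_bar X n).lift_snd _ _ _).symm).symm⟩

/-- By `eq_restrict_universal` it is enough to compare the `d₀` faces and the first edges. -/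
theorem universal_face (n : ℕ) (i : Fin (n + 1)) :
    (M.universal X (n + 1)).act (SimplexCategory.δ i.succ) =
      (M.universal X n).restrict (M.K.map (barFace X n i)) := by
  induction n with
  | zero =>
    obtain rfl : i = 0 := Subsingleton.elim (α := Fin 1) _ _
    exact Strings.ext₀ ((congrArg M.K.map (barFace_barEnd X 0 0).symm).trans (M.K.map_comp _ _))
  | succ n ih =>
    have h₁ : ((M.universal X (n + 2)).act (SimplexCategory.δ i.succ)).act (SimplexCategory.δ 0) =
        ((M.universal X (n + 1)).act (SimplexCategory.δ i)).restrict (M.barLam X (n + 1)) :=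
      ((M.universal X (n + 2)).act_succ_act_zero i).trans
        (congrArg (Strings.act · (SimplexCategory.δ i)) (M.universal_act X (n + 1)))
    revert h₁
    refine Fin.cases (fun h₁ => ?_) (fun j h₁ => ?_) i
    -- For `d₁` the tails agree by associativity of the action. The first edge is a composite, which
    -- the map K T T of `barEnd` names as a composable pair.
    · refine M.eq_restrict_universal (M.assoc _) (h₁.trans (Strings.restrict_comp _ _ _)) ?_
      refine (M.universal X (n + 2)).edge_act_succ_zero.trans ?_
      exact (M.barCat_cmp X (M.K.map (T.map (T.map (barEnd X n)))) _ _ _ (M.nat _)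
          ((M.K.map_comp _ _).symm.trans (congrArg M.K.map (T.map_comp _ _).symm))).trans
          (M.map_mul_naturality _).symm
    -- The other faces are in the image of `T`: naturality of the action handles the tail, and the
    -- first edge does not change.
    · refine M.eq_restrict_universal (M.nat _) (h₁.trans ((congrArg
        (Strings.restrict · _) (ih j)).trans (Strings.restrict_comp _ _ _))) ?_
      refine (M.universal_edge X (n + 1)).trans ?_
      refine (congrArg (fun k => M.K.map (T.map k)) (barFace_barEnd X n j).symm).trans ?_
      exact (congrArg M.K.map (T.map_comp _ _)).trans (M.K.map_comp _ _)

/-- For `σ₀` the tail is unchanged, by the unit law of the action, and the new first edge is an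
identity. The other degeneracies are in the image of `T` and follow by induction. -/
theorem universal_degen (n : ℕ) (i : Fin (n + 1)) :
    (M.universal X n).act (SimplexCategory.σ i) =
      (M.universal X (n + 1)).restrict (M.K.map (barDegen X n i)) := by
  have hzero (n : ℕ) : barDegen X n 0 = T.η.app (barPow X n) := by cases n <;> rfl
  have h₀ (n : ℕ) : (M.universal X n).act (SimplexCategory.σ 0) =
      (M.universal X (n + 1)).restrict (M.K.map (barDegen X n 0)) := by
    rw [hzero]
    refine M.eq_restrict_universal (M.unit _) ?_ ?_
    · exact (congrArg (Strings.act (M.universal X n))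
        (SimplexCategory.δ_comp_σ_self (i := (0 : Fin (n + 1))))).trans
          (Strings.restrict_id _).symm
    · refine ((M.universal X n).edge_self 0).trans ?_
      rw [universal_vertex]
      exact (M.map_unit_naturality _).symm
  induction n with
  | zero =>
    obtain rfl : i = 0 := Subsingleton.elim (α := Fin 1) _ _
    exact h₀ 0
  | succ n ih =>
    refine Fin.cases (h₀ (n + 1)) (fun j => ?_) i
    refine M.eq_restrict_universal (M.nat _) ?_ ?_
    · refine (congrArg (Strings.act (M.universal X (n + 1)))
        (SimplexCategory.δ_comp_σ_of_le (i := 0) (j := j) (Fin.zero_le _))).trans ?_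
      exact (congrArg (Strings.restrict · (M.barLam X n)) (ih j)).trans
        (Strings.restrict_comp _ _ _)
    · refine (M.universal_edge X n).trans ?_
      refine (congrArg (fun k => M.K.map (T.map k)) (barDegen_barEnd X n j).symm).trans ?_
      exact (congrArg M.K.map (T.map_comp _ _)).trans (M.K.map_comp _ _)

end CartesianModule

namespace CartesianModule

variable {E : Type u₂} [Category.{v} E] {T : Monad E} {D : Type u'} [Category.{v} D]
  (M : CartesianModule T D) (X : T.Algebra)

open InternalCat

/-- The right action as a natural transformation. -/
def act : T.toFunctor ⋙ M.K ⟶ M.K where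
  app Y := M.lam Y
  naturality _ _ f := M.nat f

/-- The bar construction represents the strings of the internal category `M.barCat X`. -/
def barEquiv (n : ℕ) (Y : D) : (Y ⟶ M.barObj X n) ≃ (M.barCat X).Strings Y n :=
  Equiv.ofBijective _ (M.universal_bijective X n Y)

/-- The simplicial operators of the bar construction. -/
def barMap {m n : ℕ} (φ : SimplexCategory.mk m ⟶ SimplexCategory.mk n) :
    M.barObj X n ⟶ M.barObj X m :=
  (M.barEquiv X m _).symm ((M.universal X n).act φ)

theorem universal_restrict_barMap {m n : ℕ} (φ : SimplexCategory.mk m ⟶ SimplexCategory.mk n) :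
    (M.universal X m).restrict (M.barMap X φ) = (M.universal X n).act φ :=
  (M.barEquiv X m _).apply_symm_apply _

/-- Yoneda: a simplicial operator of the bar construction is recognized by its effect on the
universal string. -/
theorem barMap_eq {m n : ℕ} {φ : SimplexCategory.mk m ⟶ SimplexCategory.mk n}
    {k : M.barObj X n ⟶ M.barObj X m} (h : (M.universal X n).act φ = (M.universal X m).restrict k) :
    M.barMap X φ = k :=
  (M.barEquiv X m _).symm_apply_eq.2 h

/-- The two-sided bar construction as a simplicial object. -/
def bar : SimplicialObject D where
  obj U := M.barObj X U.unop.len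
  map φ := M.barMap X φ.unop
  map_id U := M.barMap_eq X (Strings.restrict_id _).symm
  map_comp {_ _ _} φ ψ := M.barMap_eq X (by
    rw [← Strings.restrict_comp, universal_restrict_barMap, Strings.act_restrict,
      universal_restrict_barMap]
    rfl)

theorem isNerve_bar : (M.barCat X).IsNerve (M.bar X) :=
  ⟨NatIso.ofComponents
    (fun U => NatIso.ofComponents (fun Y => (M.barEquiv X U.unop.len Y.unop).toIso)
      (fun l => by
        ext k
        exact (Strings.restrict_comp (M.universal X U.unop.len) k l.unop).symm))
    (fun {U V} φ => by
      ext Y k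
      refine (Strings.restrict_comp (M.universal X V.unop.len) (M.barMap X φ.unop) k).symm.trans ?_
      exact congrArg (Strings.restrict · k) (M.universal_restrict_barMap X φ.unop))⟩

/-- The simplicial object `M.bar X` is the two-sided bar construction. -/
def barIso : BarIso M.K M.act X (M.bar X) where
  iso _ := Iso.refl _
  δ_zero n := (Category.comp_id _).trans
    ((M.barMap_eq X (φ := SimplexCategory.δ 0) (M.universal_act X n)).trans
      (Category.id_comp _).symm)
  δ_succ n i := (Category.comp_id _).trans
    ((M.barMap_eq X (M.universal_face X n i)).trans (Category.id_comp _).symm)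
  σ n i := (Category.comp_id _).trans
    ((M.barMap_eq X (M.universal_degen X n i)).trans (Category.id_comp _).symm)

end CartesianModule

/-! ### Uniqueness and transport of bar constructions -/

theorem InternalCat.IsNerve.ofIso {D : Type u'} [Category.{v} D] {A : InternalCat D}
    {N N' : SimplicialObject D} (h : A.IsNerve N) (e : N ≅ N') : A.IsNerve N' :=
  h.map fun i => (Functor.isoWhiskerRight e yoneda).symm ≪≫ i

/-- A levelwise isomorphism of simplicial objects which commutes with faces and degeneracies. -/
def simplicialIsoMk {D : Type u'} [Category.{v} D] {N N' : SimplicialObject D}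
    (e : ∀ n : ℕ, N.obj (op (SimplexCategory.mk n)) ≅ N'.obj (op (SimplexCategory.mk n)))
    (hδ : ∀ (n : ℕ) (i : Fin (n + 2)), N.δ i ≫ (e n).hom = (e (n + 1)).hom ≫ N'.δ i)
    (hσ : ∀ (n : ℕ) (i : Fin (n + 1)), N.σ i ≫ (e (n + 1)).hom = (e n).hom ≫ N'.σ i) :
    N ≅ N' :=
  NatIso.ofComponents (fun U => e U.unop.len) (by
    -- The operators for which naturality holds are closed under composition and contain all faces
    -- and degeneracies, which generate the simplex category.
    let W : MorphismProperty SimplexCategory := fun U V φ =>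
      N.map φ.op ≫ (e U.len).hom = (e V.len).hom ≫ N'.map φ.op
    have : W.IsMultiplicative :=
      { id_mem := fun U => by
          change N.map (𝟙 _) ≫ (e U.len).hom = (e U.len).hom ≫ N'.map (𝟙 _)
          rw [N.map_id, N'.map_id]
          exact (Category.id_comp _).trans (Category.comp_id _).symm
        comp_mem := fun φ ψ hφ hψ => by
          change N.map (ψ.op ≫ φ.op) ≫ _ = _ ≫ N'.map (ψ.op ≫ φ.op)
          rw [N.map_comp, N'.map_comp, Category.assoc]
          refine (congrArg (fun k => N.map ψ.op ≫ k) hφ).trans ?_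
          refine (Category.assoc _ _ _).symm.trans ((congrArg (· ≫ N'.map φ.op) hψ).trans ?_)
          exact Category.assoc _ _ _ }
    have hW : W = ⊤ := SimplexCategory.morphismProperty_eq_top W (fun i => hδ _ i) (fun i => hσ _ i)
    intro U V φ
    have : W φ.unop := hW ▸ trivial
    exact this)

theorem paste_square {D : Type u'} [Category.{v} D] {X₁ X₂ X₃ Y₁ Y₂ Y₃ : D} {f : X₁ ⟶ Y₁}
    {a : Y₁ ⟶ Y₂} {b : X₁ ⟶ X₂} {g : X₂ ⟶ Y₂} {c : Y₂ ⟶ Y₃} {d : X₂ ⟶ X₃} {h : X₃ ⟶ Y₃}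
    (h₁ : f ≫ a = b ≫ g) (h₂ : g ≫ c = d ≫ h) : f ≫ a ≫ c = (b ≫ d) ≫ h := by
  rw [← Category.assoc, h₁, Category.assoc, h₂, Category.assoc]

theorem inv_square {D : Type u'} [Category.{v} D] {X₁ X₂ Y₁ Y₂ : D} {f : X₁ ⟶ Y₁}
    {a : Y₁ ≅ Y₂} {b : X₁ ≅ X₂} {g : X₂ ⟶ Y₂} (h : f ≫ a.hom = b.hom ≫ g) :
    g ≫ a.inv = b.inv ≫ f := by
  rw [Iso.comp_inv_eq, Category.assoc, h, Iso.inv_hom_id_assoc]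

namespace BarIso

variable {E : Type u₂} [Category.{v} E] {T : Monad E} {D : Type u'} [Category.{v} D]
  {G : E ⥤ D} {act : T.toFunctor ⋙ G ⟶ G} {X : T.Algebra} {N N' : SimplicialObject D}

/-- The two-sided bar construction is unique up to isomorphism. -/
def unique (b : BarIso G act X N) (b' : BarIso G act X N') : N ≅ N' :=
  simplicialIsoMk (fun n => b.iso n ≪≫ (b'.iso n).symm)
    (fun n i => by
      refine Fin.cases ?_ (fun j => ?_) i
      · exact paste_square (b.δ_zero n) (inv_square (b'.δ_zero n))
      · exact paste_square (b.δ_succ n j) (inv_square (b'.δ_succ n j)))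
    (fun n i => paste_square (b.σ n i) (inv_square (b'.σ n i)))

/-- Transport of the two-sided bar construction along an isomorphism of functors with action. -/
def ofIso (b : BarIso G act X N) {G' : E ⥤ D} {act' : T.toFunctor ⋙ G' ⟶ G'} (φ : G ≅ G')
    (h : ∀ Y, act.app Y ≫ φ.hom.app Y = φ.hom.app (T.obj Y) ≫ act'.app Y) :
    BarIso G' act' X N where
  iso n := b.iso n ≪≫ φ.app _
  δ_zero n := paste_square (b.δ_zero n) (h _)
  δ_succ n i := paste_square (b.δ_succ n i) (φ.hom.naturality _)
  σ n i := paste_square (b.σ n i) (φ.hom.naturality _)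

/-- The image of the two-sided bar construction under a functor. -/
def map (b : BarIso G act X N) {D' : Type u} [Category.{v} D'] (p : D ⥤ D')
    {act' : T.toFunctor ⋙ G ⋙ p ⟶ G ⋙ p} (h : ∀ Y, act'.app Y = p.map (act.app Y)) :
    BarIso (G ⋙ p) act' X (((SimplicialObject.whiskering _ _).obj p).obj N) where
  iso n := p.mapIso (b.iso n)
  δ_zero n := by
    rw [h]
    exact (p.map_comp _ _).symm.trans ((congrArg p.map (b.δ_zero n)).trans (p.map_comp _ _))
  δ_succ n i :=
    (p.map_comp _ _).symm.trans ((congrArg p.map (b.δ_succ n i)).trans (p.map_comp _ _))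
  σ n i := (p.map_comp _ _).symm.trans ((congrArg p.map (b.σ n i)).trans (p.map_comp _ _))

end BarIso

/-! ### Lax morphisms out of the terminal categorical algebra -/

open InternalCat CAlg

theorem InternalCat.comp_ident_src {E : Type u₂} [Category.{v} E] (B : InternalCat E) {X : E}
    (x : X ⟶ B.obj) : (x ≫ B.ident) ≫ B.src = x := by simp

theorem InternalCat.comp_ident_tgt {E : Type u₂} [Category.{v} E] (B : InternalCat E) {X : E}
    (x : X ⟶ B.obj) : (x ≫ B.ident) ≫ B.tgt = x := by simp

/-- The terminal categorical algebra is discrete and its identity map is an identity, so a functor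
out of it is only an object. -/
theorem oneCAlg_fun_mor {E : Type u₂} [Category.{v} E] {T : Monad E} [HasFiniteLimits E]
    {B : InternalCat E} (F : carrier (oneCAlg T) ⟶ B) : Fun.mor F = Fun.obj F ≫ B.ident :=
  (Category.id_comp _).symm.trans (Fun.ident_mor F)

section LaxOne

variable {E : Type u₂} [Category.{v} E] {T : Monad E} [HasFiniteLimits E]

theorem oneCAlg_fun_ext {B : InternalCat E} {F G : carrier (oneCAlg T) ⟶ B}
    (h : Fun.obj F = Fun.obj G) : F = G :=
  hom_ext h (by rw [oneCAlg_fun_mor, oneCAlg_fun_mor, h])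

/-- The internal functor out of the terminal category given by an object. -/
def ptFun {B : InternalCat E} (x : ⊤_ E ⟶ B.obj) : carrier (oneCAlg T) ⟶ B :=
  { obj := x
    mor := x ≫ B.ident
    mor_src := (B.comp_ident_src x).trans (Category.id_comp x).symm
    mor_tgt := (B.comp_ident_tgt x).trans (Category.id_comp x).symm
    ident_mor := Category.id_comp _
    comp_mor := (Category.id_comp _).trans ((B.id_cmp x (x ≫ B.ident) (by simp)).symm.trans
      (cmp_congr _ (Category.id_comp _).symm (Category.id_comp _).symm _ _)) :
        Fun (carrier (oneCAlg T)) B }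

/-- The internal natural transformation of functors out of the terminal category given by
an arrow. -/
def ptTrans {B : InternalCat E} {F G : carrier (oneCAlg T) ⟶ B} (θ : ⊤_ E ⟶ B.mor)
    (hs : θ ≫ B.src = Fun.obj F) (ht : θ ≫ B.tgt = Fun.obj G) : F ⟶ G :=
  { app := θ
    app_src := hs
    app_tgt := ht
    naturality := by
      refine Eq.trans (cmp_congr _ (oneCAlg_fun_mor F) (Category.id_comp θ) _
        ((B.comp_ident_tgt _).trans hs.symm))
        ((B.id_cmp _ _ _).trans (Eq.trans (B.cmp_id θ (Fun.obj G) (ht.trans (B.comp_ident_src _).symm)).symm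
          (cmp_congr _ (Category.id_comp θ).symm (oneCAlg_fun_mor G).symm _ _))) : Trans F G }

theorem oneCAlg_act_fun_mor {B : CAlg T} (F : carrier (oneCAlg T) ⟶ carrier B) :
    T.map (Fun.mor F) ≫ B.mor.a = (T.map (Fun.obj F) ≫ B.obj.a) ≫ B.ident.f := by
  have h : T.map B.ident.f ≫ B.mor.a = B.obj.a ≫ B.ident.f := B.ident.h
  refine (congrArg (fun k => T.map k ≫ B.mor.a) (oneCAlg_fun_mor F)).trans ?_
  refine (congrArg (· ≫ B.mor.a) (T.map_comp _ _)).trans ?_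
  exact (Category.assoc _ _ _).trans ((congrArg (fun k => T.map (Fun.obj F) ≫ k) h).trans
    (Category.assoc _ _ _).symm)

variable (T) in
/-- The structure map of the terminal algebra. -/
abbrev oneAct : T.obj (⊤_ E) ⟶ ⊤_ E := terminal.from _

variable [CartesianMonad T]

/-- The structure cell of a lax morphism out of the terminal categorical algebra, given by its
component. -/
def laxCell {B : CAlg T} (F : carrier (oneCAlg T) ⟶ carrier B) (ξ : T.obj (⊤_ E) ⟶ B.mor.A)
    (hs : ξ ≫ B.src.f = T.map (Fun.obj F) ≫ B.obj.a)
    (ht : ξ ≫ B.tgt.f = oneAct T ≫ Fun.obj F) :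
    mapHom T.toFunctor F ≫ act B ⟶ act (oneCAlg T) ≫ F :=
  { app := ξ
    app_src := hs
    app_tgt := ht
    naturality := by
      -- Naturality is automatic: both functors send all arrows of the discrete domain to
      -- identities, and both composites reduce to `ξ`.
      have h₁ : T.map (𝟙 (⊤_ E)) ≫ ξ = ξ :=
        (congrArg (· ≫ ξ) (T.map_id _)).trans (Category.id_comp ξ)
      have h₂ : oneAct T ≫ Fun.mor F = (oneAct T ≫ Fun.obj F) ≫ B.ident.f :=
        (congrArg (fun k => oneAct T ≫ k) (oneCAlg_fun_mor F)).trans (Category.assoc _ _ _).symm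
      have w₁ : ((T.map (Fun.obj F) ≫ B.obj.a) ≫ (carrier B).ident) ≫ (carrier B).tgt =
          ξ ≫ (carrier B).src :=
        ((carrier B).comp_ident_tgt _).trans hs.symm
      have w₂ : ξ ≫ (carrier B).tgt =
          ((oneAct T ≫ Fun.obj F) ≫ (carrier B).ident) ≫ (carrier B).src :=
        ht.trans ((carrier B).comp_ident_src _).symm
      exact (cmp_congr (carrier B) (oneCAlg_act_fun_mor F) h₁ _ w₁).trans
        (((carrier B).id_cmp _ ξ w₁).trans (((carrier B).cmp_id ξ _ w₂).symm.trans
          (cmp_congr (carrier B) h₁.symm h₂.symm _ _))) :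
      Trans (mapHom T.toFunctor F ≫ act B) (act (oneCAlg T) ≫ F) }

/-- Makes the multiplication law in `laxOne` well formed before there is a lax morphism: the
boundary conditions on `ξ` suffice. -/
theorem laxOne_composable {B : CAlg T} {x : ⊤_ E ⟶ B.obj.A} {ξ : T.obj (⊤_ E) ⟶ B.mor.A}
    (hs : ξ ≫ B.src.f = T.map x ≫ B.obj.a) (ht : ξ ≫ B.tgt.f = oneAct T ≫ x) :
    (T.map ξ ≫ B.mor.a) ≫ (carrier B).tgt = (T.map (oneAct T) ≫ ξ) ≫ (carrier B).src :=
  cell_composable (laxCell (ptFun (B := carrier B) x) ξ hs ht)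

/-- A lax morphism out of the terminal categorical algebra, in terms of an object and a
structure arrow. -/
def laxOne {B : CAlg T} (x : ⊤_ E ⟶ B.obj.A) (ξ : T.obj (⊤_ E) ⟶ B.mor.A)
    (hs : ξ ≫ B.src.f = T.map x ≫ B.obj.a) (ht : ξ ≫ B.tgt.f = oneAct T ≫ x)
    (hu : T.η.app (⊤_ E) ≫ ξ = x ≫ B.ident.f)
    (hm : T.μ.app (⊤_ E) ≫ ξ = (carrier B).cmp (T.map ξ ≫ B.mor.a) (T.map (oneAct T) ≫ ξ)
      (laxOne_composable hs ht)) : LaxMor (oneCAlg T) B where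
  functor := ptFun (B := carrier B) x
  cell := laxCell (ptFun (B := carrier B) x) ξ hs ht
  unit := hu
  mul := hm

theorem laxOne_ext {B : CAlg T} {f g : LaxMor (oneCAlg T) B}
    (h : Fun.obj f.functor = Fun.obj g.functor) (h' : Trans.app f.cell = Trans.app g.cell) :
    f = g :=
  LaxMor.ext' (oneCAlg_fun_ext h) h'

/-- A transformation of lax morphisms out of the terminal categorical algebra, given by its
component. -/
def laxOneTrans {B : CAlg T} {f g : LaxMor (oneCAlg T) B} (θ : ⊤_ E ⟶ B.mor.A)
    (hs : θ ≫ B.src.f = Fun.obj f.functor) (ht : θ ≫ B.tgt.f = Fun.obj g.functor)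
    (hc : (carrier B).cmp (Trans.app f.cell) (oneAct T ≫ θ)
        ((Trans.app_tgt f.cell).trans
          (Trans.app_src (act (oneCAlg T) ◁ ptTrans (B := carrier B) θ hs ht)).symm) =
      (carrier B).cmp (T.map θ ≫ B.mor.a) (Trans.app g.cell)
        ((Trans.app_tgt (mapTrans T.toFunctor (ptTrans (B := carrier B) θ hs ht) ▷ act B)).trans
          (Trans.app_src g.cell).symm)) : f ⟶ g :=
  { trans := ptTrans (B := carrier B) θ hs ht
    comm := trans_ext hc : LaxTrans f g }

end LaxOne

section HomExt

variable {E : Type u₂} [Category.{v} E] {T : Monad E} [HasFiniteLimits E] [CartesianMonad T]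
  {X B : CAlg T} {𝒞 : Cat.{v, v}}

theorem catHom_laxMor_ext {F G : 𝒞 ⟶ Cat.of (LaxMor X B)} {σ τ : F ⟶ G}
    (h : ∀ f : 𝒞, Trans.app (LaxTrans.trans (σ.toNatTrans.app f)) =
      Trans.app (LaxTrans.trans (τ.toNatTrans.app f))) : σ = τ :=
  Cat.Hom₂.ext (NatTrans.ext (funext fun f => LaxMor.trans_ext' (h f)))

/-- Strict 2-naturality is an equation up to `eqToHom`, which has identity components and so
disappears here. -/
theorem catHom_laxMor_eqToHom_comp {F G H : 𝒞 ⟶ Cat.of (LaxMor X B)} (e : F = G)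
    (τ : G ⟶ H) (f : 𝒞) :
    Trans.app (LaxTrans.trans ((eqToHom e ≫ τ).toNatTrans.app f)) =
      Trans.app (LaxTrans.trans (τ.toNatTrans.app f)) := by
  subst e; rw [eqToHom_refl, Category.id_comp]

theorem catHom_laxMor_comp_eqToHom {F G H : 𝒞 ⟶ Cat.of (LaxMor X B)} (τ : F ⟶ G)
    (e : G = H) (f : 𝒞) :
    Trans.app (LaxTrans.trans ((τ ≫ eqToHom e).toNatTrans.app f)) =
      Trans.app (LaxTrans.trans (τ.toNatTrans.app f)) := by
  subst e; rw [eqToHom_refl, Category.comp_id]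

theorem functor_laxMor_ext {𝒞 : Type u} [Category.{v} 𝒞] {F G : 𝒞 ⥤ LaxMor X B}
    (h : ∀ f, F.obj f = G.obj f)
    (h' : ∀ {f g : 𝒞} (α : f ⟶ g),
      Trans.app (LaxTrans.trans (F.map α)) = Trans.app (LaxTrans.trans (G.map α))) : F = G :=
  CategoryTheory.Functor.ext h (fun _ _ α => LaxMor.trans_ext' (by
    rw [LaxMor.eqToHom_comp_app, LaxMor.comp_eqToHom_app, h' α]))

theorem functor_hom_ext {D : Type u'} [Category.{v} D] {A B : InternalCat D} {𝒞 : Type u}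
    [Category.{v} 𝒞] {F G : 𝒞 ⥤ (A ⟶ B)} (h : ∀ f, F.obj f = G.obj f)
    (h' : ∀ {f g : 𝒞} (α : f ⟶ g), Trans.app (F.map α) = Trans.app (G.map α)) : F = G :=
  CategoryTheory.Functor.ext h (fun _ _ α => trans_ext (by
    rw [InternalCat.eqToHom_comp_app, InternalCat.comp_eqToHom_app, h' α]))

end HomExt

/-! ### Representability -/

/-- The functor `K` of a module is left adjoint to the underlying functor of `R : D ⥤ Alg_T`, and
the action on `K` is adjoint to the algebra structures. -/
structure ModuleAdj {E : Type u₂} [Category.{v} E] {T : Monad E} {D : Type u'} [Category.{v} D]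
    (K : E ⥤ D) (act : T.toFunctor ⋙ K ⟶ K) (R : D ⥤ T.Algebra) where
  adj : K ⊣ R ⋙ T.forget
  homEquiv_act {X : E} {B : D} (f : K.obj X ⟶ B) :
    adj.homEquiv (T.obj X) B (act.app X ≫ f) = T.map (adj.homEquiv X B f) ≫ (R.obj B).a

namespace ModuleAdj

section Transpose

variable {E : Type u₂} [Category.{v} E] {T : Monad E} {D : Type u'} [Category.{v} D]
  {K : E ⥤ D} {act : T.toFunctor ⋙ K ⟶ K} {R : D ⥤ T.Algebra} (P : ModuleAdj K act R)

/-- The transpose of a map. -/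
def tr {X : E} {B : D} (f : K.obj X ⟶ B) : X ⟶ (R.obj B).A := P.adj.homEquiv X B f

/-- The map with a given transpose. -/
def untr {X : E} {B : D} (f : X ⟶ (R.obj B).A) : K.obj X ⟶ B := (P.adj.homEquiv X B).symm f

@[simp]
theorem tr_untr {X : E} {B : D} (f : X ⟶ (R.obj B).A) : P.tr (P.untr f) = f :=
  (P.adj.homEquiv X B).apply_symm_apply f

@[simp]
theorem untr_tr {X : E} {B : D} (f : K.obj X ⟶ B) : P.untr (P.tr f) = f :=
  (P.adj.homEquiv X B).symm_apply_apply f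

theorem tr_injective {X : E} {B : D} {f g : K.obj X ⟶ B} (h : P.tr f = P.tr g) : f = g :=
  (P.adj.homEquiv X B).injective h

theorem tr_map_comp {X Y : E} {B : D} (g : X ⟶ Y) (f : K.obj Y ⟶ B) :
    P.tr (K.map g ≫ f) = g ≫ P.tr f :=
  P.adj.homEquiv_naturality_left g f

theorem tr_comp {X : E} {B B' : D} (f : K.obj X ⟶ B) (g : B ⟶ B') :
    P.tr (f ≫ g) = P.tr f ≫ (R.map g).f :=
  P.adj.homEquiv_naturality_right f g

theorem tr_act {X : E} {B : D} (f : K.obj X ⟶ B) :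
    P.tr (act.app X ≫ f) = T.map (P.tr f) ≫ (R.obj B).a :=
  P.homEquiv_act f

include P in
/-- An action that is adjoint to algebra structures is unital. -/
theorem act_unit (X : E) : K.map (T.η.app X) ≫ act.app X = 𝟙 (K.obj X) := by
  apply P.tr_injective
  refine (P.tr_map_comp _ _).trans ?_
  have h : P.tr (act.app X) = T.map (P.tr (𝟙 (K.obj X))) ≫ (R.obj (K.obj X)).a :=
    (congrArg P.tr (Category.comp_id _).symm).trans (P.tr_act (𝟙 (K.obj X)))
  have h' : T.η.app X ≫ T.map (P.tr (𝟙 (K.obj X))) = P.tr (𝟙 (K.obj X)) ≫ T.η.app _ :=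
    (T.η.naturality (P.tr (𝟙 (K.obj X)))).symm
  rw [h, ← Category.assoc, h', Category.assoc, Monad.Algebra.unit]
  exact Category.comp_id _

include P in
/-- An action that is adjoint to algebra structures is associative. -/
theorem act_assoc (X : E) :
    K.map (T.μ.app X) ≫ act.app X = act.app (T.obj X) ≫ act.app X := by
  apply P.tr_injective
  refine (P.tr_map_comp _ _).trans (Eq.trans ?_ (P.tr_act (act.app X)).symm)
  have h : P.tr (act.app X) = T.map (P.tr (𝟙 (K.obj X))) ≫ (R.obj (K.obj X)).a :=
    (congrArg P.tr (Category.comp_id _).symm).trans (P.tr_act (𝟙 (K.obj X)))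
  have h' : T.μ.app X ≫ T.map (P.tr (𝟙 (K.obj X))) =
      T.map (T.map (P.tr (𝟙 (K.obj X)))) ≫ T.μ.app _ :=
    (T.μ.naturality (P.tr (𝟙 (K.obj X)))).symm
  rw [h, ← Category.assoc, h', Category.assoc, Monad.Algebra.assoc, T.map_comp, Category.assoc]

/-- The module of a cartesian action which is adjoint to algebra structures. -/
def module (h : NatTrans.Equifibered act) : CartesianModule T D where
  K := K
  lam X := act.app X
  nat f := act.naturality f
  unit := P.act_unit
  assoc := P.act_assoc
  cartesian f := (h f).flip

end Transpose

section Rep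

variable {E : Type u₂} [Category.{v} E] {T : Monad E} [HasFiniteLimits E]
  {D : Type u'} [Category.{v} D] {K : E ⥤ D} {act : T.toFunctor ⋙ K ⟶ K} {R : D ⥤ T.Algebra}
  (P : ModuleAdj K act R) (h : NatTrans.Equifibered act) {A B : InternalCat D}

/-- The internal category which represents internal algebras. -/
def repr : InternalCat D := (P.module h).barCat (terminalAlgebra T)

variable {h}

/-- The source map of the bar category is the action, whose transpose is the algebra structure; this
yields the domain of a structure cell. Likewise `tr_tgt` yields its codomain. -/
theorem tr_src (F : P.repr h ⟶ A) :
    P.tr (Fun.mor F) ≫ (R.map A.src).f = T.map (P.tr (Fun.obj F)) ≫ (R.obj A.obj).a :=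
  (P.tr_comp _ _).symm.trans ((congrArg P.tr (Fun.mor_src F)).trans (P.tr_act _))

theorem tr_tgt (F : P.repr h ⟶ A) :
    P.tr (Fun.mor F) ≫ (R.map A.tgt).f = oneAct T ≫ P.tr (Fun.obj F) :=
  (P.tr_comp _ _).symm.trans ((congrArg P.tr (Fun.mor_tgt F)).trans (P.tr_map_comp _ _))

variable [HasPullbacks D] [PreservesLimitsOfShape WalkingCospan R]

/-- Since `R` and the forgetful functor preserve the pullback of composable pairs, transposition
respects composition of generalized arrows. -/
theorem tr_cmp {X : E} (f g : K.obj X ⟶ A.mor) (w : f ≫ A.tgt = g ≫ A.src) :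
    P.tr (A.cmp f g w) = (carrier (mapObj R A)).cmp (P.tr f) (P.tr g)
      ((P.tr_comp f A.tgt).symm.trans ((congrArg P.tr w).trans (P.tr_comp g A.src))) := by
  refine (P.tr_comp _ _).trans (congrArg (· ≫ (R.map A.comp).f) ?_)
  apply (carrier (mapObj R A)).isPullback.hom_ext
  · exact ((P.tr_comp _ _).symm.trans (congrArg P.tr (A.isPullback.lift_fst _ _ _))).trans
      (IsPullback.lift_fst _ _ _ _).symm
  · exact ((P.tr_comp _ _).symm.trans (congrArg P.tr (A.isPullback.lift_snd _ _ _))).trans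
      (IsPullback.lift_snd _ _ _ _).symm

variable [CartesianMonad T]

/-- The lax morphism corresponding to an internal functor. -/
def toLax (F : P.repr h ⟶ A) : LaxMor (oneCAlg T) (mapObj R A) :=
  -- Preservation of identities transposes to the unit law, and preservation of composition to the
  -- multiplication law: in a composable pair the first projection is the action and the second is K
  -- T of the structure map.
  laxOne (B := mapObj R A) (P.tr (Fun.obj F)) (P.tr (Fun.mor F)) (P.tr_src F) (P.tr_tgt F)
    ((P.tr_map_comp _ _).symm.trans ((congrArg P.tr (Fun.ident_mor F)).trans (P.tr_comp _ _)))
    ((P.tr_map_comp _ _).symm.trans ((congrArg P.tr (Fun.comp_mor F)).trans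
      ((P.tr_cmp _ _ _).trans (cmp_congr _ (P.tr_act _) (P.tr_map_comp _ _) _ _))))

variable (h) in
/-- The internal functor corresponding to a lax morphism. -/
def ofLax (f : LaxMor (oneCAlg T) (mapObj R A)) : P.repr h ⟶ A :=
  { obj := P.untr (Fun.obj f.functor)
    mor := P.untr (Trans.app f.cell)
    mor_src := P.tr_injective ((P.tr_comp _ _).trans
      ((congrArg (· ≫ (R.map A.src).f) (P.tr_untr _)).trans ((Trans.app_src f.cell).trans
        ((P.tr_act _).trans
          (congrArg (fun k => T.map k ≫ (R.obj A.obj).a) (P.tr_untr _))).symm)))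
    mor_tgt := P.tr_injective ((P.tr_comp _ _).trans
      ((congrArg (· ≫ (R.map A.tgt).f) (P.tr_untr _)).trans ((Trans.app_tgt f.cell).trans
        ((P.tr_map_comp _ _).trans (congrArg (fun k => oneAct T ≫ k) (P.tr_untr _))).symm)))
    ident_mor := P.tr_injective ((P.tr_map_comp _ _).trans
      ((congrArg (fun k => T.η.app (⊤_ E) ≫ k) (P.tr_untr _)).trans (f.unit.trans
        ((P.tr_comp _ _).trans
          (congrArg (· ≫ (R.map A.ident).f) (P.tr_untr _))).symm)))
    comp_mor := by
      apply P.tr_injective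
      refine (P.tr_map_comp _ _).trans (Eq.trans ?_ (P.tr_cmp _ _ _).symm)
      refine (congrArg (fun k => T.μ.app (⊤_ E) ≫ k) (P.tr_untr _)).trans (f.mul.trans
        (cmp_congr _ ?_ ?_ _ _))
      · exact ((P.tr_act _).trans
          (congrArg (fun k => T.map k ≫ (R.obj A.mor).a) (P.tr_untr _))).symm
      · exact ((P.tr_map_comp _ _).trans
          (congrArg (fun k => T.map (oneAct T) ≫ k) (P.tr_untr _))).symm : Fun (P.repr h) A }

theorem toLax_ofLax (f : LaxMor (oneCAlg T) (mapObj R A)) : P.toLax (P.ofLax h f) = f :=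
  laxOne_ext (P.tr_untr _) (P.tr_untr _)

theorem ofLax_toLax (F : P.repr h ⟶ A) : P.ofLax h (P.toLax F) = F :=
  hom_ext (P.untr_tr _) (P.untr_tr _)

/-- The transformation of lax morphisms corresponding to an internal natural transformation. -/
def toLaxTrans {F G : P.repr h ⟶ A} (θ : F ⟶ G) : P.toLax F ⟶ P.toLax G :=
  laxOneTrans (B := mapObj R A) (P.tr (Trans.app θ))
    ((P.tr_comp _ _).symm.trans (congrArg P.tr (Trans.app_src θ)))
    ((P.tr_comp _ _).symm.trans (congrArg P.tr (Trans.app_tgt θ)))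
    ((cmp_congr _ rfl (P.tr_map_comp _ _).symm _ _).trans ((P.tr_cmp _ _ _).symm.trans
      ((congrArg P.tr (Trans.naturality θ)).trans ((P.tr_cmp _ _ _).trans
        (cmp_congr _ (P.tr_act _) rfl _ _)))))

variable (h) in
/-- The internal natural transformation corresponding to a transformation of lax morphisms. -/
def ofLaxTrans {f g : LaxMor (oneCAlg T) (mapObj R A)} (α : f ⟶ g) :
    P.ofLax h f ⟶ P.ofLax h g :=
  { app := P.untr (Trans.app (LaxTrans.trans α))
    app_src := P.tr_injective ((P.tr_comp _ _).trans
      ((congrArg (· ≫ (R.map A.src).f) (P.tr_untr _)).trans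
        ((Trans.app_src (LaxTrans.trans α)).trans (P.tr_untr _).symm)))
    app_tgt := P.tr_injective ((P.tr_comp _ _).trans
      ((congrArg (· ≫ (R.map A.tgt).f) (P.tr_untr _)).trans
        ((Trans.app_tgt (LaxTrans.trans α)).trans (P.tr_untr _).symm)))
    naturality := by
      apply P.tr_injective
      refine (P.tr_cmp _ _ _).trans (Eq.trans ?_ (P.tr_cmp _ _ _).symm)
      refine Eq.trans (cmp_congr _ ?_ ?_ _ _) ((LaxTrans.comm_app α).trans
        (cmp_congr _ ?_ ?_ _ _))
      · exact P.tr_untr _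
      · exact (P.tr_map_comp _ _).trans (congrArg (fun k => oneAct T ≫ k) (P.tr_untr _))
      · exact (congrArg (fun k => T.map k ≫ (R.obj A.mor).a) (P.tr_untr _).symm).trans
          (P.tr_act _).symm
      · exact (P.tr_untr _).symm : Trans (P.ofLax h f) (P.ofLax h g) }

variable (h A) in
/-- Internal functors to lax morphisms, as a functor. -/
def toLaxFunctor : (P.repr h ⟶ A) ⥤ LaxMor (oneCAlg T) (mapObj R A) where
  obj F := P.toLax F
  map θ := P.toLaxTrans θ
  map_id _ := LaxMor.trans_ext' (P.tr_comp _ _)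
  map_comp _ _ := LaxMor.trans_ext' (P.tr_cmp _ _ _)

variable (h A) in
/-- Lax morphisms to internal functors, as a functor. -/
def ofLaxFunctor : LaxMor (oneCAlg T) (mapObj R A) ⥤ (P.repr h ⟶ A) where
  obj f := P.ofLax h f
  map α := P.ofLaxTrans h α
  map_id _ := trans_ext (P.tr_injective ((P.tr_untr _).trans
    (Eq.trans (congrArg (· ≫ (R.map A.ident).f) (P.tr_untr _).symm) (P.tr_comp _ _).symm)))
  map_comp _ _ := trans_ext (P.tr_injective ((P.tr_untr _).trans
    (Eq.trans (cmp_congr _ (P.tr_untr _).symm (P.tr_untr _).symm _ _) (P.tr_cmp _ _ _).symm)))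

variable (h A) in
theorem toLaxFunctor_comp : P.toLaxFunctor h A ⋙ P.ofLaxFunctor h A = 𝟭 _ :=
  functor_hom_ext P.ofLax_toLax (fun _ => P.untr_tr _)

variable (h A) in
theorem ofLaxFunctor_comp : P.ofLaxFunctor h A ⋙ P.toLaxFunctor h A = 𝟭 _ :=
  functor_laxMor_ext P.toLax_ofLax (fun _ => P.tr_untr _)

variable (h) in
/-- The bar construction represents internal algebras. -/
def twoRep : TwoRep ((InternalCat.map R).comp (IAlg T)) (P.repr h) where
  iso A :=
    { hom := (P.toLaxFunctor h A).toCatHom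
      inv := (P.ofLaxFunctor h A).toCatHom
      hom_inv_id := congrArg Functor.toCatHom (P.toLaxFunctor_comp h A)
      inv_hom_id := congrArg Functor.toCatHom (P.ofLaxFunctor_comp h A) }
  natural {A A'} g := congrArg Functor.toCatHom (functor_laxMor_ext
    (F := postcomp (P.repr h) g ⋙ P.toLaxFunctor h A')
    (G := P.toLaxFunctor h A ⋙ LaxMor.postcompFunctor (oneCAlg T) (mapHom R g))
    (fun F => laxOne_ext (P.tr_comp _ _)
      ((P.tr_comp _ _).trans (LaxMor.postcompCell_app (P.toLax F) (mapHom R g)).symm))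
    (fun _ => P.tr_comp _ _))
  natural₂ {A A' g g'} θ := catHom_laxMor_ext (fun F => by
    refine Eq.trans ?_ ((catHom_laxMor_eqToHom_comp _ _ F).trans
      (catHom_laxMor_comp_eqToHom _ _ F)).symm
    exact P.tr_comp _ _)

end Rep

end ModuleAdj

/-! ### Comparison of modules with the same right adjoint, and the modules `F^T` and `G` -/

namespace ModuleAdj

section Uniqueness

variable {E : Type u₂} [Category.{v} E] {T : Monad E} {D : Type u'} [Category.{v} D]
  {K K' : E ⥤ D} {act : T.toFunctor ⋙ K ⟶ K} {act' : T.toFunctor ⋙ K' ⟶ K'}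
  {R : D ⥤ T.Algebra} (P : ModuleAdj K act R) (P' : ModuleAdj K' act' R)

/-- Two left adjoints of the same functor are isomorphic. -/
def uniq : K ≅ K' := P.adj.leftAdjointUniq P'.adj

theorem tr_uniq (X : E) : P.tr ((P.uniq P').hom.app X) = P'.tr (𝟙 (K'.obj X)) :=
  (Adjunction.homEquiv_leftAdjointUniq_hom_app P.adj P'.adj X).trans
    (Adjunction.homEquiv_id P'.adj X).symm

/-- The canonical isomorphism of left adjoints is equivariant because both actions are transposes of
the algebra structures on `R`. -/
theorem act_uniq (X : E) :
    act.app X ≫ (P.uniq P').hom.app X = (P.uniq P').hom.app (T.obj X) ≫ act'.app X := by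
  apply P.tr_injective
  refine (P.tr_act _).trans (Eq.trans ?_ (P.tr_comp _ _).symm)
  refine (congrArg (fun k => T.map k ≫ (R.obj (K'.obj X)).a) (P.tr_uniq P' X)).trans
    (Eq.trans ?_ (congrArg (· ≫ (R.map (act'.app X)).f) (P.tr_uniq P' _)).symm)
  refine (P'.tr_act _).symm.trans (Eq.trans ?_ (P'.tr_comp _ _))
  exact congrArg P'.tr ((Category.comp_id _).trans (Category.id_comp _).symm)

include P P' in
/-- Whether the action is cartesian only depends on the right adjoint. -/
theorem equifibered (h : NatTrans.Equifibered act') : NatTrans.Equifibered act := fun X Y f =>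
  have e : ∀ X, act'.app X ≫ (P.uniq P').inv.app X = (P.uniq P').inv.app (T.obj X) ≫ act.app X :=
    fun X => inv_square (a := (P.uniq P').app X) (b := (P.uniq P').app (T.obj X))
      (P.act_uniq P' X)
  (h f).of_iso ((P.uniq P').symm.app _) ((P.uniq P').symm.app _) ((P.uniq P').symm.app _)
    ((P.uniq P').symm.app _) ((P.uniq P').inv.naturality _) (e X) (e Y)
    ((P.uniq P').inv.naturality _)

/-- Composition with an adjunction. -/
def comp {D' : Type u} [Category.{v} D'] {p : D ⥤ D'} {d : D' ⥤ D} (q : p ⊣ d) :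
    ModuleAdj (T := T) (K ⋙ p) (Functor.whiskerRight act p) (d ⋙ R) where
  adj := P.adj.comp q
  homEquiv_act {X B} f :=
    have e : ∀ {Y : E} (g : p.obj (K.obj Y) ⟶ B), (P.adj.comp q).homEquiv Y B g =
        P.adj.homEquiv Y (d.obj B) (q.homEquiv (K.obj Y) B g) := fun g => by
      rw [Adjunction.comp_homEquiv]; rfl
    (e _).trans (((congrArg (P.adj.homEquiv _ _)
      (q.homEquiv_naturality_left (act.app X) f)).trans (P.homEquiv_act (q.homEquiv _ _ f))).trans
        (congrArg (fun k => T.map k ≫ (R.obj (d.obj B)).a) (e f)).symm)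

end Uniqueness

/-- Both sides equal `f`, by the two unit laws of the monad. -/
theorem free_transpose {E : Type u₂} [Category.{v} E] (T : Monad E) (X : E) (B : T.Algebra)
    (f : T.obj X ⟶ B.A) (h : T.map f ≫ B.a = T.μ.app X ≫ f) :
    T.η.app (T.obj X) ≫ T.μ.app X ≫ f = T.map (T.η.app X ≫ f) ≫ B.a := by
  rw [T.map_comp, Category.assoc, h, T.left_unit_assoc, ← Category.assoc, T.right_unit]
  exact (Category.id_comp f).symm

/-- The free algebra functor with its right action of `T`. -/
def free {E : Type u₂} [Category.{v} E] (T : Monad E) :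
    ModuleAdj T.free (freeAction T) (𝟭 T.Algebra) where
  adj := T.adj
  homEquiv_act {X B} f := by
    have e : ∀ {Y : E} (g : T.free.obj Y ⟶ B), T.adj.homEquiv Y B g = T.η.app Y ≫ g.f :=
      fun g => by simp [Monad.adj]; rfl
    exact (e _).trans ((congrArg (fun k => T.η.app (T.obj X) ≫ k ≫ f.f) (freeAction_app X)).trans
      ((free_transpose T X B f.f f.h).trans (congrArg (fun k => T.map k ≫ B.a) (e f)).symm))

/-- The forgetful functor reflects pullbacks, and it sends these squares to naturality squares of
the multiplication. -/
theorem freeAction_equifibered {E : Type u₂} [Category.{v} E] [HasFiniteLimits E] (T : Monad E)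
    [CartesianMonad T] : NatTrans.Equifibered (freeAction T) := fun X Y f => by
  refine IsPullback.of_map T.forget ((freeAction T).naturality f) ?_
  have h := CartesianMonad.mul_cartesian (T := T) f
  rw [← freeAction_app, ← freeAction_app] at h
  exact h

theorem square_transpose {E : Type u₂} [Category.{v} E] (T : Monad E) {X W W' Z : E}
    (k : X ⟶ W) (s : T.obj W ⟶ W) (g : W ⟶ W') (s' : T.obj W' ⟶ W') (i : W' ⟶ Z)
    (z : T.obj Z ⟶ Z) (h : T.map g ≫ s' = s ≫ g) (h' : s' ≫ i = T.map i ≫ z) :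
    ((T.map k ≫ s) ≫ g) ≫ i = T.map ((k ≫ g) ≫ i) ≫ z := by
  simp only [T.map_comp, Category.assoc, ← h', ← reassoc_of% h]

section Square

variable {C : Type u₁} [Category.{v} C] {E : Type u₂} [Category.{v} E]
  {S : Monad C} {T : Monad E} (Q : AdjSquare S T)

/-- The functor `G = F^S c` with its right action of `T`. -/
def ofSquare : ModuleAdj Q.G Q.action Q.d where
  adj := Q.adjG.ofNatIsoRight Q.comm.symm
  homEquiv_act {X B} f := by
    -- Transposes for U^T d are those for w U^S followed by the inverse of `commIso`, along which
    -- `str` was transported from the structure of `d B`.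
    have e : ∀ {Y : E} (g : Q.G.obj Y ⟶ B), (Q.adjG.ofNatIsoRight Q.comm.symm).homEquiv Y B g =
        Q.adjG.homEquiv Y B g ≫ (Q.commIso B).inv := fun g =>
      Adjunction.homEquiv_ofNatIsoRight_apply _ _ _
    have h₁ : Q.adjG.homEquiv (T.obj X) B (Q.action.app X ≫ f) =
        (T.map (Q.adjG.unit.app X) ≫ Q.str (Q.G.obj X)) ≫ Q.w.map f.f :=
      (Q.adjG.homEquiv_naturality_right _ _).trans
        (congrArg (· ≫ Q.w.map f.f) (Equiv.apply_symm_apply _ _))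
    have h₂ : Q.adjG.homEquiv X B f = Q.adjG.unit.app X ≫ Q.w.map f.f :=
      Q.adjG.homEquiv_unit X B f
    refine (e _).trans (Eq.trans ?_ (congrArg (fun k => T.map k ≫ (Q.d.obj B).a) (e f)).symm)
    refine (congrArg (· ≫ (Q.commIso B).inv) h₁).trans (Eq.trans ?_
      (congrArg (fun k => T.map (k ≫ (Q.commIso B).inv) ≫ (Q.d.obj B).a) h₂).symm)
    exact square_transpose T _ _ _ _ _ _ (Q.str_naturality f) (by
      rw [AdjSquare.str, Category.assoc, Category.assoc, Iso.hom_inv_id, Category.comp_id])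

end Square

end ModuleAdj

/-! ### The representing categorical algebras -/

section Representability

variable {E : Type u₂} [Category.{v} E] {T : Monad E} [HasFiniteLimits E] [CartesianMonad T]

variable (T) in
/-- The categorical `T`-algebra whose nerve is the cotriple resolution of the terminal algebra. -/
def cotripleCat : CAlg T := (ModuleAdj.free T).repr (ModuleAdj.freeAction_equifibered T)

variable (T) in
/-- The cotriple resolution of the terminal algebra. -/
def cotripleNerve : SimplicialObject T.Algebra :=
  ((ModuleAdj.free T).module (ModuleAdj.freeAction_equifibered T)).bar (terminalAlgebra T)

variable (T) in
/-- Internal algebras are represented by the cotriple resolution. -/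
def cotripleRep : TwoRep (IAlg T) (cotripleCat T) :=
  -- This represents `IAlg T` precomposed with the 2-functor induced by the identity; after
  -- unfolding, its fields are those required.
  have ρ := (ModuleAdj.free T).twoRep (ModuleAdj.freeAction_equifibered T)
  { iso := ρ.iso
    natural := ρ.natural
    natural₂ := ρ.natural₂ }

variable (T) in
theorem cotripleCat_isNerve : (cotripleCat T).IsNerve (cotripleNerve T) :=
  CartesianModule.isNerve_bar _ _

variable (T) in
/-- The cotriple resolution is a two-sided bar construction. -/
def cotripleBarIso : BarIso T.free (freeAction T) (terminalAlgebra T) (cotripleNerve T) :=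
  ((ModuleAdj.free T).module (ModuleAdj.freeAction_equifibered T)).barIso (terminalAlgebra T)

variable {C : Type u₁} [Category.{v} C] [HasFiniteLimits C] {S : Monad C}

/-- A left adjoint of `d` takes the representing object of internal algebras to a representing
object of internal algebras over `d`. -/
theorem AdjSquare.exists_twoRep_IAlgOver (Q : AdjSquare S T)
    (hQ : NatTrans.Equifibered Q.action) {p : T.Algebra ⥤ S.Algebra} (q : p ⊣ Q.d)
    {N : SimplicialObject T.Algebra}
    (b : BarIso T.free (freeAction T) (terminalAlgebra T) N) :
    ∃ h : CAlg S, Nonempty (TwoRep Q.IAlgOver h) ∧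
      h.IsNerve (((SimplicialObject.whiskering _ _).obj p).obj N) ∧
      Nonempty (BarIso Q.G Q.action (terminalAlgebra T)
        (((SimplicialObject.whiskering _ _).obj p).obj N)) := by
  let P : ModuleAdj (T.free ⋙ p) (Functor.whiskerRight (freeAction T) p) Q.d :=
    (ModuleAdj.free T).comp q
  -- The functor `p` is not known to preserve pullbacks, so cartesianness is not inherited from
  -- `freeAction T`. It comes from the action on `G` through the uniqueness of left adjoints.
  have hP := P.equifibered (ModuleAdj.ofSquare Q) hQ
  have bP : BarIso (T.free ⋙ p) (Functor.whiskerRight (freeAction T) p) (terminalAlgebra T)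
      (((SimplicialObject.whiskering _ _).obj p).obj N) := b.map p (fun _ => rfl)
  refine ⟨P.repr hP, ⟨P.twoRep hP⟩, ?_, ⟨bP.ofIso _ (P.act_uniq (ModuleAdj.ofSquare Q))⟩⟩
  exact (CartesianModule.isNerve_bar (P.module hP) (terminalAlgebra T)).ofIso
    (BarIso.unique (CartesianModule.barIso (P.module hP) (terminalAlgebra T)) bP)

end Representability

/-! ### Restriction along the classifying map -/

/-- The Yoneda argument compares 2-cells whose ends are only propositionally equal. Heterogeneous
equality avoids carrying the transports. -/
theorem catHom_eqToHom_app_heq {𝒞 𝒟 : Cat.{v, u}} {F G H I : 𝒞 ⟶ 𝒟} (e : F = G) (τ : G ⟶ H)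
    (e' : H = I) (x : 𝒞) :
    HEq ((eqToHom e ≫ τ ≫ eqToHom e').toNatTrans.app x) (τ.toNatTrans.app x) := by
  subst e e'
  rw [eqToHom_refl, eqToHom_refl, Category.id_comp, Category.comp_id]

theorem catHom_ext_of_heq {𝒞 𝒟 : Cat.{v, u}} {F G : 𝒞 ⟶ 𝒟}
    (h : ∀ x, F.toFunctor.obj x = G.toFunctor.obj x)
    (h' : ∀ {x y : 𝒞} (f : x ⟶ y), HEq (F.toFunctor.map f) (G.toFunctor.map f)) : F = G :=
  congrArg Functor.toCatHom (Functor.hext h fun _ _ f => h' f)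

theorem catHom₂_app_heq {𝒞 𝒟 : Cat.{v, u}} {F G : 𝒞 ⟶ 𝒟} (τ : F ⟶ G) {x y : 𝒞} (h : x = y) :
    HEq (τ.toNatTrans.app x) (τ.toNatTrans.app y) := by
  subst h; rfl

theorem catHom_map_heq {𝒞 𝒟 : Cat.{v, u}} (F : 𝒞 ⟶ 𝒟) {x y x' y' : 𝒞} {f : x ⟶ y} {g : x' ⟶ y'}
    (hx : x = x') (hy : y = y') (h : HEq f g) : HEq (F.toFunctor.map f) (F.toFunctor.map g) := by
  subst hx hy
  obtain rfl := eq_of_heq h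
  rfl

/-- In a strict bicategory the unitors are `eqToHom`, hence invisible to heterogeneous equality. -/
theorem CategoryTheory.Bicategory.Strict.id_whiskerLeft_heq {B : Type u} [Bicategory.{v, v} B]
    [Bicategory.Strict B] {X Y : B} {f g : X ⟶ Y} (θ : f ⟶ g) : HEq (𝟙 X ◁ θ) θ := by
  rw [Bicategory.id_whiskerLeft, Strict.leftUnitor_eqToIso, Strict.leftUnitor_eqToIso,
    eqToIso.hom, eqToIso.inv, eqToHom_comp_heq_iff, comp_eqToHom_heq_iff]

namespace TwoRep

variable {B : Type u} [Bicategory.{v, v} B] [Bicategory.Strict B]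
  {F F' : StrictPseudofunctor B Cat.{v, v}} {X Y : B} (ρ : TwoRep F X) (ρ' : TwoRep F' Y)

theorem elt_comp {A A' : B} (f : X ⟶ A) (g : A ⟶ A') :
    ρ.elt (f ≫ g) = (F.map g).toFunctor.obj (ρ.elt f) :=
  Functor.congr_obj (congrArg Cat.Hom.toFunctor (ρ.natural g)) f

theorem eltMap_whiskerLeft {A A' : B} (f : X ⟶ A) {g g' : A ⟶ A'} (θ : g ⟶ g') :
    HEq (ρ.eltMap (f ◁ θ)) ((F.map₂ θ).toNatTrans.app (ρ.elt f)) :=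
  (heq_of_eq (congrArg (fun τ => Cat.Hom₂.toNatTrans τ |>.app f) (ρ.natural₂ θ))).trans
    (catHom_eqToHom_app_heq _ ((ρ.iso A).hom ◁ F.map₂ θ) _ f)

/-- A `2`-natural family of functors between representable `2`-functors is restriction along the
`1`-cell which classifies the image of the universal element. -/
theorem precomp_eq (t : ∀ A, F.obj A ⟶ F'.obj A)
    (nat : ∀ {A A' : B} (g : A ⟶ A'), F.map g ≫ t A' = t A ≫ F'.map g)
    (nat₂ : ∀ {A A' : B} {g g' : A ⟶ A'} (θ : g ⟶ g') (x : F.obj A),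
      HEq ((t A').toFunctor.map ((F.map₂ θ).toNatTrans.app x))
        ((F'.map₂ θ).toNatTrans.app ((t A).toFunctor.obj x))) (A : B) :
    (precomposingCat Y X A).obj (ρ'.classify ((t X).toFunctor.obj (ρ.elt (𝟙 X)))) ≫
      (ρ'.iso A).hom = (ρ.iso A).hom ≫ t A := by
  have hz : ρ'.elt (ρ'.classify ((t X).toFunctor.obj (ρ.elt (𝟙 X)))) =
    (t X).toFunctor.obj (ρ.elt (𝟙 X)) := ρ'.elt_classify _
  -- Only the element that `z` classifies matters from here on.
  generalize ρ'.classify ((t X).toFunctor.obj (ρ.elt (𝟙 X))) = z at hz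
  have hobj : ∀ f : X ⟶ A, (F.map f).toFunctor.obj (ρ.elt (𝟙 X)) = ρ.elt f := fun f =>
    (ρ.elt_comp (𝟙 X) f).symm.trans (congrArg ρ.elt (Strict.id_comp f))
  have h : ∀ f : X ⟶ A, ρ'.elt (z ≫ f) = (t A).toFunctor.obj (ρ.elt f) := fun f =>
    (ρ'.elt_comp z f).trans ((congrArg (F'.map f).toFunctor.obj hz).trans
      ((Functor.congr_obj (congrArg Cat.Hom.toFunctor (nat f)) (ρ.elt (𝟙 X))).symm.trans
        (congrArg (t A).toFunctor.obj (hobj f))))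
  refine catHom_ext_of_heq h fun {f g} θ => ?_
  refine (ρ'.eltMap_whiskerLeft z θ).trans ((catHom₂_app_heq (F'.map₂ θ) hz).trans
    ((nat₂ θ _).symm.trans (catHom_map_heq (t A) (hobj f) (hobj g) ?_)))
  -- Writing `θ` as its whiskering with `𝟙 X` reduces the claim to the universal element.
  refine (ρ.eltMap_whiskerLeft (𝟙 X) θ).symm.trans ?_
  exact catHom_map_heq (ρ.iso A).hom (Strict.id_comp f) (Strict.id_comp g)
    (Strict.id_whiskerLeft_heq θ)

end TwoRep

/-! ### Strict 2-naturality of `δ` -/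

namespace AdjSquare

variable {C : Type u₁} [Category.{v} C] {E : Type u₂} [Category.{v} E]
  {S : Monad C} {T : Monad E} (Q : AdjSquare S T)

/-- On underlying objects, structure cells and transformations alike, `δ` is conjugation of `w` by
fixed maps and the inverse of `commIso`. Naturality of the latter is thus the whole content of
2-naturality. -/
theorem delta_transpose {X : C} {M N : S.Algebra} (k : X ⟶ M.A) (i : M ⟶ N) {Y Z : E}
    (m : Z ⟶ Y) (l : Y ⟶ Q.w.obj X) :
    m ≫ l ≫ Q.w.map (k ≫ i.f) ≫ (Q.commIso N).inv =
      (m ≫ l ≫ Q.w.map k ≫ (Q.commIso M).inv) ≫ (Q.d.map i).f := by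
  rw [aux_unit]; simp only [Category.assoc]

variable [HasFiniteLimits C] [HasFiniteLimits E] [CartesianMonad S] [CartesianMonad T]

theorem delta_obj_cell_app {A : CAlg S} (f : (IAlg S).obj A) :
    Trans.app (LaxMor.cell ((Q.delta A).toFunctor.obj f)) =
      T.map (Fun.obj Q.oneComparison).f ≫
        (T.map (Q.commIso (oneCAlg S).obj).hom ≫ Q.distApp (oneCAlg S).obj.A) ≫
          Q.w.map (Trans.app (LaxMor.cell f)) ≫ (Q.commIso A.mor).inv :=
  (LaxMor.precompCell_app Q.oneComparison (Q.dLax f)).trans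
    (congrArg (fun k => T.map (Fun.obj Q.oneComparison).f ≫ k) (Q.dCell_app f))

theorem delta_postcomp {A A' : CAlg S} (g : A ⟶ A') (f : (IAlg S).obj A) :
    (Q.delta A').toFunctor.obj (((IAlg S).map g).toFunctor.obj f) =
      (Q.IAlgOver.map g).toFunctor.obj ((Q.delta A).toFunctor.obj f) :=
  laxOne_ext (B := Q.dObj A')
    (Q.delta_transpose (Fun.obj (LaxMor.functor f)) (Fun.obj g) _ _)
    ((Q.delta_obj_cell_app _).trans
      (((congrArg (fun k => T.map (Fun.obj Q.oneComparison).f ≫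
        (T.map (Q.commIso (oneCAlg S).obj).hom ≫ Q.distApp (oneCAlg S).obj.A) ≫
          Q.w.map k ≫ (Q.commIso A'.mor).inv) (LaxMor.postcompCell_app f g)).trans
        (Q.delta_transpose (Trans.app (LaxMor.cell f)) (Fun.mor g) _ _)).trans
        ((congrArg (· ≫ (Q.d.map (Fun.mor g)).f) (Q.delta_obj_cell_app f)).symm.trans
          (LaxMor.postcompCell_app ((Q.delta A).toFunctor.obj f) (mapHom Q.d g)).symm)))

theorem delta_natural {A A' : CAlg S} (g : A ⟶ A') :
    (IAlg S).map g ≫ Q.delta A' = Q.delta A ≫ Q.IAlgOver.map g :=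
  congrArg Functor.toCatHom (functor_laxMor_ext
    (F := ((IAlg S).map g ≫ Q.delta A').toFunctor)
    (G := (Q.delta A ≫ Q.IAlgOver.map g).toFunctor)
    (fun f => Q.delta_postcomp g f)
    (fun α => Q.delta_transpose (Trans.app (LaxTrans.trans α)) (Fun.mor g) _ _))

theorem laxTrans_heq {A B : CAlg T} {f g f' g' : LaxMor A B} {α : f ⟶ g} {β : f' ⟶ g'}
    (hf : f = f') (hg : g = g')
    (h : Trans.app (LaxTrans.trans α) = Trans.app (LaxTrans.trans β)) : HEq α β := by
  subst hf hg
  exact heq_of_eq (LaxMor.trans_ext' h)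

theorem delta_natural₂ {A A' : CAlg S} {g g' : A ⟶ A'} (θ : g ⟶ g') (f : (IAlg S).obj A) :
    HEq ((Q.delta A').toFunctor.map (((IAlg S).map₂ θ).toNatTrans.app f))
      ((Q.IAlgOver.map₂ θ).toNatTrans.app ((Q.delta A).toFunctor.obj f)) :=
  laxTrans_heq (Q.delta_postcomp g f) (Q.delta_postcomp g' f)
    (Q.delta_transpose (Fun.obj (LaxMor.functor f)) (Trans.app θ) _ _)

/-- Yoneda for the 2-natural family `δ`; `zeta` is by definition the 1-cell classifying the image of
the universal element. -/
theorem deltaIsRestriction {HS h : CAlg S} (ρS : TwoRep (IAlg S) HS)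
    (ρ : TwoRep Q.IAlgOver h) : Q.DeltaIsRestriction ρS ρ := fun A =>
  ρS.precomp_eq ρ Q.delta Q.delta_natural Q.delta_natural₂ A

end AdjSquare

/-! ### Left adjoints and Kan extensions -/

section Universal

variable {𝒳 : Type u₁} [Category.{v} 𝒳] {𝒴 : Type u₁} [Category.{v} 𝒴]
  {𝒜 : Type u₂} [Category.{v} 𝒜] {ℬ : Type u₂} [Category.{v} ℬ]
  {P : 𝒳 ⥤ 𝒴} {r : 𝒴 ⥤ ℬ} {s : 𝒳 ⥤ 𝒜} {δ : 𝒜 ⥤ ℬ} (H : P ⋙ r = s ⋙ δ)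
  {L : ℬ ⥤ 𝒜} (adj : L ⊣ δ) {y : 𝒴} {x : 𝒳} (hx : L.obj (r.obj y) = s.obj x)
  {k : y ⟶ P.obj x} {e : δ.obj (L.obj (r.obj y)) = r.obj (P.obj x)}
  (hk : r.map k = adj.unit.app (r.obj y) ≫ eqToHom e)

include hk in
-- Under `r` and `s`, the passage from `φ` to `k` followed by `P φ` is the hom bijection of the
-- adjunction, up to `eqToHom`. Existence and uniqueness in the universal property both follow.
theorem map_comp_eq_homEquiv {z : 𝒳} (φ : x ⟶ z) :
    r.map (k ≫ P.map φ) = adj.homEquiv _ _ (eqToHom hx ≫ s.map φ) ≫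
      eqToHom (Functor.congr_obj H z).symm := by
  have h := Functor.congr_hom H φ
  dsimp only [Functor.comp_map, Functor.comp_obj] at h
  rw [r.map_comp, hk, h, Adjunction.homEquiv_unit, δ.map_comp, eqToHom_map]
  simp

include H hx hk in
/-- Universal arrows are transported along an isomorphism of functors. -/
theorem isUniversal_of_adjunction (hr : r.FullyFaithful) (hs : s.FullyFaithful) :
    Nonempty (StructuredArrow.IsUniversal (StructuredArrow.mk (T := P) k)) := by
  -- The factorization is the adjoint transpose of `r t`, lifted through the full functor `s`.
  have ex : ∀ t : StructuredArrow y P, ∃ φ : x ⟶ t.right, k ≫ P.map φ = t.hom := fun t => by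
    refine ⟨hs.preimage (eqToHom hx.symm ≫ (adj.homEquiv _ _).symm
      (r.map t.hom ≫ eqToHom (Functor.congr_obj H t.right))), hr.map_injective ?_⟩
    rw [map_comp_eq_homEquiv H adj hx hk, hs.map_preimage, eqToHom_trans_assoc,
      eqToHom_refl, Category.id_comp, Equiv.apply_symm_apply]
    simp
  refine ⟨IsInitial.ofUniqueHom (fun t => StructuredArrow.homMk (ex t).choose (ex t).choose_spec)
    fun t τ => ?_⟩
  refine StructuredArrow.hom_ext _ _ (hs.map_injective ?_)
  have h := congrArg r.map ((StructuredArrow.w τ).trans (ex t).choose_spec.symm)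
  have h' := (map_comp_eq_homEquiv H adj hx hk _).symm.trans
    (h.trans (map_comp_eq_homEquiv H adj hx hk _))
  exact (cancel_epi _).1 ((adj.homEquiv _ _).injective ((cancel_mono _).1 h'))

end Universal

theorem catIso_isEquivalence {𝒞 𝒟 : Cat.{v, u}} (e : 𝒞 ≅ 𝒟) : e.hom.toFunctor.IsEquivalence :=
  (Cat.equivOfIso e).isEquivalence_functor

/-- Isomorphisms of categories are fully faithful. -/
def catIsoFullyFaithful {𝒞 𝒟 : Cat.{v, u}} (e : 𝒞 ≅ 𝒟) : e.hom.toFunctor.FullyFaithful :=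
  (Cat.equivOfIso e).fullyFaithfulFunctor

/-- Each of `P` and `δ` is the other one conjugated by isomorphisms of categories, which are right
adjoints. -/
theorem isRightAdjoint_iff_of_square {𝒳 𝒴 𝒜 ℬ : Cat.{v, u}} {P : 𝒳 ⟶ 𝒴} {δ : 𝒜 ⟶ ℬ}
    (r : 𝒴 ≅ ℬ) (s : 𝒳 ≅ 𝒜) (H : P ≫ r.hom = s.hom ≫ δ) :
    δ.toFunctor.IsRightAdjoint ↔ P.toFunctor.IsRightAdjoint := by
  have hr := catIso_isEquivalence r
  have hs := catIso_isEquivalence s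
  have hr' := catIso_isEquivalence r.symm
  have hs' := catIso_isEquivalence s.symm
  constructor
  · intro _
    have h : P = s.hom ≫ δ ≫ r.symm.hom := by
      rw [← Category.assoc, ← H, Category.assoc]; simp
    rw [h]
    exact inferInstanceAs ((s.hom.toFunctor ⋙ δ.toFunctor ⋙ r.symm.hom.toFunctor).IsRightAdjoint)
  · intro _
    have h : δ = s.symm.hom ≫ P ≫ r.hom := by
      rw [H]; simp
    rw [h]
    exact inferInstanceAs ((s.symm.hom.toFunctor ⋙ P.toFunctor ⋙ r.hom.toFunctor).IsRightAdjoint)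

namespace AdjSquare

variable {C : Type u₁} [Category.{v} C] {E : Type u₂} [Category.{v} E]
  {S : Monad C} {T : Monad E} {Q : AdjSquare S T}
  [HasFiniteLimits C] [HasFiniteLimits E] [CartesianMonad S] [CartesianMonad T]
  {HS h : CAlg S} {ρS : TwoRep (IAlg S) HS} {ρ : TwoRep Q.IAlgOver h}
  (H : Q.DeltaIsRestriction ρS ρ)

/-- A left adjoint of `δ` is given by left Kan extension along `ζ`. -/
theorem DeltaIsRestriction.exists_isKan {A : CAlg S} (L : Q.IAlgOver.obj A ⥤ (IAlg S).obj A)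
    (adj : L ⊣ (Q.delta A).toFunctor) (f : h ⟶ A) :
    ∃ k : f ⟶ Q.zeta ρS ρ ≫ ρS.classify (L.obj (ρ.elt f)),
      ρ.eltMap k = adj.unit.app (ρ.elt f) ≫ eqToHom (H.elt_comp (L.obj (ρ.elt f))) ∧
      Nonempty (Bicategory.LeftExtension.IsKan (Bicategory.LeftExtension.mk _ k)) :=
  have hr := catIsoFullyFaithful (ρ.iso A)
  -- The 2-cell is the preimage of the unit under the representing isomorphism; being a Kan
  -- extension means being initial among structured arrows from `f` to precomposition with `ζ`.
  ⟨hr.preimage (adj.unit.app (ρ.elt f) ≫ eqToHom (H.elt_comp (L.obj (ρ.elt f)))),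
    hr.map_preimage _,
    isUniversal_of_adjunction (P := Bicategory.precomp A (Q.zeta ρS ρ))
      (congrArg Cat.Hom.toFunctor (H A)) adj (ρS.elt_classify _).symm (hr.map_preimage _) hr
      (catIsoFullyFaithful (ρS.iso A))⟩

include H in
/-- `δ` has a left adjoint if and only if all left Kan extensions along `ζ` exist. -/
theorem DeltaIsRestriction.isRightAdjoint_iff (A : CAlg S) :
    (Q.delta A).toFunctor.IsRightAdjoint ↔
      ∀ f : h ⟶ A, Bicategory.HasLeftKanExtension (Q.zeta ρS ρ) f :=
  (isRightAdjoint_iff_of_square (ρ.iso A) (ρS.iso A) (H A)).trans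
    -- Precomposition with `ζ` has a left adjoint exactly when each such category of structured
    -- arrows has an initial object.
    (isRightAdjoint_iff_hasInitial_structuredArrow.trans
      (forall_congr' fun _ => ⟨fun i => ⟨i⟩, fun i => i.hasInitial⟩))

end AdjSquare

/-- In the last clause the representing objects and representations are arbitrary. The third part is
an existential over its proof `H` because the formula for the 2-cell in the fourth part needs `H` to
identify the target of the unit. -/
theorem mainTheorem8 {C : Type u₁} [Category.{v} C] {E : Type u₂} [Category.{v} E]
    [HasFiniteLimits C] [HasFiniteLimits E] [HasColimits C] [HasColimits E]
    (S : Monad C) (T : Monad E) [CartesianMonad S] [CartesianMonad T]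
    [PreservesFilteredColimits S.toFunctor] [PreservesFilteredColimits T.toFunctor]
    (Q : AdjSquare S T) (hQ : NatTrans.Equifibered Q.action) :
    Q.d.IsRightAdjoint ∧
    (∃ (HT : CAlg T) (N : SimplicialObject T.Algebra),
      Nonempty (TwoRep (IAlg T) HT) ∧ HT.IsNerve N ∧
      Nonempty (BarIso T.free (freeAction T) (terminalAlgebra T) N) ∧
      ∀ (p : T.Algebra ⥤ S.Algebra) (_ : p ⊣ Q.d), ∃ h : CAlg S,
        Nonempty (TwoRep Q.IAlgOver h) ∧
        h.IsNerve (((SimplicialObject.whiskering _ _).obj p).obj N) ∧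
        Nonempty (BarIso Q.G Q.action (terminalAlgebra T)
          (((SimplicialObject.whiskering _ _).obj p).obj N))) ∧
    (∃ (HS : CAlg S) (N : SimplicialObject S.Algebra),
      Nonempty (TwoRep (IAlg S) HS) ∧ HS.IsNerve N ∧
      Nonempty (BarIso S.free (freeAction S) (terminalAlgebra S) N)) ∧
    (∀ (HS h : CAlg S) (ρS : TwoRep (IAlg S) HS) (ρ : TwoRep Q.IAlgOver h),
      ∃ H : Q.DeltaIsRestriction ρS ρ, ∀ A : CAlg S,
        (∀ (L : Q.IAlgOver.obj A ⥤ (IAlg S).obj A) (adj : L ⊣ (Q.delta A).toFunctor)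
          (f : h ⟶ A),
          ∃ u : f ⟶ Q.zeta ρS ρ ≫ ρS.classify (L.obj (ρ.elt f)),
            ρ.eltMap u = adj.unit.app (ρ.elt f) ≫ eqToHom (H.elt_comp (L.obj (ρ.elt f))) ∧
            Nonempty (Bicategory.LeftExtension.IsKan (Bicategory.LeftExtension.mk _ u))) ∧
        ((Q.delta A).toFunctor.IsRightAdjoint ↔
          ∀ f : h ⟶ A, Bicategory.HasLeftKanExtension (Q.zeta ρS ρ) f)) :=
  ⟨Q.d_isRightAdjoint,
    ⟨cotripleCat T, cotripleNerve T, ⟨cotripleRep T⟩, cotripleCat_isNerve T, ⟨cotripleBarIso T⟩,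
      fun _ q => Q.exists_twoRep_IAlgOver hQ q (cotripleBarIso T)⟩,
    ⟨cotripleCat S, cotripleNerve S, ⟨cotripleRep S⟩, cotripleCat_isNerve S, ⟨cotripleBarIso S⟩⟩,
    fun _ _ ρS ρ => ⟨Q.deltaIsRestriction ρS ρ, fun A =>
      ⟨fun L adj f => (Q.deltaIsRestriction ρS ρ).exists_isKan L adj f,
        (Q.deltaIsRestriction ρS ρ).isRightAdjoint_iff A⟩⟩⟩

end
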